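/- Let $n\ge 1$, $T>0$, $s>1$, and consider the Cauchy problem on $[0,T]\times\mathbb R^n$ \[ \partial_t^2u-\sum_{i=1}^n a_i(t)\partial_{x_i}^2u+\sum_{i=1}^n c_i(t)\partial_{x_i}u+d(t)\partial_tu+e(t)u=f(t,x),\qquad u(0,x)=g_0(x),\quad \partial_tu(0,x)=g_1(x), \] where $a_i,c_i,d,e$ are distributions on $\mathbb R$ with compact support contained in $[0,T]$, the $a_i$ are real-valued and $a_i\ge 0$, $f\in C([0,T];\mathcal E'(\mathbb R^n))$ and $g_0,g_1\in\mathcal E'(\mathbb R^n)$. Regularisation. Let $\psi\in C_c^\infty(\mathbb R)$, $\psi\ge0$, $\int\psi=1$, and $\psi_\delta(t)=\delta^{-1}\psi(t/\delta)$. Let $\phi$ be smooth on $\mathbb R^n$ with $|x^\beta\partial^\alpha\phi(x)|\le C^{|\alpha|+|\beta|+1}(\alpha!)^s(\beta!)^s$ for all $\alpha,\beta,x$ (Gelfand--Shilov class of order $s$), $\int\phi=1$ and $\int x^\alpha\phi(x)\,dx=0$ for $\alpha\ne0$; let $\chi$ be a Gevrey function of order $s$ with $0\le\chi\le1$, $\chi(x)=1$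 for $|x|\le1$ and $\chi(x)=0$ for $|x|\ge2$; put $\rho_\delta(x)=\delta^{-n}\phi(x/\delta)\chi(x|\ln\delta|)$. A scale of logarithmic type with exponent $p>0$ is a function $\omega:(0,1]\to(0,\infty)$ with $c_2\varepsilon^r\le\omega(\varepsilon)\le c_1$ for some $c_1,c_2,r>0$ and all $\varepsilon\in(0,1]$, and $\omega(\varepsilon)^{-1}=(\ln\varepsilon^{-1})^{p}$ for all small $\varepsilon$. Given scales $\omega,\nu$ set $a_{i,\varepsilon}=a_i*\psi_{\omega(\varepsilon)}$, $c_{i,\varepsilon}=c_i*\psi_{\nu(\varepsilon)}$, $d_\varepsilon=d*\psi_{\nu(\varepsilon)}$, $e_\varepsilon=e*\psi_{\nu(\varepsilon)}$, $g_{j,\varepsilon}=g_j*\rho_{\omega(\varepsilon)}$ and $f_\varepsilon(t,x)=\int_0^T\psi_{\omega(\varepsilon)}(t-\tau)\,(f(\tau)*\rho_{\omega(\varepsilon)})(x)\,d\tau$. Levi conditions. We say that they hold with exponents $(p,q)$ if, for $\omega,\nu$ of logarithmic type with exponents $p,q$, there are $c_1,c_2,R>0$ such that for all sufficiently small $\varepsilon$,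 all $t\in[0,T]$ and all $\xi\in\mathbb R^n$ with $|\xi|\ge R$ \[ \Bigl|\mathrm i\sum_{i=1}^n c_{i,\varepsilon}(t)\xi_i+e_\varepsilon(t)\Bigr|^2\le c_1(\ln\varepsilon^{-1})^2\Bigl(2\sum_{i=1}^n a_{i,\varepsilon}(t)\xi_i^2\Bigr),\qquad |d_\varepsilon(t)|^2\le c_2(\ln\varepsilon^{-1})^2 . \] Very weak solution. The problem has a very weak solution of order $s$ with exponents $(p,q)$ if there are scales $\omega,\nu$ of logarithmic type with exponents $p,q$ and a net $(u_\varepsilon)_{\varepsilon\in(0,1]}$ in $C^\infty([0,T];\gamma^s(\mathbb R^n))$, where $\gamma^s$ is the Gevrey class of order $s$, such that the regularised coefficients are $C^\infty$-moderate, $g_{0,\varepsilon},g_{1,\varepsilon}$ are $\gamma^s$-moderate, $f_\varepsilon$ is $C^\infty([0,T];\gamma^s)$-moderate, $u_\varepsilon$ solves, for every $\varepsilon\in(0,1]$, the Cauchy problem in which all coefficients and data are replaced by their regularisations, and $(u_\varepsilon)$ is $C^\infty([0,T];\gamma^s)$-moderate. Here a net $(v_\varepsilon)$ of smooth functions is: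 $C^\infty$-moderate if on every compact set each derivative is bounded by $c\,\varepsilon^{-N}$ ($c,N$ depending on the compact set and the derivative); $\gamma^s$-moderate if for every compact $K$ there are $c,N$ with $|\partial^\alpha v_\varepsilon|\le c^{|\alpha|+1}(\alpha!)^s\varepsilon^{-N-|\alpha|}$ on $K$ for all $\alpha,\varepsilon$; $C^\infty([0,T];\gamma^s)$-moderate if for every compact $K$ there are $c,N$ and, for every $k$, $c_k,N_k$ with $|\partial_t^k\partial_x^\alpha v_\varepsilon|\le c_k\varepsilon^{-N_k}c^{|\alpha|+1}(\alpha!)^s\varepsilon^{-N-|\alpha|}$ on $[0,T]\times K$ for all $\alpha,\varepsilon$. Theorem. There is $p_0>0$ such that, whenever $p,q>0$ and the Levi conditions hold with exponents $(p,q)$, the Cauchy problem has a very weak solution of order $s$ with exponents $(\theta p,\theta q)$ for every $\theta\in(0,1]$ with $\theta p\le p_0$ and $\theta q\le p_0$. In particular, if the Levi conditions hold for some scales of logarithmic type, the Cauchy problem has a very weak solution of order $s$. -/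

import Mathlib

open Set Filter Topology MeasureTheory
open scoped SchwartzMap ContDiff

noncomputable section

namespace VeryWeak

/-- The space `ℝⁿ` with its Euclidean norm. -/
abbrev Sp (n : ℕ) := EuclideanSpace ℝ (Fin n)

/-! ### Compactly supported distributions

A compactly supported distribution is a tempered distribution `u` whose distributional support
`Distribution.dsupport u` is compact: `ℰ'(ℝⁿ) = {u ∈ 𝓢'(ℝⁿ) : supp u compact}`. -/

/-- `u ∈ ℰ'(ℝⁿ)`. -/
def IsCompactlySupported {n : ℕ} (u : 𝓢'(Sp n, ℂ)) : Prop :=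
  IsCompact (Distribution.dsupport u)

/-- A distribution on the line that is real-valued and nonnegative. -/
structure IsRealNonneg (u : 𝓢'(ℝ, ℂ)) : Prop where
  real : ∀ φ : 𝓢(ℝ, ℂ), (∀ x, (φ x).im = 0) → (u φ).im = 0
  nonneg : ∀ φ : 𝓢(ℝ, ℂ), (∀ x, 0 ≤ (φ x).re ∧ (φ x).im = 0) → 0 ≤ (u φ).re

/-- `f ∈ C([0,T]; ℰ'(ℝⁿ))`.  A continuous curve on a compact interval has a bounded image in
`ℰ'(ℝⁿ)`, and bounded subsets of `ℰ'(ℝⁿ)` consist of distributions with supports in one compact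
set; for curves with supports in a fixed compact set, continuity into `ℰ'(ℝⁿ)` (weak or strong)
is continuity of the pairing with every test function. -/
def IsContinuousCurve {n : ℕ} (T : ℝ) (f : ℝ → 𝓢'(Sp n, ℂ)) : Prop :=
  (∃ K : Set (Sp n), IsCompact K ∧ ∀ t ∈ Icc 0 T, Distribution.dsupport (f t) ⊆ K) ∧
    ∀ φ : 𝓢(Sp n, ℂ), ContinuousOn (fun t => f t φ) (Icc 0 T)

section Convolution

variable {E : Type*} [NormedAddCommGroup E] [NormedSpace ℝ E]

open Classical in
/-- The convolution `(u ∗ θ)(x) = u_y (θ (x - y))` of a tempered distribution with a Schwartz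
function `θ` (given as an unbundled function; the value is `0` if `θ` is not a Schwartz
function). -/
def conv (u : 𝓢'(E, ℂ)) (θ : E → ℂ) (x : E) : ℂ :=
  if h : ∃ φ : 𝓢(E, ℂ), ∀ y, φ y = θ (x - y) then u h.choose else 0

theorem conv_eq (u : 𝓢'(E, ℂ)) (θ : E → ℂ) (x : E) (φ : 𝓢(E, ℂ))
    (hφ : ∀ y, φ y = θ (x - y)) : conv u θ x = u φ := by
  have h : ∃ φ : 𝓢(E, ℂ), ∀ y, φ y = θ (x - y) := ⟨φ, hφ⟩
  have key : h.choose = φ := by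
    ext y
    rw [h.choose_spec y, hφ y]
  rw [conv, dif_pos h, key]

end Convolution

/-! ### Mollifiers and scales -/

/-- A nonnegative Friedrichs mollifier on the line: `ψ ∈ C_c^∞(ℝ)`, `ψ ≥ 0`, `∫ ψ = 1`. -/
structure IsFriedrichsMollifier (ψ : ℝ → ℝ) : Prop where
  smooth : ContDiff ℝ ∞ ψ
  compactSupport : HasCompactSupport ψ
  nonneg : ∀ t, 0 ≤ ψ t
  integral_eq_one : ∫ t, ψ t = 1

/-- `ψ_δ(t) = δ⁻¹ ψ(t/δ)`, as a complex-valued function. -/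
def dilate (ψ : ℝ → ℝ) (δ : ℝ) (t : ℝ) : ℂ := ((δ⁻¹ * ψ (t / δ) : ℝ) : ℂ)

/-- The pair of a function `φ` in the Gelfand-Shilov space of order `σ` with `∫ φ = 1` and all
higher moments vanishing, and a cut-off `χ` of Gevrey class `σ`, from which the mollifier of
order `σ` is built.

Here and below, bounds on all partial derivatives `∂^α` with `|α| = m` by `c^(m+1) (α!)^σ` are
written as bounds on the norm of the `m`-th Fréchet derivative by `c^(m+1) (m!)^σ`; since
`α! ≤ |α|! ≤ n^|α| α!`, the two families of conditions are the same up to the value of `c`. -/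
structure IsGevreyMollifierPair {n : ℕ} (σ : ℝ) (φ : Sp n → ℂ) (χ : Sp n → ℝ) : Prop where
  smooth : ContDiff ℝ ∞ φ
  gelfandShilov : ∃ C > 0, ∀ (k m : ℕ) (x : Sp n),
    ‖x‖ ^ k * ‖iteratedFDeriv ℝ m φ x‖ ≤
      C ^ (k + m + 1) * (k.factorial : ℝ) ^ σ * (m.factorial : ℝ) ^ σ
  integral_eq_one : ∫ x, φ x = 1
  moments : ∀ α : Fin n → ℕ, α ≠ 0 → ∫ x, (∏ i, ((x i : ℝ) : ℂ) ^ α i) * φ x = 0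
  cutoff_smooth : ContDiff ℝ ∞ χ
  cutoff_gevrey : ∀ K : Set (Sp n), IsCompact K → ∃ c > 0, ∀ m : ℕ, ∀ x ∈ K,
    ‖iteratedFDeriv ℝ m χ x‖ ≤ c ^ (m + 1) * (m.factorial : ℝ) ^ σ
  cutoff_mem : ∀ x, χ x ∈ Icc (0 : ℝ) 1
  cutoff_one : ∀ x, ‖x‖ ≤ 1 → χ x = 1
  cutoff_zero : ∀ x, 2 ≤ ‖x‖ → χ x = 0

/-- The mollifier of order `σ` at scale `δ`: `ρ_δ(x) = δ⁻ⁿ φ(x/δ) χ(x |ln δ|)`. -/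
def gevreyMollifier {n : ℕ} (φ : Sp n → ℂ) (χ : Sp n → ℝ) (δ : ℝ) (x : Sp n) : ℂ :=
  (((δ ^ n)⁻¹ : ℝ) : ℂ) * φ (δ⁻¹ • x) * ((χ (|Real.log δ| • x) : ℝ) : ℂ)

/-- A scale of logarithmic type with exponent `p`: a positive net `μ` on `(0,1]`
(`c₂ ε^r ≤ μ(ε) ≤ c₁`) such that `μ(ε)⁻¹ = (ln ε⁻¹)^p` for all small `ε`. -/
structure IsLogScale (p : ℝ) (μ : ℝ → ℝ) : Prop where
  positive_net : ∃ c₁ > 0, ∃ c₂ > 0, ∃ r > 0, ∀ ε ∈ Ioc (0 : ℝ) 1,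
    c₂ * ε ^ r ≤ μ ε ∧ μ ε ≤ c₁
  log_type : ∀ᶠ ε in 𝓝[>] (0 : ℝ), (μ ε)⁻¹ = Real.log ε⁻¹ ^ p

/-! ### Moderate nets (indexed by `ε ∈ (0,1]`) -/

/-- A `C^∞`-moderate net of functions on the line. -/
structure IsSmoothModerate (v : ℝ → ℝ → ℂ) : Prop where
  smooth : ∀ ε ∈ Ioc (0 : ℝ) 1, ContDiff ℝ ∞ (v ε)
  moderate : ∀ K : Set ℝ, IsCompact K → ∀ k : ℕ, ∃ N : ℕ, ∃ c > 0,
    ∀ ε ∈ Ioc (0 : ℝ) 1, ∀ t ∈ K, ‖iteratedDeriv k (v ε) t‖ ≤ c * (ε ^ N)⁻¹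

/-- A `γ^s`-moderate net of functions on `ℝⁿ`. -/
structure IsGevreyModerate {n : ℕ} (s : ℝ) (v : ℝ → Sp n → ℂ) : Prop where
  smooth : ∀ ε ∈ Ioc (0 : ℝ) 1, ContDiff ℝ ∞ (v ε)
  moderate : ∀ K : Set (Sp n), IsCompact K → ∃ c > 0, ∃ N : ℕ,
    ∀ ε ∈ Ioc (0 : ℝ) 1, ∀ m : ℕ, ∀ x ∈ K,
      ‖iteratedFDeriv ℝ m (v ε) x‖ ≤ c ^ (m + 1) * (m.factorial : ℝ) ^ s * (ε ^ (N + m))⁻¹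

/-- A `C^∞([0,T]; γ^s(ℝⁿ))`-moderate net; the bound for a fixed `ε` expresses membership of
`v ε` in `C^∞([0,T]; γ^s(ℝⁿ))`.  Time derivatives are one-sided at the end points. -/
structure IsTimeGevreyModerate {n : ℕ} (T s : ℝ) (v : ℝ → ℝ → Sp n → ℂ) : Prop where
  smooth : ∀ ε ∈ Ioc (0 : ℝ) 1,
    ContDiffOn ℝ ∞ (fun z : ℝ × Sp n => v ε z.1 z.2) (Icc 0 T ×ˢ univ)
  moderate : ∀ K : Set (Sp n), IsCompact K → ∃ N : ℕ, ∃ c > 0, ∀ k : ℕ, ∃ Nk : ℕ, ∃ ck > 0,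
    ∀ ε ∈ Ioc (0 : ℝ) 1, ∀ m : ℕ, ∀ t ∈ Icc 0 T, ∀ x ∈ K,
      ‖iteratedDerivWithin k (fun τ => iteratedFDeriv ℝ m (v ε τ) x) (Icc 0 T) t‖ ≤
        ck * (ε ^ Nk)⁻¹ * (c ^ (m + 1) * (m.factorial : ℝ) ^ s * (ε ^ (N + m))⁻¹)

/-! ### Very weak solutions -/

/-- The partial derivative `∂_{x_i} v`. -/
def pd {n : ℕ} (i : Fin n) (v : Sp n → ℂ) (x : Sp n) : ℂ :=
  fderiv ℝ v x (EuclideanSpace.single i 1)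

/-- The net `u` is a very weak solution of order `s` on `[0,T] × ℝⁿ` for the equation
`∂_t² u - ∑ a_i ∂_{x_i}² u + ∑ c_i ∂_{x_i} u + d ∂_t u + e u = f`, `u(0) = g₀`, `∂_t u(0) = g₁`,
with respect to the nets of regularised coefficients `a, c, d, e`, right-hand side `f` and
initial data `g₀, g₁` (the first argument of every net is `ε`): these nets are moderate, `u`
solves the regularised problem for every `ε ∈ (0,1]`, and `u` is moderate. -/
structure IsVeryWeakSolution {n : ℕ} (T s : ℝ) (a c : Fin n → ℝ → ℝ → ℂ) (d e : ℝ → ℝ → ℂ)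
    (f : ℝ → ℝ → Sp n → ℂ) (g₀ g₁ : ℝ → Sp n → ℂ) (u : ℝ → ℝ → Sp n → ℂ) : Prop where
  moderate_a : ∀ i, IsSmoothModerate (a i)
  moderate_c : ∀ i, IsSmoothModerate (c i)
  moderate_d : IsSmoothModerate d
  moderate_e : IsSmoothModerate e
  moderate_f : IsTimeGevreyModerate T s f
  moderate_g₀ : IsGevreyModerate s g₀
  moderate_g₁ : IsGevreyModerate s g₁
  equation : ∀ ε ∈ Ioc (0 : ℝ) 1, ∀ t ∈ Icc 0 T, ∀ x : Sp n,
    iteratedDerivWithin 2 (fun τ => u ε τ x) (Icc 0 T) t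
      - ∑ i, a i ε t * pd i (pd i (u ε t)) x
      + ∑ i, c i ε t * pd i (u ε t) x
      + d ε t * derivWithin (fun τ => u ε τ x) (Icc 0 T) t
      + e ε t * u ε t x = f ε t x
  initial_value : ∀ ε ∈ Ioc (0 : ℝ) 1, ∀ x : Sp n, u ε 0 x = g₀ ε x
  initial_velocity : ∀ ε ∈ Ioc (0 : ℝ) 1, ∀ x : Sp n,
    derivWithin (fun τ => u ε τ x) (Icc 0 T) 0 = g₁ ε x
  moderate_u : IsTimeGevreyModerate T s u

/-- The regularised right-hand side
`f_{τ,y}(ψ_δ(t-τ) ρ_δ(x-y)) = ∫_0^T ψ_δ(t-τ) (f(τ) ∗ ρ_δ)(x) dτ`. -/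
def mollifyRhs {n : ℕ} (T : ℝ) (f : ℝ → 𝓢'(Sp n, ℂ)) (ψ : ℝ → ℝ) (φ : Sp n → ℂ) (χ : Sp n → ℝ)
    (δ t : ℝ) (x : Sp n) : ℂ :=
  ∫ τ in (0 : ℝ)..T, dilate ψ δ (t - τ) * conv (f τ) (gevreyMollifier φ χ δ) x

/-- The Cauchy problem with distributional coefficients `a, c, d, e`, right-hand side `f` and
data `g₀, g₁` has a very weak solution of order `s` for regularisation by mollifiers with
logarithmic scales of exponents `p` (for `a, f, g₀, g₁`) and `q` (for `c, d, e`). -/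
def HasVeryWeakSolution {n : ℕ} (T s : ℝ) (a c : Fin n → 𝓢'(ℝ, ℂ)) (d e : 𝓢'(ℝ, ℂ))
    (f : ℝ → 𝓢'(Sp n, ℂ)) (g₀ g₁ : 𝓢'(Sp n, ℂ))
    (ψ : ℝ → ℝ) (φ : Sp n → ℂ) (χ : Sp n → ℝ) (p q : ℝ) : Prop :=
  ∃ μ ν : ℝ → ℝ, IsLogScale p μ ∧ IsLogScale q ν ∧
    ∃ u : ℝ → ℝ → Sp n → ℂ, IsVeryWeakSolution T s
      (fun i ε => conv (a i) (dilate ψ (μ ε))) (fun i ε => conv (c i) (dilate ψ (ν ε)))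
      (fun ε => conv d (dilate ψ (ν ε))) (fun ε => conv e (dilate ψ (ν ε)))
      (fun ε => mollifyRhs T f ψ φ χ (μ ε))
      (fun ε => conv g₀ (gevreyMollifier φ χ (μ ε)))
      (fun ε => conv g₁ (gevreyMollifier φ χ (μ ε))) u

/-- The Levi conditions on the coefficients regularised by `ψ` at the logarithmic scales
`μ(ε) = (ln ε⁻¹)^(-p)` (for `a`) and `ν(ε) = (ln ε⁻¹)^(-q)` (for `c, d, e`), for all small `ε`
and all large `|ξ|`. -/
def LeviConditions {n : ℕ} (T : ℝ) (a c : Fin n → 𝓢'(ℝ, ℂ)) (d e : 𝓢'(ℝ, ℂ))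
    (ψ : ℝ → ℝ) (p q : ℝ) : Prop :=
  ∃ c₁ > 0, ∃ c₂ > 0, ∃ R > 0, ∀ᶠ ε in 𝓝[>] (0 : ℝ), ∀ t ∈ Icc 0 T,
    (∀ ξ : Sp n, R ≤ ‖ξ‖ →
      ‖Complex.I * ∑ i, conv (c i) (dilate ψ (Real.log ε⁻¹ ^ (-q))) t * (ξ i : ℂ)
          + conv e (dilate ψ (Real.log ε⁻¹ ^ (-q))) t‖ ^ 2 ≤
        c₁ * Real.log ε⁻¹ ^ 2 *
          (2 * ∑ i, (conv (a i) (dilate ψ (Real.log ε⁻¹ ^ (-p))) t).re * ξ i ^ 2)) ∧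
    ‖conv d (dilate ψ (Real.log ε⁻¹ ^ (-q))) t‖ ^ 2 ≤ c₂ * Real.log ε⁻¹ ^ 2

end VeryWeak

end

open VeryWeak

/-! ### Tempered distributions of finite order, tested on reflected translates. -/

namespace VeryWeak
variable {E : Type*} [NormedAddCommGroup E] [NormedSpace ℝ E]

/-! Fourier transformation in `x` turns the regularised problem into a family of scalar equations
`y'' + (b + l) y + d y' = F`, one for each frequency `ξ`, with `b = ∑ aᵢ (2π ξᵢ)² ≥ 0` and `l` the
contribution of the lower-order terms. Regularised data decay in `ξ` like `exp (-κ (‖ξ‖/η)^(1/s))`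
once `η` exceeds the inverse scale (`exists_data_bound`), and such decay gives back Gevrey bounds in
`x` (`exists_gevreyTower_bound`). It remains to show that solving the equation costs only part of
this decay together with a power of `ε⁻¹`.

The energy `|y'|² + (b + 1)|y|²` grows at a rate controlled by the Levi constant `Λ`, except for the
term `b' |y|²`. Where `b` decreases this term helps; where `b` increases, the quotient of the energy
by `b + 1` is controlled instead, so one monotone stretch costs a factor `sup (b + 1)`
(`OscillatorData.energy_le_of_monotone`). A smooth `b` may have too many monotone stretches. On an
interval of length `h` with `|b^(m)| h^m ≤ 1/2` it is therefore replaced by a nonnegative Taylor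
polynomial of degree less than `m`, which has a bounded number of them (`exists_polynomial_approx`,
`OscillatorData.energy_le_of_card_roots`). If `X` bounds both `b + 2` and `|b^(m)|`, about `X^(1/m)`
intervals suffice, each costing about `X^m`; the total loss is at most `exp (C X^(2/m))`
(`exists_step_bound`). Here `X` is of size `η^M (1 + ‖ξ‖)²`, and `m ≥ 8 s` makes the exponent grow
no faster than `‖ξ‖^(1/(2s))`. Hence it is at most `C η^M₀ + κ (‖ξ‖/η)^(1/s)` with `κ` as small as
desired (`exists_exponent_bound`, `exists_energy_bound`), and the last term is paid for by the decay
of the data.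

What is left is the factor `exp (C η^M₀ + 8 Λ T)`. Let `L` be the logarithm of `ε⁻¹`. With `η =
L^(1/Q)` and `Q` larger than `M₀`, the first summand is at most `C L`; the Levi conditions give `Λ ≤
K L`. The factor is then a power of `ε⁻¹`, which is moderateness. The exponent `Q` depends on `s`
and on the powers of `η` bounding the coefficients and data, but not on `p` and `q`, so `p₀ = 1/Q`
is admissible. Passing from exponents `(p, q)` to `(θ p, θ q)` amounts to reading the Levi
conditions at the parameter whose logarithm is `L^θ ≤ L` (`LeviConditions.exists_symbol_bound`).

Time derivatives of the solution are estimated from the equation itself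
(`exists_iteratedDerivWithin_bound`) at the price of powers of `η` and of `1 + ‖ξ‖`, the latter
absorbed by a further part of the decay (`exists_solution_tower`). The continuous curve `f` is
handled through a common order for all `f(t)`, a uniform boundedness principle
(`exists_hasOrder_of_pointwise_bounded`). -/

noncomputable def reflTranslate (x : E) : 𝓢(E, ℂ) →L[ℂ] 𝓢(E, ℂ) :=
  (SchwartzMap.compSubConstCLM ℂ x).comp
    (SchwartzMap.compCLMOfContinuousLinearEquiv ℂ (ContinuousLinearEquiv.neg ℝ))

@[simp] theorem reflTranslate_apply (x : E) (θ : 𝓢(E, ℂ)) (y : E) :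
    reflTranslate x θ y = θ (x - y) := by
  simp [reflTranslate]

theorem conv_eq_reflTranslate (u : 𝓢'(E, ℂ)) (θ : 𝓢(E, ℂ)) (x : E) :
    conv u θ x = u (reflTranslate x θ) :=
  conv_eq u θ x _ fun y => reflTranslate_apply x θ y

theorem norm_iteratedFDeriv_reflTranslate (x : E) (θ : 𝓢(E, ℂ)) (l : ℕ) (y : E) :
    ‖iteratedFDeriv ℝ l (reflTranslate x θ) y‖ = ‖iteratedFDeriv ℝ l θ (x - y)‖ := by
  have h1 : (reflTranslate x θ : E → ℂ) = fun y => (θ ∘ (LinearIsometryEquiv.neg ℝ : E ≃ₗᵢ[ℝ] E)) (y - x) := by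
    ext y; simp
  rw [h1, iteratedFDeriv_comp_sub, LinearIsometryEquiv.norm_iteratedFDeriv_comp_right]
  simp

/-- One index bounds both the weight and the number of derivatives. Order and constant are explicit
because later estimates must be uniform over families of distributions. -/
def HasOrder (u : 𝓢'(E, ℂ)) (N : ℕ) (C : ℝ) : Prop :=
  ∀ φ : 𝓢(E, ℂ), ‖u φ‖ ≤ C * ((Finset.Iic (N, N)).sup (schwartzSeminormFamily ℂ E ℂ)) φ

theorem exists_hasOrder (u : 𝓢'(E, ℂ)) : ∃ N : ℕ, ∃ C : ℝ, 0 ≤ C ∧ HasOrder u N C := by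
  obtain ⟨s, C, -, h⟩ := Seminorm.bound_of_continuous (schwartz_withSeminorms ℂ E ℂ)
    ((normSeminorm ℂ ℂ).comp u.toLinearMap) (by
      exact continuous_norm.comp u.continuous)
  refine ⟨s.sup fun p => max p.1 p.2, C, C.2, fun φ => (h φ).trans ?_⟩
  rw [smul_apply, NNReal.smul_def, smul_eq_mul]
  refine mul_le_mul_of_nonneg_left ?_ C.2
  refine Seminorm.le_def.1 (Finset.sup_mono fun p hp => ?_) φ
  rw [Finset.mem_Iic, Prod.le_def]
  have := Finset.le_sup (f := fun p : ℕ × ℕ => max p.1 p.2) hp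
  exact ⟨(le_max_left _ _).trans this, (le_max_right _ _).trans this⟩

/-- On a ball of radius `R` the polynomial weights cost at most `(1 + R)^N`, so only derivative
bounds matter. -/
theorem sup_seminorm_le_of_support (φ : 𝓢(E, ℂ)) {N : ℕ} {R B : ℝ} (hR : 0 ≤ R) (hB : 0 ≤ B)
    (hs : ∀ y, R < ‖y‖ → φ y = 0) (h : ∀ l ≤ N, ∀ y, ‖iteratedFDeriv ℝ l φ y‖ ≤ B) :
    ((Finset.Iic (N, N)).sup (schwartzSeminormFamily ℂ E ℂ)) φ ≤ (1 + R) ^ N * B := by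
  refine Seminorm.finset_sup_apply_le (by positivity) fun p hp => ?_
  rw [Finset.mem_Iic, Prod.le_def] at hp
  refine SchwartzMap.seminorm_le_bound ℂ p.1 p.2 φ (by positivity) fun y => ?_
  have hts : tsupport φ ⊆ Metric.closedBall 0 R :=
    closure_minimal (fun y hy => by
      by_contra hc
      exact hy (hs y (by simpa using hc))) Metric.isClosed_closedBall
  by_cases hy : y ∈ tsupport φ
  · have hyR : ‖y‖ ≤ R := by simpa using hts hy
    calc _ ≤ (1 + R) ^ p.1 * B := by
          gcongr
          · linarith
          · exact h _ hp.2 y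
      _ ≤ _ := by
          gcongr
          · linarith
          · exact hp.1
  · have : iteratedFDeriv ℝ p.2 φ y = 0 := by
      by_contra hc
      exact hy (support_iteratedFDeriv_subset (𝕜 := ℝ) p.2 hc)
    rw [this, norm_zero, mul_zero]
    positivity

/-- The reflected translate lives in the ball of radius `‖x‖ + r` and has the same derivative bounds
as `θ`. This reduces estimates of regularisations to estimates of the mollifier. -/
theorem HasOrder.norm_reflTranslate_le {u : 𝓢'(E, ℂ)} {N : ℕ} {C : ℝ} (hu : HasOrder u N C)
    (hC : 0 ≤ C) (θ : 𝓢(E, ℂ)) {r B : ℝ} (hr : 0 ≤ r) (hs : ∀ y, r < ‖y‖ → θ y = 0)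
    (h : ∀ l ≤ N, ∀ y, ‖iteratedFDeriv ℝ l θ y‖ ≤ B) (x : E) :
    ‖u (reflTranslate x θ)‖ ≤ C * ((1 + (‖x‖ + r)) ^ N * B) := by
  have hB : 0 ≤ B := (norm_nonneg _).trans (h 0 (Nat.zero_le _) 0)
  refine (hu _).trans (mul_le_mul_of_nonneg_left ?_ hC)
  refine sup_seminorm_le_of_support _ (by positivity) hB (fun y hy => ?_) fun l hl y => ?_
  · rw [reflTranslate_apply]
    refine hs _ ?_
    have := norm_sub_norm_le y x
    rw [norm_sub_rev] at this
    linarith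
  · rw [norm_iteratedFDeriv_reflTranslate]
    exact h l hl _
end VeryWeak

/-! ### Differentiability of a convolution. -/

namespace VeryWeak
variable {E : Type*} [NormedAddCommGroup E] [NormedSpace ℝ E]
open LineDeriv

theorem lineDerivOp_comm (θ : 𝓢(E, ℂ)) (v w : E) :
    (∂_{v} (∂_{w} θ : 𝓢(E, ℂ)) : 𝓢(E, ℂ)) = ∂_{w} (∂_{v} θ : 𝓢(E, ℂ)) := by
  ext z
  have hs : ContDiff ℝ ∞ (fderiv ℝ θ) := (contDiff_succ_iff_fderiv.mp (θ.smooth ⊤)).2.2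
  have hd : DifferentiableAt ℝ (fderiv ℝ θ) z := hs.differentiable (by simp) z
  have h : ∀ v w : E, (∂_{v} (∂_{w} θ : 𝓢(E, ℂ)) : 𝓢(E, ℂ)) z = fderiv ℝ (fderiv ℝ θ) z v w := by
    intro v w
    rw [SchwartzMap.lineDerivOp_apply_eq_fderiv]
    have : ((∂_{w} θ : 𝓢(E, ℂ)) : E → ℂ) = fun y => fderiv ℝ θ y w := rfl
    rw [this, fderiv_clm_apply hd (differentiableAt_const w)]
    simp
  rw [h, h]
  exact ((show ContDiffAt ℝ 2 θ z by exact_mod_cast (θ.smooth 2).contDiffAt).isSymmSndFDerivAt (n := 2)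
    (by simp)) v w

theorem iteratedLineDerivOp_lineDerivOp_comm {l : ℕ} (m : Fin l → E) (h : E) (θ : 𝓢(E, ℂ)) :
    (∂^{m} (∂_{h} θ : 𝓢(E, ℂ)) : 𝓢(E, ℂ)) = ∂_{h} (∂^{m} θ : 𝓢(E, ℂ)) := by
  induction l with
  | zero => simp
  | succ l ih => rw [iteratedLineDerivOp_succ_left, ih, lineDerivOp_comm,
      ← iteratedLineDerivOp_succ_left]

/-- Directional derivatives commute by symmetry of the second derivative, so `∂_h` can be moved
outside the iterated derivative. -/
theorem iteratedFDeriv_lineDerivOp (θ : 𝓢(E, ℂ)) (h : E) (l : ℕ) (z : E) :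
    iteratedFDeriv ℝ l (∂_{h} θ : 𝓢(E, ℂ)) z = fderiv ℝ (iteratedFDeriv ℝ l θ) z h := by
  ext m
  rw [← SchwartzMap.iteratedLineDerivOp_eq_iteratedFDeriv, iteratedLineDerivOp_lineDerivOp_comm,
    SchwartzMap.lineDerivOp_apply_eq_fderiv, ← fderiv_continuousMultilinear_apply_const_apply]
  · congr 2
    ext y
    rw [SchwartzMap.iteratedLineDerivOp_eq_iteratedFDeriv]
  · exact (θ.smooth ⊤).differentiable_iteratedFDeriv (mod_cast ENat.natCast_lt_top l) z

/-- The mean value inequality is used twice: first the derivative of `D^l θ` is Lipschitz with a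
constant given by the derivatives of order `l + 2`, then the increment along the segment from `z` to
`z + h` is compared with its linear part. -/
theorem norm_iteratedFDeriv_taylor_le (θ : 𝓢(E, ℂ)) (l : ℕ) (z h : E) :
    ‖iteratedFDeriv ℝ l θ (z + h) - iteratedFDeriv ℝ l θ z
      - iteratedFDeriv ℝ l (∂_{h} θ : 𝓢(E, ℂ)) z‖
      ≤ SchwartzMap.seminorm ℂ 0 (l + 2) θ * ‖h‖ * ‖h‖ := by
  set S := SchwartzMap.seminorm ℂ 0 (l + 2) θ
  have hd : ∀ k, Differentiable ℝ (iteratedFDeriv ℝ k θ) := fun k =>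
    (θ.smooth ⊤).differentiable_iteratedFDeriv (mod_cast ENat.natCast_lt_top k)
  have hlip : ∀ w, ‖fderiv ℝ (iteratedFDeriv ℝ l θ) w - fderiv ℝ (iteratedFDeriv ℝ l θ) z‖
      ≤ S * ‖w - z‖ := by
    intro w
    have := Convex.norm_image_sub_le_of_norm_fderiv_le (𝕜 := ℝ) (C := S)
      (f := iteratedFDeriv ℝ (l + 1) θ) (s := univ) (x := z) (y := w)
      (fun x _ => hd (l + 1) x) (fun x _ => by
        rw [norm_fderiv_iteratedFDeriv]
        exact θ.norm_iteratedFDeriv_le_seminorm ℂ _ x) convex_univ (mem_univ _) (mem_univ _)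
    have e : ∀ x, fderiv ℝ (iteratedFDeriv ℝ l θ) x
        = continuousMultilinearCurryLeftEquiv ℝ (fun _ : Fin (l + 1) => E) ℂ
          (iteratedFDeriv ℝ (l + 1) θ x) := fun x => by
      rw [fderiv_iteratedFDeriv]; rfl
    rw [e, e]
    refine le_trans (le_of_eq ?_) this
    have hi := (continuousMultilinearCurryLeftEquiv ℝ (fun _ : Fin (l + 1) => E) ℂ).isometry.dist_eq
      (iteratedFDeriv ℝ (l + 1) θ w) (iteratedFDeriv ℝ (l + 1) θ z)
    rw [dist_eq_norm, dist_eq_norm] at hi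
    exact hi
  have hseg := Convex.norm_image_sub_le_of_norm_fderiv_le' (𝕜 := ℝ) (C := S * ‖h‖)
    (f := iteratedFDeriv ℝ l θ) (s := segment ℝ z (z + h)) (x := z) (y := z + h)
    (φ := fderiv ℝ (iteratedFDeriv ℝ l θ) z) (fun x _ => hd l x) (fun x hx => by
      refine (hlip x).trans ?_
      gcongr
      obtain ⟨t, ht, rfl⟩ := (segment_eq_image' ℝ z (z + h)).subset hx
      simp only [add_sub_cancel_left, norm_smul, Real.norm_eq_abs, abs_of_nonneg ht.1]
      exact mul_le_of_le_one_left (norm_nonneg _) ht.2) (convex_segment _ _)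
    (left_mem_segment _ _ _) (right_mem_segment _ _ _)
  rw [add_sub_cancel_left] at hseg
  rwa [iteratedFDeriv_lineDerivOp]

theorem lineDerivOp_eq_zero_of_support {θ : 𝓢(E, ℂ)} {r : ℝ} (hs : ∀ y, r < ‖y‖ → θ y = 0) (h : E)
    (y : E) (hy : r < ‖y‖) : (∂_{h} θ : 𝓢(E, ℂ)) y = 0 := by
  rw [SchwartzMap.lineDerivOp_apply_eq_fderiv]
  have : (θ : E → ℂ) =ᶠ[𝓝 y] fun _ => 0 := by
    filter_upwards [(isOpen_lt continuous_const continuous_norm).mem_nhds hy] with w hw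
    exact hs w hw
  rw [this.fderiv_eq]; simp

/-- The first-order Taylor remainder of `θ` is itself a Schwartz function of compact support with
all derivatives `O(‖h‖²)`. Since `u` has finite order, the bound passes to the pairing. -/
theorem norm_apply_reflTranslate_taylor_le (u : 𝓢'(E, ℂ)) (θ : 𝓢(E, ℂ)) {r : ℝ} (hr : 0 ≤ r)
    (hs : ∀ y, r < ‖y‖ → θ y = 0) (x : E) :
    ∃ K : ℝ, ∀ h : E, ‖h‖ ≤ 1 → ‖u (reflTranslate (x + h) θ) - u (reflTranslate x θ)
      - u (reflTranslate x (∂_{h} θ))‖ ≤ K * ‖h‖ ^ 2 := by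
  obtain ⟨N, C, hC, hu⟩ := exists_hasOrder u
  set S := ∑ l ∈ Finset.range (N + 1), SchwartzMap.seminorm ℂ 0 (l + 2) θ
  refine ⟨C * ((1 + (‖x‖ + (r + 1))) ^ N * S), fun h hh => ?_⟩
  set η : 𝓢(E, ℂ) := SchwartzMap.compSubConstCLM ℂ (-h) θ - θ - ∂_{h} θ
  have hη : reflTranslate (x + h) θ - reflTranslate x θ - reflTranslate x (∂_{h} θ)
      = reflTranslate x η := by
    ext y
    simp [η, add_sub_right_comm]
  rw [← map_sub, ← map_sub, hη]
  -- The radius grows to `r + 1` because translation by `h` with `‖h‖ ≤ 1` moves the support.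
  have key := hu.norm_reflTranslate_le hC η (r := r + 1) (B := S * ‖h‖ ^ 2) (by linarith)
    (fun y hy => ?_) (fun l hl z => ?_) x
  · calc _ ≤ _ := key
      _ = _ := by ring
  · have h1 : r < ‖y‖ := by linarith
    have h2 : r < ‖y + h‖ := by
      have := norm_sub_norm_le y (-h)
      rw [norm_neg, sub_neg_eq_add] at this
      linarith
    simp [η, hs y h1, hs (y + h) h2, lineDerivOp_eq_zero_of_support hs h y h1]
  · have e : iteratedFDeriv ℝ l η z = iteratedFDeriv ℝ l θ (z + h) - iteratedFDeriv ℝ l θ z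
        - iteratedFDeriv ℝ l (∂_{h} θ : 𝓢(E, ℂ)) z := by
      have e1 : (η : E → ℂ) = (fun y => θ (y + h)) - θ - (∂_{h} θ : 𝓢(E, ℂ)) := by
        ext y; simp [η]
      have c1 : ContDiff ℝ l (fun y => θ (y + h)) := ((θ.smooth l).comp (contDiff_id.add contDiff_const))
      have c2 : ContDiff ℝ l ((fun y => θ (y + h)) - ⇑θ) := c1.sub (θ.smooth l)
      rw [e1, iteratedFDeriv_sub c2 ((∂_{h} θ : 𝓢(E, ℂ)).smooth l),
        iteratedFDeriv_sub c1 (θ.smooth l)]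
      simp [iteratedFDeriv_comp_add_right]
    rw [e]
    refine (norm_iteratedFDeriv_taylor_le θ l z h).trans ?_
    rw [mul_assoc, ← sq]
    gcongr
    exact Finset.single_le_sum (f := fun l => SchwartzMap.seminorm ℂ 0 (l + 2) θ)
      (fun i _ => apply_nonneg _ _) (Finset.mem_range.2 (by omega))

variable [FiniteDimensional ℝ E]

theorem hasFDerivAt_conv (u : 𝓢'(E, ℂ)) (θ : 𝓢(E, ℂ)) {r : ℝ} (hr : 0 ≤ r)
    (hs : ∀ y, r < ‖y‖ → θ y = 0) (x : E) :
    HasFDerivAt (fun x => conv u θ x) (∑ i, conv u (∂_{Module.finBasis ℝ E i} θ : 𝓢(E, ℂ)) x •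
      (Complex.ofRealCLM.comp (LinearMap.toContinuousLinearMap ((Module.finBasis ℝ E).coord i)))) x := by
  obtain ⟨K, hK⟩ := norm_apply_reflTranslate_taylor_le u θ hr hs x
  rw [hasFDerivAt_iff_isLittleO_nhds_zero]
  refine Asymptotics.IsBigO.trans_isLittleO (g := fun h : E => ‖h‖ ^ 2) ?_ ?_
  · refine Asymptotics.IsBigO.of_bound K ?_
    filter_upwards [Metric.closedBall_mem_nhds (0 : E) one_pos] with h hh
    have e : (∂_{h} θ : 𝓢(E, ℂ)) = ∑ i, ((Module.finBasis ℝ E).repr h i) •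
        (∂_{Module.finBasis ℝ E i} θ : 𝓢(E, ℂ)) := by
      conv_lhs => rw [← (Module.finBasis ℝ E).sum_repr h]
      rw [lineDerivOp_left_sum]
      simp only [lineDerivOp_left_smul]
    have e2 : u (reflTranslate x (∂_{h} θ)) = ∑ i, ((Module.finBasis ℝ E).repr h i) •
        u (reflTranslate x (∂_{Module.finBasis ℝ E i} θ : 𝓢(E, ℂ))) := by
      rw [e, map_sum, map_sum]
      refine Finset.sum_congr rfl fun i _ => ?_
      rw [← Complex.coe_smul, ← Complex.coe_smul, map_smul, map_smul]
    have := hK h (by simpa using hh)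
    simp only [conv_eq_reflTranslate]
    rw [e2] at this
    rw [norm_pow, norm_norm]
    refine le_trans (le_of_eq ?_) this
    congr 2
    simp [mul_comm]
  · have : (fun h : E => ‖h‖ ^ 2) = fun h => ‖h‖ ^ 1 * ‖h‖ := by ext; ring
    exact Asymptotics.IsLittleO.of_norm_right (by simpa using Asymptotics.isLittleO_norm_pow_norm_pow (one_lt_two))
end VeryWeak

/-! ### Smoothness and support of a convolution. -/

namespace VeryWeak
variable {E : Type*} [NormedAddCommGroup E] [NormedSpace ℝ E] [FiniteDimensional ℝ E]
open LineDeriv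

/-- The derivative is a finite combination of convolutions with derivatives of the kernel, which
have the same support bound; hence induction on the order of differentiability, for all kernels at
once. -/
theorem contDiff_conv (u : 𝓢'(E, ℂ)) (θ : 𝓢(E, ℂ)) {r : ℝ} (hr : 0 ≤ r)
    (hs : ∀ y, r < ‖y‖ → θ y = 0) : ContDiff ℝ ∞ (fun x => conv u θ x) := by
  rw [contDiff_infty]
  intro m
  induction m generalizing θ with
  | zero =>
    rw [Nat.cast_zero, contDiff_zero]
    exact continuous_iff_continuousAt.2 fun x => (hasFDerivAt_conv u θ hr hs x).continuousAt
  | succ m ih =>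
    rw [Nat.cast_succ, contDiff_succ_iff_hasFDerivAt]
    refine ⟨_, ?_, fun x => hasFDerivAt_conv u θ hr hs x⟩
    refine ContDiff.sum fun i _ => ?_
    exact (ih _ (lineDerivOp_eq_zero_of_support hs _)).smul contDiff_const

theorem fderiv_conv (u : 𝓢'(E, ℂ)) (θ : 𝓢(E, ℂ)) {r : ℝ} (hr : 0 ≤ r)
    (hs : ∀ y, r < ‖y‖ → θ y = 0) (x v : E) :
    fderiv ℝ (fun x => conv u θ x) x v = conv u (∂_{v} θ : 𝓢(E, ℂ)) x := by
  rw [(hasFDerivAt_conv u θ hr hs x).fderiv]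
  have e : (∂_{v} θ : 𝓢(E, ℂ)) = ∑ i, ((Module.finBasis ℝ E).repr v i) •
      (∂_{Module.finBasis ℝ E i} θ : 𝓢(E, ℂ)) := by
    conv_lhs => rw [← (Module.finBasis ℝ E).sum_repr v]
    rw [lineDerivOp_left_sum]
    simp only [lineDerivOp_left_smul]
  simp only [conv_eq_reflTranslate]
  rw [e, map_sum, map_sum, sum_apply]
  refine Finset.sum_congr rfl fun i _ => ?_
  rw [← Complex.coe_smul, map_smul, map_smul]
  simp [mul_comm]

/-- Vanishing is only known locally, near each point outside the support. A finite partition of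
unity on the support of `φ` splits `φ` into pieces, each killed by `u`. -/
theorem apply_eq_zero_of_disjoint_dsupport (u : 𝓢'(E, ℂ)) (φ : 𝓢(E, ℂ))
    (hc : HasCompactSupport φ) (hd : Disjoint (tsupport φ) (Distribution.dsupport u)) : u φ = 0 := by
  classical
  have hcov : ∀ x ∈ tsupport φ, ∃ s : Set E, Distribution.IsVanishingOn u s ∧ IsOpen s ∧ x ∈ s :=
    fun x hx => (Distribution.notMem_dsupport_iff x).1 (Set.disjoint_left.1 hd hx)
  choose! U hUv hUo hUx using hcov
  obtain ⟨t, ht, htc⟩ := hc.isCompact.elim_nhds_subcover U fun x hx => (hUo x hx).mem_nhds (hUx x hx)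
  obtain ⟨f, hf⟩ := SmoothPartitionOfUnity.exists_isSubordinate (modelWithCornersSelf ℝ E)
    (isClosed_tsupport φ) (fun i : t => U i) (fun i => hUo i (ht i i.2)) (by
      intro x hx
      obtain ⟨i, hi, hxi⟩ := mem_iUnion₂.1 (htc hx)
      exact mem_iUnion.2 ⟨⟨i, hi⟩, hxi⟩)
  have hfs : ∀ i, ContDiff ℝ ∞ (f i) := fun i => (f i).contMDiff.contDiff
  have hcs : ∀ i, HasCompactSupport (fun x => ((f i x : ℝ) : ℂ) * φ x) := fun i => hc.mul_left
  have hsm : ∀ i, ContDiff ℝ ∞ (fun x => ((f i x : ℝ) : ℂ) * φ x) := fun i =>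
    (Complex.ofRealCLM.contDiff.comp (hfs i)).mul (φ.smooth ⊤)
  have hsum : φ = ∑ i, (hcs i).toSchwartzMap (hsm i) := by
    ext x
    rw [sum_apply]
    simp only [HasCompactSupport.toSchwartzMap_toFun]
    change _ = ∑ i, ((f i x : ℝ) : ℂ) * φ x
    rw [← Finset.sum_mul, ← Complex.ofReal_sum]
    by_cases hx : x ∈ tsupport φ
    · have := f.sum_eq_one hx
      rw [finsum_eq_sum_of_fintype] at this
      rw [this]; simp
    · rw [image_eq_zero_of_notMem_tsupport hx, mul_zero]
  rw [hsum, map_sum]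
  refine Finset.sum_eq_zero fun i _ => ?_
  refine hUv i (ht i i.2) _ ?_
  refine (tsupport_mul_subset_left (f := fun x => ((f i x : ℝ) : ℂ)) (g := φ)).trans ?_
  refine subset_trans (closure_mono ?_) (hf i)
  intro x hx
  simpa using hx

theorem conv_eq_zero_of_support (u : 𝓢'(E, ℂ)) (θ : 𝓢(E, ℂ)) {r R : ℝ}
    (hs : ∀ y, r < ‖y‖ → θ y = 0) (hu : Distribution.dsupport u ⊆ Metric.closedBall 0 R) (x : E)
    (hx : R + r < ‖x‖) : conv u θ x = 0 := by
  rw [conv_eq_reflTranslate]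
  have hts : tsupport (reflTranslate x θ) ⊆ Metric.closedBall x r := by
    refine closure_minimal (fun y hy => ?_) Metric.isClosed_closedBall
    by_contra hc
    refine hy ?_
    rw [reflTranslate_apply]
    refine hs _ ?_
    rw [Metric.mem_closedBall, not_le, dist_comm, dist_eq_norm] at hc
    exact hc
  refine apply_eq_zero_of_disjoint_dsupport u _ ?_ ?_
  · exact (isCompact_closedBall x r).of_isClosed_subset (isClosed_tsupport _) hts
  · refine Set.disjoint_left.2 fun y hy hy' => ?_
    have h1 := hts hy
    have h2 := hu hy'
    rw [Metric.mem_closedBall, dist_comm, dist_eq_norm] at h1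
    rw [Metric.mem_closedBall, dist_zero_right] at h2
    have := norm_sub_norm_le x y
    linarith

/-- A smooth function of compact support is Schwartz, so the Fourier transform of the convolution is
available, and its derivatives are convolutions with the differentiated kernel. -/
theorem exists_schwartz_eq_conv (u : 𝓢'(E, ℂ)) (θ : 𝓢(E, ℂ)) {r R : ℝ} (hr : 0 ≤ r)
    (hs : ∀ y, r < ‖y‖ → θ y = 0) (hu : Distribution.dsupport u ⊆ Metric.closedBall 0 R) :
    ∃ G : 𝓢(E, ℂ), ∀ (v : E) (m : ℕ) (x : E),
      ((∂_{v})^[m] G : 𝓢(E, ℂ)) x = conv u ((∂_{v})^[m] θ : 𝓢(E, ℂ)) x := by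
  have hc : HasCompactSupport (fun x => conv u θ x) := by
    refine HasCompactSupport.intro (isCompact_closedBall (0 : E) (R + r)) fun x hx => ?_
    exact conv_eq_zero_of_support u θ hs hu x (by simpa using hx)
  refine ⟨hc.toSchwartzMap (contDiff_conv u θ hr hs), fun v m => ?_⟩
  have hsm : ∀ m, ∀ y, r < ‖y‖ → ((∂_{v})^[m] θ : 𝓢(E, ℂ)) y = 0 := by
    intro m
    induction m with
    | zero => exact hs
    | succ m ih =>
      intro y hy
      rw [Function.iterate_succ_apply']
      exact lineDerivOp_eq_zero_of_support ih v y hy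
  induction m with
  | zero => intro x; rfl
  | succ m ih =>
    intro x
    rw [Function.iterate_succ_apply', Function.iterate_succ_apply',
      SchwartzMap.lineDerivOp_apply_eq_fderiv, ← fderiv_conv u _ hr (hsm m)]
    congr 2
    ext y
    exact ih y
end VeryWeak

/-! ### A uniform boundedness principle for tempered distributions. -/

namespace VeryWeak
variable {E : Type*} [NormedAddCommGroup E] [NormedSpace ℝ E]

/-- Absolutely summable coefficients times a bounded sequence of Schwartz functions: each seminorm
of the tail is dominated by the tail of a convergent numerical series. -/
theorem exists_hasSum_schwartz (ψ : ℕ → 𝓢(E, ℂ))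
    (hψ : ∀ k l, ∃ M : ℝ, ∀ N, SchwartzMap.seminorm ℂ k l (ψ N) ≤ M) (c : ℕ → ℂ)
    (hc : Summable fun N => ‖c N‖) : ∃ Φ : 𝓢(E, ℂ), HasSum (fun N => c N • ψ N) Φ := by
  choose M hM using hψ
  have hb : ∀ k l N x, ‖x‖ ^ k * ‖iteratedFDeriv ℝ l (c N • ψ N) x‖ ≤ ‖c N‖ * M k l := by
    intro k l N x
    have h1 := (c N • ψ N).le_seminorm ℂ k l x
    rw [map_smul_eq_mul] at h1
    exact h1.trans (mul_le_mul_of_nonneg_left (hM k l N) (norm_nonneg _))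
  have hb0 : ∀ l N x, ‖iteratedFDeriv ℝ l (c N • ψ N) x‖ ≤ ‖c N‖ * M 0 l := by
    intro l N x
    simpa using hb 0 l N x
  have hs : ∀ k l, Summable fun N => ‖c N‖ * M k l := fun k l => hc.mul_right _
  have hsm : ∀ N, ContDiff ℝ ∞ (c N • ψ N : 𝓢(E, ℂ)) := fun N => (c N • ψ N).smooth ⊤
  set F : E → ℂ := fun x => ∑' N, (c N • ψ N) x
  have hF : ContDiff ℝ ∞ F := contDiff_tsum (N := ⊤) hsm (fun l _ => hs 0 l)
    (fun l N x _ => hb0 l N x)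
  have hD : ∀ l x, iteratedFDeriv ℝ l F x = ∑' N, iteratedFDeriv ℝ l (c N • ψ N) x := by
    intro l x
    exact iteratedFDeriv_tsum_apply (N := ⊤) hsm (fun l _ => hs 0 l)
      (fun l N x _ => hb0 l N x) le_top x
  have hsD : ∀ l x, Summable fun N => iteratedFDeriv ℝ l (c N • ψ N) x := fun l x =>
    Summable.of_norm_bounded (hs 0 l) fun N => hb0 l N x
  have htail : ∀ k l (s : Finset ℕ) x, ‖x‖ ^ k * ‖iteratedFDeriv ℝ l F x
      - ∑ N ∈ s, iteratedFDeriv ℝ l (c N • ψ N) x‖ ≤ ∑' N : ↥((s : Set ℕ)ᶜ), ‖c N‖ * M k l := by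
    intro k l s x
    have h1 := (hsD l x).sum_add_tsum_compl (s := s)
    rw [hD, ← h1, add_sub_cancel_left]
    have h2 : ∀ N, ‖(‖x‖ ^ k : ℝ) • iteratedFDeriv ℝ l (c N • ψ N) x‖ ≤ ‖c N‖ * M k l := by
      intro N
      rw [norm_smul, norm_pow, norm_norm]
      exact hb k l N x
    have h3 := tsum_of_norm_bounded (f := fun N : ↥((s : Set ℕ)ᶜ) =>
      (‖x‖ ^ k : ℝ) • iteratedFDeriv ℝ l (c N • ψ N) x)
      ((hs k l).subtype ((s : Set ℕ)ᶜ)).hasSum (fun N => h2 N)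
    rw [tsum_const_smul'', norm_smul, norm_pow, norm_norm] at h3
    exact h3
  refine ⟨⟨F, hF, fun k l => ⟨∑' N : ↥(((∅ : Finset ℕ) : Set ℕ)ᶜ), ‖c N‖ * M k l, fun x => by
    simpa using htail k l ∅ x⟩⟩, ?_⟩
  set Φ : 𝓢(E, ℂ) := ⟨F, hF, _⟩
  refine ((schwartz_withSeminorms ℂ E ℂ).tendsto_nhds _ _).2 fun p ε hε => ?_
  have ht := tendsto_tsum_compl_atTop_zero fun N => ‖c N‖ * M p.1 p.2
  filter_upwards [(tendsto_order.1 ht).2 ε hε] with s hs'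
  refine lt_of_le_of_lt ?_ hs'
  have hnn : 0 ≤ ∑' N : ↥((s : Set ℕ)ᶜ), ‖c N‖ * M p.1 p.2 :=
    le_trans (by positivity) (htail p.1 p.2 s 0)
  refine SchwartzMap.seminorm_le_bound ℂ p.1 p.2 _ hnn fun x => ?_
  have e : iteratedFDeriv ℝ p.2 (∑ N ∈ s, c N • ψ N - Φ : 𝓢(E, ℂ)) x
      = -(iteratedFDeriv ℝ p.2 F x - ∑ N ∈ s, iteratedFDeriv ℝ p.2 (c N • ψ N) x) := by
    have e1 : ((∑ N ∈ s, c N • ψ N - Φ : 𝓢(E, ℂ)) : E → ℂ)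
        = (fun x => ∑ N ∈ s, (c N • ψ N : 𝓢(E, ℂ)) x) - F := by
      ext x
      simp only [Pi.sub_apply, sub_apply, sum_apply]
      rfl
    have c1 : ContDiff ℝ p.2 (fun x => ∑ N ∈ s, (c N • ψ N : 𝓢(E, ℂ)) x) :=
      ContDiff.sum fun N _ => (c N • ψ N).smooth p.2
    rw [e1, iteratedFDeriv_sub c1 (hF.of_le (by exact_mod_cast le_top)), neg_sub]
    rw [iteratedFDeriv_sum fun N _ => (c N • ψ N).smooth p.2]
    simp
  change ‖x‖ ^ p.1 * ‖iteratedFDeriv ℝ p.2 (∑ N ∈ s, c N • ψ N - Φ : 𝓢(E, ℂ)) x‖ ≤ _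
  rw [e, norm_neg]
  exact htail p.1 p.2 s x

/-- If no common order exists, there are members `u (i N)` and test functions `ψ N` whose `N`-th
seminorm is at most 1, with `|u (i N) (ψ N)| = N`. The map `c ↦ ∑ c_N ψ_N` carries `ℓ¹` into the
Schwartz space, so the family induces functionals on the Banach space `ℓ¹` that are pointwise
bounded. Banach–Steinhaus bounds their norms, and the unit vectors of `ℓ¹` give a contradiction. -/
theorem exists_hasOrder_of_pointwise_bounded {ι : Type*} (u : ι → 𝓢'(E, ℂ))
    (h : ∀ φ : 𝓢(E, ℂ), ∃ B : ℝ, ∀ i, ‖u i φ‖ ≤ B) :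
    ∃ N : ℕ, ∃ C : ℝ, 0 ≤ C ∧ ∀ i, HasOrder (u i) N C := by
  by_contra! hcon
  have h1 : ∀ N : ℕ, ∃ i, ∃ ψ : 𝓢(E, ℂ),
      ((Finset.Iic (N, N)).sup (schwartzSeminormFamily ℂ E ℂ)) ψ ≤ 1 ∧ ‖u i ψ‖ = N := by
    intro N
    obtain ⟨i, hi⟩ := hcon N N (Nat.cast_nonneg N)
    rw [HasOrder] at hi
    push Not at hi
    obtain ⟨φ, hφ⟩ := hi
    set P := ((Finset.Iic (N, N)).sup (schwartzSeminormFamily ℂ E ℂ)) φ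
    have hP : 0 ≤ P := apply_nonneg _ _
    have hpos : 0 < ‖u i φ‖ := lt_of_le_of_lt (by positivity) hφ
    refine ⟨i, ((N / ‖u i φ‖ : ℝ) : ℂ) • φ, ?_, ?_⟩
    · rw [map_smul_eq_mul, Complex.norm_real, Real.norm_eq_abs, abs_of_nonneg (by positivity),
        div_mul_eq_mul_div, div_le_one hpos]
      exact hφ.le
    · rw [map_smul, norm_smul, Complex.norm_real, Real.norm_eq_abs, abs_of_nonneg (by positivity)]
      field_simp
  choose i ψ hψ hu using h1
  have hb : ∀ k l, ∃ M : ℝ, ∀ N, SchwartzMap.seminorm ℂ k l (ψ N) ≤ M := by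
    intro k l
    -- From `N = max k l` on, the seminorm of index `(k, l)` is one of those bounded by 1; the
    -- finitely many earlier terms are summed.
    refine ⟨1 + ∑ N ∈ Finset.range (max k l), SchwartzMap.seminorm ℂ k l (ψ N), fun N => ?_⟩
    by_cases hN : N < max k l
    · have := Finset.single_le_sum (f := fun N => SchwartzMap.seminorm ℂ k l (ψ N))
        (fun i _ => apply_nonneg _ _) (Finset.mem_range.2 hN)
      linarith
    · have h2 : SchwartzMap.seminorm ℂ k l (ψ N) ≤ 1 := by
        refine le_trans (Seminorm.le_def.1 (Finset.le_sup (f := schwartzSeminormFamily ℂ E ℂ)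
          (b := (k, l)) ?_) (ψ N)) (hψ N)
        rw [Finset.mem_Iic, Prod.le_def]
        simp only [not_lt, max_le_iff] at hN
        exact hN
      have : 0 ≤ ∑ N ∈ Finset.range (max k l), SchwartzMap.seminorm ℂ k l (ψ N) :=
        Finset.sum_nonneg fun _ _ => apply_nonneg _ _
      linarith
  have hsum : ∀ c : lp (fun _ : ℕ => ℂ) 1, Summable fun N => ‖c N‖ := fun c => by
    simpa using (lp.memℓp c).summable (by simp)
  have hΦ : ∀ c : lp (fun _ : ℕ => ℂ) 1, ∃ Φ : 𝓢(E, ℂ), ∀ j,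
      HasSum (fun N => c N * u j (ψ N)) (u j Φ) := by
    intro c
    obtain ⟨Φ, hΦ⟩ := exists_hasSum_schwartz ψ hb (fun N => c N) (hsum c)
    refine ⟨Φ, fun j => ?_⟩
    have h1 := hΦ.mapL (u j : 𝓢(E, ℂ) →L[ℂ] ℂ)
    have e : (fun N => c N * u j (ψ N)) = fun N => (u j) (c N • ψ N) :=
      funext fun N => (map_smul (u j : 𝓢(E, ℂ) →L[ℂ] ℂ) (c N) (ψ N)).symm
    rw [e]
    exact h1
  have hbd : ∀ j, ∃ B : ℝ, ∀ N, ‖u j (ψ N)‖ ≤ B := by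
    intro j
    obtain ⟨N₀, C, hC, ho⟩ := exists_hasOrder (u j)
    choose M hM using hb
    refine ⟨C * ∑ p ∈ Finset.Iic (N₀, N₀), M p.1 p.2, fun N => (ho _).trans ?_⟩
    refine mul_le_mul_of_nonneg_left ?_ hC
    have hM0 : ∀ k l, 0 ≤ M k l := fun k l => (apply_nonneg _ _).trans (hM k l 0)
    refine Seminorm.finset_sup_apply_le (Finset.sum_nonneg fun p _ => hM0 _ _) fun p hp => ?_
    exact (hM p.1 p.2 N).trans (Finset.single_le_sum (f := fun p : ℕ × ℕ => M p.1 p.2)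
      (fun p _ => hM0 _ _) hp)
  choose B hB using hbd
  let L : ι → lp (fun _ : ℕ => ℂ) 1 →L[ℂ] ℂ := fun j => LinearMap.mkContinuous
    { toFun := fun c => ∑' N, c N * u j (ψ N)
      map_add' := fun c c' => by
        obtain ⟨Φ, h1⟩ := hΦ c
        obtain ⟨Φ', h2⟩ := hΦ c'
        rw [← Summable.tsum_add (h1 j).summable (h2 j).summable]
        refine tsum_congr fun N => ?_
        simp [add_mul]
      map_smul' := fun a c => by
        simp [mul_assoc, tsum_mul_left] }
    (B j) fun c => by
      have h1 : ‖c‖ = ∑' N, ‖c N‖ := by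
        rw [lp.norm_eq_tsum_rpow (by simp)]; simp
      rw [h1, ← tsum_mul_left]
      refine tsum_of_norm_bounded ((hsum c).mul_left (B j)).hasSum fun N => ?_
      rw [norm_mul, mul_comm]
      exact mul_le_mul_of_nonneg_right (hB j N) (norm_nonneg _)
  have hL : ∀ j c, L j c = ∑' N, c N * u j (ψ N) := fun j c => rfl
  obtain ⟨C', hC'⟩ := banach_steinhaus (g := L) fun c => by
    obtain ⟨Φ, h1⟩ := hΦ c
    obtain ⟨B, hB⟩ := h Φ
    refine ⟨B, fun j => ?_⟩
    rw [hL, (h1 j).tsum_eq]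
    exact hB j
  obtain ⟨N, hN⟩ := exists_nat_gt C'
  have h3 := (L (i N)).le_of_opNorm_le (hC' (i N)) (lp.single 1 N (1 : ℂ))
  rw [hL, tsum_eq_single N (fun M hM => by simp [lp.single_apply, hM]), lp.norm_single (by simp)] at h3
  simp only [lp.single_apply_self, one_mul, hu, norm_one, mul_one] at h3
  linarith
end VeryWeak

/-! ### Energy estimate on an interval where the comparison function is monotone. -/

namespace VeryWeak
open Polynomial

/-- Data of the energy estimate. -/
structure OscillatorData (T : ℝ) (b : ℝ → ℝ) (l d F y z : ℝ → ℂ) (Λ Φ : ℝ) : Prop where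
  deriv_y : ∀ t ∈ Icc 0 T, HasDerivWithinAt y (z t) (Icc 0 T) t
  deriv_z : ∀ t ∈ Icc 0 T, HasDerivWithinAt z (F t - ((b t : ℂ) + l t) * y t - d t * z t) (Icc 0 T) t
  b_nonneg : ∀ t ∈ Icc 0 T, 0 ≤ b t
  levi : ∀ t ∈ Icc 0 T, ‖l t‖ ^ 2 ≤ Λ ^ 2 * (b t + 1)
  damping : ∀ t ∈ Icc 0 T, ‖d t‖ ≤ Λ
  source : ∀ t ∈ Icc 0 T, ‖F t‖ ≤ Φ
  one_le : 1 ≤ Λ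

/-- The energy `|z|² + (g + 1)|y|² + Φ²`. -/
noncomputable def energy (g : ℝ → ℝ) (y z : ℝ → ℂ) (Φ t : ℝ) : ℝ :=
  ‖z t‖ ^ 2 + (g t + 1) * ‖y t‖ ^ 2 + Φ ^ 2

theorem HasDerivWithinAt.norm_sq_complex {f : ℝ → ℂ} {f' : ℂ} {s : Set ℝ} {t : ℝ}
    (h : HasDerivWithinAt f f' s t) :
    HasDerivWithinAt (fun t => ‖f t‖ ^ 2) (2 * (f t * (starRingEnd ℂ) f').re) s t := by
  have := h.norm_sq
  convert this using 1
  simp [Complex.inner]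
  ring

/-- The terms `-b y` and `(g + 1) y` nearly cancel, leaving a factor `g + 1 - b` of size at most 2.
The Levi bound controls `|l| |y|` by `Λ √(b + 1) |y|` with `b + 1 ≤ 2 (g + 1)`, and `Φ²` in the
energy absorbs the source. Only `g' |y|²` is left unestimated. -/
theorem energy_rate_le {b g g' Λ Φ : ℝ} {l d F y z : ℂ} (hg : 0 ≤ g) (hbg : |b - g| ≤ 1)
    (hl : ‖l‖ ^ 2 ≤ Λ ^ 2 * (b + 1)) (hd : ‖d‖ ≤ Λ) (hF : ‖F‖ ≤ Φ) (hΛ : 1 ≤ Λ) :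
    2 * (z * (starRingEnd ℂ) (F - ((b : ℂ) + l) * y - d * z)).re
      + (g' * ‖y‖ ^ 2 + (g + 1) * (2 * (y * (starRingEnd ℂ) z).re))
      ≤ 8 * Λ * (‖z‖ ^ 2 + (g + 1) * ‖y‖ ^ 2 + Φ ^ 2) + g' * ‖y‖ ^ 2 := by
  have hsplit : 2 * (z * (starRingEnd ℂ) (F - ((b : ℂ) + l) * y - d * z)).re
      + (g + 1) * (2 * (y * (starRingEnd ℂ) z).re)
      = 2 * (z * (starRingEnd ℂ) F).re - 2 * (z * (starRingEnd ℂ) (l * y)).re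
        - 2 * (z * (starRingEnd ℂ) (d * z)).re + 2 * (g + 1 - b) * (y * (starRingEnd ℂ) z).re := by
    simp [Complex.mul_re, Complex.sub_re, Complex.mul_im, Complex.sub_im]
    ring
  have hre : ∀ p q : ℂ, |(p * (starRingEnd ℂ) q).re| ≤ ‖p‖ * ‖q‖ := fun p q => by
    refine (Complex.abs_re_le_norm _).trans ?_
    rw [norm_mul, RCLike.norm_conj]
  have h1 := abs_le.1 (hre z F)
  have h2 := abs_le.1 (hre z (l * y))
  have h3 := abs_le.1 (hre z (d * z))
  have h4 := abs_le.1 (hre y z)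
  rw [norm_mul] at h2 h3
  set Y := ‖y‖
  set Z := ‖z‖
  set L := ‖l‖
  have hY : 0 ≤ Y := norm_nonneg _
  have hZ : 0 ≤ Z := norm_nonneg _
  have hL : 0 ≤ L := norm_nonneg _
  have hbg' := abs_le.1 hbg
  have e1 : 2 * (z * (starRingEnd ℂ) F).re ≤ Λ * (Z ^ 2 + Φ ^ 2) := by
    have : Z * ‖F‖ ≤ Z * Φ := by gcongr
    nlinarith [sq_nonneg (Z - Φ), sq_nonneg Z, sq_nonneg Φ]
  have e2 : -(2 * (z * (starRingEnd ℂ) (l * y)).re) ≤ Λ * Z ^ 2 + 2 * Λ * ((g + 1) * Y ^ 2) := by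
    -- Young's inequality weighted by `Λ`, so that dividing by `Λ` afterwards leaves a bound linear
    -- in `Λ`.
    have k1 : 2 * (Z * (L * Y)) * Λ ≤ Λ ^ 2 * Z ^ 2 + L ^ 2 * Y ^ 2 := by
      nlinarith [sq_nonneg (Λ * Z - L * Y)]
    have k2 : L ^ 2 * Y ^ 2 ≤ Λ ^ 2 * (2 * (g + 1)) * Y ^ 2 := by
      gcongr
      refine hl.trans ?_
      gcongr
      linarith
    have k3 : 2 * (Z * (L * Y)) ≤ Λ * Z ^ 2 + 2 * Λ * ((g + 1) * Y ^ 2) := by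
      have hΛ0 : 0 < Λ := by linarith
      refine le_of_mul_le_mul_right ?_ hΛ0
      nlinarith
    linarith
  have e3 : -(2 * (z * (starRingEnd ℂ) (d * z)).re) ≤ 2 * Λ * Z ^ 2 := by
    have : Z * (‖d‖ * Z) ≤ Z * (Λ * Z) := by gcongr
    nlinarith
  have e4 : 2 * (g + 1 - b) * (y * (starRingEnd ℂ) z).re ≤ 2 * (Λ * (Z ^ 2 + (g + 1) * Y ^ 2)) := by
    have k0 : |(g + 1 - b) * (y * (starRingEnd ℂ) z).re| ≤ 2 * (Y * Z) := by
      rw [abs_mul]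
      refine mul_le_mul ?_ (hre y z) (abs_nonneg _) (by norm_num)
      rw [abs_le]; constructor <;> linarith
    have k1 := (abs_le.1 k0).2
    have k2 : 2 * (Y * Z) ≤ Z ^ 2 + (g + 1) * Y ^ 2 := by
      nlinarith [sq_nonneg (Y - Z), mul_nonneg hg (sq_nonneg Y)]
    have k3 : Z ^ 2 + (g + 1) * Y ^ 2 ≤ Λ * (Z ^ 2 + (g + 1) * Y ^ 2) :=
      le_mul_of_one_le_left (by positivity) hΛ
    linarith
  have e5 : 0 ≤ Λ * ((g + 1) * Y ^ 2) := by
    have : 0 ≤ Λ := by linarith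
    positivity
  have e6 : 0 ≤ Λ * Z ^ 2 := by
    have : 0 ≤ Λ := by linarith
    positivity
  have e7 : 0 ≤ Λ * Φ ^ 2 := by
    have : 0 ≤ Λ := by linarith
    positivity
  nlinarith [hsplit]

/-- Gronwall's inequality: `exp (-C t) f t` is nonincreasing. -/
theorem le_of_hasDerivWithinAt_le {f f' : ℝ → ℝ} {α β C : ℝ} (hαβ : α ≤ β)
    (hf : ContinuousOn f (Icc α β))
    (hd : ∀ t ∈ Ioo α β, HasDerivAt f (f' t) t) (h : ∀ t ∈ Ioo α β, f' t ≤ C * f t) :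
    f β ≤ Real.exp (C * (β - α)) * f α := by
  have hanti : AntitoneOn (fun t => Real.exp (-(C * t)) * f t) (Icc α β) := by
    have hexp : ∀ t : ℝ, HasDerivAt (fun t => Real.exp (-(C * t))) (Real.exp (-(C * t)) * -C) t := by
      intro t
      have := (((hasDerivAt_id t).const_mul C).neg).exp
      simpa using this
    refine antitoneOn_of_deriv_nonpos (convex_Icc α β)
      ((by fun_prop : Continuous fun t : ℝ => Real.exp (-(C * t))).continuousOn.mul hf) ?_ ?_
    · intro t ht
      rw [interior_Icc] at ht
      exact ((hexp t).mul (hd t ht)).differentiableAt.differentiableWithinAt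
    · intro t ht
      rw [interior_Icc] at ht
      rw [((hexp t).fun_mul (hd t ht)).deriv]
      have := h t ht
      have hp := Real.exp_pos (-(C * t))
      nlinarith
  have := hanti (left_mem_Icc.2 hαβ) (right_mem_Icc.2 hαβ) hαβ
  simp only at this
  have h2 : Real.exp (C * (β - α)) = Real.exp (C * β) * Real.exp (-(C * α)) := by
    rw [← Real.exp_add]; ring_nf
  rw [h2]
  have h3 : f β = Real.exp (C * β) * (Real.exp (-(C * β)) * f β) := by
    rw [← mul_assoc, ← Real.exp_add]; simp
  rw [h3, mul_assoc]
  gcongr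

/-- For `P' ≤ 0` the term `P' |y|²` is dropped. For `P' ≥ 0`, the inequality `(P + 1)|y|² ≤ energy`
shows that it is at most the logarithmic derivative of `P + 1` times the energy; Gronwall then
applies to `energy / (P + 1)`, and undoing the quotient costs the factor `X`. -/
theorem OscillatorData.energy_le_of_monotone {T : ℝ} {b : ℝ → ℝ} {l d F y z : ℝ → ℂ} {Λ Φ : ℝ}
    (D : OscillatorData T b l d F y z Λ Φ) {α β X : ℝ} (hα : 0 ≤ α) (hαβ : α ≤ β) (hβ : β ≤ T)
    (P : ℝ[X]) (hP : ∀ t ∈ Icc α β, 0 ≤ P.eval t) (hPX : ∀ t ∈ Icc α β, P.eval t + 1 ≤ X)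
    (hbP : ∀ t ∈ Icc α β, |b t - P.eval t| ≤ 1)
    (hsign : (∀ t ∈ Ioo α β, 0 ≤ P.derivative.eval t) ∨ (∀ t ∈ Ioo α β, P.derivative.eval t ≤ 0)) :
    energy (fun t => P.eval t) y z Φ β ≤
      X * Real.exp (8 * Λ * (β - α)) * energy (fun t => P.eval t) y z Φ α := by
  have hsub : Icc α β ⊆ Icc 0 T := Icc_subset_Icc hα hβ
  have hI : ∀ t ∈ Ioo α β, Icc (0 : ℝ) T ∈ 𝓝 t := fun t ht =>
    Icc_mem_nhds (hα.trans_lt ht.1) (ht.2.trans_le hβ)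
  have hyc : ContinuousOn y (Icc α β) := fun t ht => ((D.deriv_y t (hsub ht)).continuousWithinAt).mono hsub
  have hzc : ContinuousOn z (Icc α β) := fun t ht => ((D.deriv_z t (hsub ht)).continuousWithinAt).mono hsub
  have hPc : ContinuousOn (fun t => P.eval t) (Icc α β) := P.continuous.continuousOn
  have hEc : ContinuousOn (energy (fun t => P.eval t) y z Φ) (Icc α β) := by
    unfold energy; fun_prop
  have hEd : ∀ t ∈ Ioo α β, ∃ E' : ℝ, HasDerivAt (energy (fun t => P.eval t) y z Φ) E' t ∧
      E' ≤ 8 * Λ * energy (fun t => P.eval t) y z Φ t + P.derivative.eval t * ‖y t‖ ^ 2 := by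
    intro t ht
    have ht' := hsub (Ioo_subset_Icc_self ht)
    have h1 := (HasDerivWithinAt.norm_sq_complex (D.deriv_y t ht')).hasDerivAt (hI t ht)
    have h2 := (HasDerivWithinAt.norm_sq_complex (D.deriv_z t ht')).hasDerivAt (hI t ht)
    have h3 := (h2.add (((P.hasDerivAt t).add_const 1).mul h1)).add_const (Φ ^ 2)
    refine ⟨_, h3, ?_⟩
    exact energy_rate_le (hP t (Ioo_subset_Icc_self ht)) (hbP t (Ioo_subset_Icc_self ht))
      (D.levi t ht') (D.damping t ht') (D.source t ht') D.one_le
  choose! E' hE' hE'le using hEd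
  have hα' : α ∈ Icc α β := left_mem_Icc.2 hαβ
  have hβ' : β ∈ Icc α β := right_mem_Icc.2 hαβ
  have hEnn : ∀ t ∈ Icc α β, 0 ≤ energy (fun t => P.eval t) y z Φ t := fun t ht => by
    have := hP t ht
    unfold energy; positivity
  have hX : 1 ≤ X := by have := hP α hα'; have := hPX α hα'; linarith
  have hexp := Real.exp_pos (8 * Λ * (β - α))
  rcases hsign with hs | hs
  · have key := le_of_hasDerivWithinAt_le (f := fun t => energy (fun t => P.eval t) y z Φ t / (P.eval t + 1))
      (C := 8 * Λ) hαβ (hEc.div (hPc.add continuousOn_const) fun t ht => by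
        have := hP t ht; positivity)
      (fun t ht => (hE' t ht).div ((P.hasDerivAt t).add_const 1) (by
        have := hP t (Ioo_subset_Icc_self ht); positivity))
      (fun t ht => by
        have h0 := hP t (Ioo_subset_Icc_self ht)
        have hp : 0 < P.eval t + 1 := by positivity
        have h1 := hE'le t ht
        have h2 := hs t ht
        rw [div_le_iff₀ (by positivity)]
        have h3 : 8 * Λ * (energy (fun t => P.eval t) y z Φ t / (P.eval t + 1)) * (P.eval t + 1) ^ 2
            = 8 * Λ * energy (fun t => P.eval t) y z Φ t * (P.eval t + 1) := by
          field_simp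
        rw [h3]
        have h4 : (P.eval t + 1) * ‖y t‖ ^ 2 ≤ energy (fun t => P.eval t) y z Φ t := by
          unfold energy
          nlinarith [sq_nonneg ‖z t‖, sq_nonneg Φ]
        have h5 : P.derivative.eval t * ((P.eval t + 1) * ‖y t‖ ^ 2)
            ≤ P.derivative.eval t * energy (fun t => P.eval t) y z Φ t := by gcongr
        have h6 : E' t * (P.eval t + 1) ≤ (8 * Λ * energy (fun t => P.eval t) y z Φ t
            + P.derivative.eval t * ‖y t‖ ^ 2) * (P.eval t + 1) := by gcongr
        nlinarith)
    have hpβ : 0 < P.eval β + 1 := by have := hP β hβ'; positivity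
    have hpα : 1 ≤ P.eval α + 1 := by have := hP α hα'; linarith
    rw [div_le_iff₀ hpβ] at key
    calc _ ≤ _ := key
      _ ≤ Real.exp (8 * Λ * (β - α)) * (energy (fun t => P.eval t) y z Φ α) * X := by
          have := hEnn α hα'
          gcongr
          · exact div_le_self this hpα
          · exact hPX β hβ'
      _ = _ := by ring
  · have key := le_of_hasDerivWithinAt_le (C := 8 * Λ) hαβ hEc hE' (fun t ht => by
      have h1 := hE'le t ht
      have h2 := hs t ht
      nlinarith [sq_nonneg ‖y t‖])
    calc _ ≤ _ := key
      _ = 1 * Real.exp (8 * Λ * (β - α)) * energy (fun t => P.eval t) y z Φ α := by ring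
      _ ≤ _ := by
          have := hEnn α hα'
          gcongr

end VeryWeak

/-! ### Comparison with polynomials and the energy estimate over many steps. -/

namespace VeryWeak
open Polynomial

theorem eval_sign_of_no_root (Q : ℝ[X]) {α β : ℝ} (h : ∀ t ∈ Ioo α β, Q.eval t ≠ 0) :
    (∀ t ∈ Ioo α β, 0 ≤ Q.eval t) ∨ (∀ t ∈ Ioo α β, Q.eval t ≤ 0) := by
  by_contra! hcon
  obtain ⟨⟨t₁, h₁, h₁'⟩, ⟨t₂, h₂, h₂'⟩⟩ := hcon
  obtain ⟨t, ht, ht'⟩ := isPreconnected_Ioo.intermediate_value h₁ h₂ Q.continuous.continuousOn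
    ⟨h₁'.le, h₂'.le⟩
  exact h t ht ht'

section
variable {T : ℝ} {b : ℝ → ℝ} {l d F y z : ℝ → ℂ} {Λ Φ : ℝ}

/-- Strong induction on the number of critical points of `P` inside the interval. Cutting at one of
them leaves `A` and `B` on the two sides with `|A| + |B| + 1 ≤ m`, and the exponents `|A| + 1` and
`|B| + 1` add up to at most `m + 1`. Without critical points `P` is monotone. -/
theorem OscillatorData.energy_le_of_card_roots (D : OscillatorData T b l d F y z Λ Φ) {X : ℝ}
    (P : ℝ[X]) (hP0 : P.derivative ≠ 0) (m : ℕ) : ∀ α β : ℝ, 0 ≤ α → α ≤ β → β ≤ T →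
    (∀ t ∈ Icc α β, 0 ≤ P.eval t) → (∀ t ∈ Icc α β, P.eval t + 1 ≤ X) →
    (∀ t ∈ Icc α β, |b t - P.eval t| ≤ 1) →
    ({t ∈ P.derivative.roots.toFinset | t ∈ Ioo α β} : Finset ℝ).card ≤ m →
    energy (fun t => P.eval t) y z Φ β ≤
      X ^ (m + 1) * Real.exp (8 * Λ * (β - α)) * energy (fun t => P.eval t) y z Φ α := by
  induction m using Nat.strong_induction_on with
  | _ m ih =>
  intro α β hα hαβ hβ hP hPX hbP hm
  have hX : 1 ≤ X := by
    have h1 := hP α (left_mem_Icc.2 hαβ)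
    have h2 := hPX α (left_mem_Icc.2 hαβ)
    linarith
  have hE : 0 ≤ energy (fun t => P.eval t) y z Φ α := by
    have h1 := hP α (left_mem_Icc.2 hαβ)
    unfold energy; positivity
  by_cases hr : ∃ r ∈ Ioo α β, P.derivative.eval r = 0
  · obtain ⟨r, hr, hr0⟩ := hr
    have hrm : r ∈ P.derivative.roots.toFinset := by
      rw [Multiset.mem_toFinset, Polynomial.mem_roots hP0]; exact hr0
    set A : Finset ℝ := {t ∈ P.derivative.roots.toFinset | t ∈ Ioo α r}
    set B : Finset ℝ := {t ∈ P.derivative.roots.toFinset | t ∈ Ioo r β}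
    have hAB : Disjoint A B := by
      refine Finset.disjoint_left.2 fun t h1 h2 => ?_
      exact absurd ((Finset.mem_filter.1 h1).2.2.trans (Finset.mem_filter.1 h2).2.1) (lt_irrefl _)
    have hrn : r ∉ A ∪ B := by
      simp [A, B]
    have hcard : A.card + B.card + 1 ≤ m := by
      rw [← Finset.card_union_of_disjoint hAB, ← Finset.card_insert_of_notMem hrn]
      refine (Finset.card_le_card fun t ht => ?_).trans hm
      rcases Finset.mem_insert.1 ht with rfl | ht
      · exact Finset.mem_filter.2 ⟨hrm, hr⟩
      · rcases Finset.mem_union.1 ht with ht | ht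
        · have := Finset.mem_filter.1 ht
          exact Finset.mem_filter.2 ⟨this.1, this.2.1, this.2.2.trans hr.2⟩
        · have := Finset.mem_filter.1 ht
          exact Finset.mem_filter.2 ⟨this.1, hr.1.trans this.2.1, this.2.2⟩
    have s1 : Icc α r ⊆ Icc α β := Icc_subset_Icc le_rfl hr.2.le
    have s2 : Icc r β ⊆ Icc α β := Icc_subset_Icc hr.1.le le_rfl
    have k1 := ih A.card (by omega) α r hα hr.1.le (hr.2.le.trans hβ) (fun t ht => hP t (s1 ht))
      (fun t ht => hPX t (s1 ht)) (fun t ht => hbP t (s1 ht)) le_rfl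
    have k2 := ih B.card (by omega) r β (hα.trans hr.1.le) hr.2.le hβ (fun t ht => hP t (s2 ht))
      (fun t ht => hPX t (s2 ht)) (fun t ht => hbP t (s2 ht)) le_rfl
    calc energy (fun t => P.eval t) y z Φ β ≤ _ := k2
      _ ≤ X ^ (B.card + 1) * Real.exp (8 * Λ * (β - r)) * (X ^ (A.card + 1) *
          Real.exp (8 * Λ * (r - α)) * energy (fun t => P.eval t) y z Φ α) := by gcongr
      _ = X ^ (A.card + B.card + 1 + 1) * Real.exp (8 * Λ * (β - α)) *
          energy (fun t => P.eval t) y z Φ α := by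
          rw [show 8 * Λ * (β - α) = 8 * Λ * (β - r) + 8 * Λ * (r - α) by ring, Real.exp_add]
          ring
      _ ≤ _ := by
          gcongr
  · push Not at hr
    refine (D.energy_le_of_monotone hα hαβ hβ P hP hPX hbP
      (eval_sign_of_no_root _ hr)).trans ?_
    gcongr
    exact le_self_pow₀ hX (by omega)

theorem OscillatorData.energy_le_of_polynomial (D : OscillatorData T b l d F y z Λ Φ) {X : ℝ}
    (P : ℝ[X]) {K : ℕ} (hK : P.natDegree ≤ K) {α β : ℝ} (hα : 0 ≤ α) (hαβ : α ≤ β) (hβ : β ≤ T)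
    (hP : ∀ t ∈ Icc α β, 0 ≤ P.eval t) (hPX : ∀ t ∈ Icc α β, P.eval t + 1 ≤ X)
    (hbP : ∀ t ∈ Icc α β, |b t - P.eval t| ≤ 1) :
    energy (fun t => P.eval t) y z Φ β ≤
      X ^ (K + 1) * Real.exp (8 * Λ * (β - α)) * energy (fun t => P.eval t) y z Φ α := by
  have h1 := hP α (left_mem_Icc.2 hαβ)
  have hX : 1 ≤ X := by
    have h2 := hPX α (left_mem_Icc.2 hαβ)
    linarith
  -- A constant polynomial is monotone, but its derivative vanishes identically and has no useful
  -- root count.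
  by_cases hP0 : P.derivative = 0
  · have hE : 0 ≤ energy (fun t => P.eval t) y z Φ α := by unfold energy; positivity
    refine (D.energy_le_of_monotone hα hαβ hβ P hP hPX hbP (Or.inl fun t _ => by simp [hP0])).trans ?_
    gcongr
    exact le_self_pow₀ hX (by omega)
  · refine D.energy_le_of_card_roots P hP0 K α β hα hαβ hβ hP hPX hbP ?_
    calc _ ≤ P.derivative.roots.toFinset.card := Finset.card_filter_le _ _
      _ ≤ P.derivative.roots.card := Multiset.toFinset_card_le _
      _ ≤ P.derivative.natDegree := Polynomial.card_roots' _
      _ ≤ P.natDegree - 1 := Polynomial.natDegree_derivative_le _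
      _ ≤ K := by omega

/-- The Taylor polynomial is within `1/2` of `b`; raised by `1/2` it lies above `b ≥ 0`, hence is
nonnegative, and remains within 1. -/
theorem exists_polynomial_approx (hb : ContDiff ℝ ∞ b) {α β M : ℝ} {K : ℕ} (hαβ : α < β)
    (hM : ∀ t ∈ Icc α β, |iteratedDeriv (K + 1) b t| ≤ M) (hMh : M * (β - α) ^ (K + 1) ≤ 1 / 2)
    (hb0 : ∀ t ∈ Icc α β, 0 ≤ b t) : ∃ P : ℝ[X], P.natDegree ≤ K ∧
      ∀ t ∈ Icc α β, 0 ≤ P.eval t ∧ |b t - P.eval t| ≤ 1 := by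
  set P : ℝ[X] := (∑ k ∈ Finset.range (K + 1),
    C (((k.factorial : ℝ)⁻¹) * iteratedDerivWithin k b (Icc α β) α) * (X - C α) ^ k) + C (1 / 2)
  have hnd : P.natDegree ≤ K := by
    refine (natDegree_add_le _ _).trans (max_le ?_ (by simp))
    refine natDegree_sum_le_of_forall_le _ _ fun k hk => ?_
    refine (natDegree_C_mul_le _ _).trans (natDegree_pow_le.trans ?_)
    rw [natDegree_X_sub_C, mul_one]
    exact Nat.lt_succ_iff.1 (Finset.mem_range.1 hk)
  refine ⟨P, hnd, fun t ht => ?_⟩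
  have hM0 : 0 ≤ M := (abs_nonneg _).trans (hM t ht)
  have heval : P.eval t = taylorWithinEval b K (Icc α β) α t + 1 / 2 := by
    rw [taylor_within_apply, eval_add, eval_finsetSum, eval_C]
    congr 1
    refine Finset.sum_congr rfl fun k _ => ?_
    simp
    ring
  have hrem := taylor_mean_remainder_bound (f := b) (C := M) (n := K) hαβ.le
    ((hb.of_le (by exact_mod_cast le_top)).contDiffOn) ht (fun y hy => by
      rw [iteratedDerivWithin_eq_iteratedDeriv (uniqueDiffOn_Icc hαβ)
        (hb.contDiffAt.of_le (by exact_mod_cast le_top)) hy]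
      exact hM y hy)
  have hle : M * (t - α) ^ (K + 1) / (K.factorial : ℝ) ≤ 1 / 2 := by
    have h1 : (1 : ℝ) ≤ K.factorial := by exact_mod_cast Nat.one_le_iff_ne_zero.2 (Nat.factorial_ne_zero K)
    have h2 : 0 ≤ t - α := by linarith [ht.1]
    calc _ ≤ M * (t - α) ^ (K + 1) := div_le_self (by positivity) h1
      _ ≤ M * (β - α) ^ (K + 1) := by gcongr; exact ht.2
      _ ≤ _ := hMh
  have h3 := abs_le.1 (hrem.trans hle)
  have h0 := hb0 t ht
  rw [heval]
  refine ⟨by linarith, abs_le.2 ⟨by linarith, by linarith⟩⟩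

/-- Here `g₁ + 1 ≤ 2 (g₂ + 1)`, so exchanging the weight in the energy costs a factor 2. -/
theorem energy_le_two_mul {g₁ g₂ : ℝ → ℝ} {t : ℝ} (h2 : 0 ≤ g₂ t)
    (h : |g₁ t - g₂ t| ≤ 1) : energy g₁ y z Φ t ≤ 2 * energy g₂ y z Φ t := by
  unfold energy
  have := abs_le.1 h
  nlinarith [sq_nonneg ‖z t‖, sq_nonneg ‖y t‖, sq_nonneg Φ, mul_nonneg h2 (sq_nonneg ‖y t‖)]

/-- The factor 4 comes from passing from `b` to the polynomial and back. -/
theorem OscillatorData.energy_le_step (D : OscillatorData T b l d F y z Λ Φ)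
    (hb : ContDiff ℝ ∞ b) {X M h : ℝ} {K : ℕ} (hX : ∀ t ∈ Icc 0 T, b t + 2 ≤ X)
    (hM : ∀ t ∈ Icc 0 T, |iteratedDeriv (K + 1) b t| ≤ M) (hMh : M * h ^ (K + 1) ≤ 1 / 2)
    {α β : ℝ} (hα : 0 ≤ α) (hαβ : α ≤ β) (hβ : β ≤ T) (hh : β - α ≤ h) :
    energy b y z Φ β ≤ (4 * X ^ (K + 1)) * Real.exp (8 * Λ * (β - α)) * energy b y z Φ α := by
  have hsub : Icc α β ⊆ Icc 0 T := Icc_subset_Icc hα hβ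
  have hα' : α ∈ Icc α β := left_mem_Icc.2 hαβ
  have hβ' : β ∈ Icc α β := right_mem_Icc.2 hαβ
  have hX1 : 1 ≤ X := by linarith [D.b_nonneg α (hsub hα'), hX α (hsub hα')]
  have hE : 0 ≤ energy b y z Φ α := by
    have := D.b_nonneg α (hsub hα')
    unfold energy; positivity
  rcases hαβ.eq_or_lt with rfl | hlt
  · have h1 : 1 ≤ X ^ (K + 1) := one_le_pow₀ hX1
    simp only [sub_self, mul_zero, Real.exp_zero, mul_one]
    nlinarith
  · have hM0 : 0 ≤ M := (abs_nonneg _).trans (hM α (hsub hα'))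
    obtain ⟨P, hPK, hP⟩ := exists_polynomial_approx hb hlt (fun t ht => hM t (hsub ht))
      (le_trans (by gcongr) hMh) (fun t ht => D.b_nonneg t (hsub ht))
    have key := D.energy_le_of_polynomial P hPK (X := X) hα hαβ hβ (fun t ht => (hP t ht).1)
      (fun t ht => by
        have h1 := (abs_le.1 (hP t ht).2).1
        have h2 := hX t (hsub ht)
        linarith) (fun t ht => (hP t ht).2)
    have e1 := energy_le_two_mul (y := y) (z := z) (Φ := Φ) (g₁ := b) (g₂ := fun t => P.eval t)
      (hP β hβ').1 (hP β hβ').2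
    have e2 := energy_le_two_mul (y := y) (z := z) (Φ := Φ) (g₁ := fun t => P.eval t) (g₂ := b)
      (D.b_nonneg α (hsub hα')) (by rw [abs_sub_comm]; exact (hP α hα').2)
    calc _ ≤ _ := e1
      _ ≤ 2 * (X ^ (K + 1) * Real.exp (8 * Λ * (β - α)) * (2 * energy b y z Φ α)) := by
          refine mul_le_mul_of_nonneg_left (key.trans ?_) (by norm_num)
          gcongr
      _ = _ := by ring

theorem OscillatorData.energy_le_steps (D : OscillatorData T b l d F y z Λ Φ)
    (hb : ContDiff ℝ ∞ b) {X M h : ℝ} {K : ℕ} (hX : ∀ t ∈ Icc 0 T, b t + 2 ≤ X)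
    (hM : ∀ t ∈ Icc 0 T, |iteratedDeriv (K + 1) b t| ≤ M) (hh : 0 ≤ h)
    (hMh : M * h ^ (K + 1) ≤ 1 / 2) (N : ℕ) :
    ∀ t ∈ Icc 0 T, t ≤ N * h →
      energy b y z Φ t ≤ (4 * X ^ (K + 1)) ^ N * Real.exp (8 * Λ * t) * energy b y z Φ 0 := by
  induction N with
  | zero =>
    intro t ht htN
    have : t = 0 := le_antisymm (by simpa using htN) ht.1
    simp [this]
  | succ N ih =>
    intro t ht htN
    -- The last step starts at `t - h`, or at `0` if that is negative.
    have hγ : max 0 (t - h) ∈ Icc 0 T := ⟨le_max_left _ _, max_le (ht.1.trans ht.2) (by linarith [ht.2])⟩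
    have hγt : max 0 (t - h) ≤ t := max_le ht.1 (by linarith)
    have k1 := ih (max 0 (t - h)) hγ (max_le (by positivity) (by push_cast at htN; linarith))
    have k2 := D.energy_le_step hb hX hM hMh hγ.1 hγt ht.2 (by linarith [le_max_right 0 (t - h)])
    have hX0 : 0 ≤ X := by linarith [D.b_nonneg t ht, hX t ht]
    calc _ ≤ _ := k2
      _ ≤ (4 * X ^ (K + 1)) * Real.exp (8 * Λ * (t - max 0 (t - h))) *
          ((4 * X ^ (K + 1)) ^ N * Real.exp (8 * Λ * max 0 (t - h)) * energy b y z Φ 0) := by gcongr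
      _ = _ := by
          rw [show 8 * Λ * t = 8 * Λ * (t - max 0 (t - h)) + 8 * Λ * max 0 (t - h) by ring,
            Real.exp_add]
          ring

end
end VeryWeak

/-! ### Linear ordinary differential equations depending on a parameter. -/

namespace VeryWeak

section
variable {X : Type*} {E : Type*} [NormedAddCommGroup E] [NormedSpace ℝ E]

/-- The terms of the Picard (Dyson) series of the linear equation `Y' = A Y + b`. -/
noncomputable def picardTerm (A : ℝ → X → E →L[ℝ] E) (b : ℝ → X → E) (Y₀ : X → E) :
    ℕ → ℝ → X → E
  | 0 => fun t x => Y₀ x + ∫ s in (0 : ℝ)..t, b s x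
  | j + 1 => fun t x => ∫ s in (0 : ℝ)..t, A s x (picardTerm A b Y₀ j s x)

variable {A : ℝ → X → E →L[ℝ] E} {b : ℝ → X → E} {Y₀ : X → E}

theorem norm_picardTerm_le {T M C : ℝ} {x : X} (hM : ∀ t ∈ Icc 0 T, ‖A t x‖ ≤ M)
    (hC : ∀ t ∈ Icc 0 T, ‖picardTerm A b Y₀ 0 t x‖ ≤ C) (j : ℕ) :
    ∀ t ∈ Icc 0 T, ‖picardTerm A b Y₀ j t x‖ ≤ C * M ^ j * t ^ j / j.factorial := by
  induction j with
  | zero => intro t ht; simpa using hC t ht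
  | succ j ih =>
    intro t ht
    have h1 : ‖∫ s in (0 : ℝ)..t, A s x (picardTerm A b Y₀ j s x)‖
        ≤ ∫ s in (0 : ℝ)..t, M * (C * M ^ j * s ^ j / j.factorial) := by
      refine intervalIntegral.norm_integral_le_of_norm_le ht.1 ?_ ?_
      · refine Eventually.of_forall fun s hs => ?_
        have hs' : s ∈ Icc 0 T := ⟨hs.1.le, hs.2.trans ht.2⟩
        refine (ContinuousLinearMap.le_opNorm _ _).trans ?_
        exact mul_le_mul (hM s hs') (ih s hs') (norm_nonneg _) ((norm_nonneg _).trans (hM s hs'))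
      · exact (by fun_prop : Continuous fun s : ℝ => M * (C * M ^ j * s ^ j / j.factorial)).intervalIntegrable _ _
    refine h1.trans (le_of_eq ?_)
    have h2 : ∀ s : ℝ, M * (C * M ^ j * s ^ j / j.factorial) = (C * M ^ (j + 1) / j.factorial) * s ^ j := by
      intro s; ring
    simp only [h2, intervalIntegral.integral_const_mul, integral_pow]
    rw [Nat.factorial_succ]
    push_cast
    have : (j.factorial : ℝ) ≠ 0 := by exact_mod_cast Nat.factorial_ne_zero j
    field_simp
    ring

variable [TopologicalSpace X]

theorem continuous_picardTerm (hA : Continuous fun p : ℝ × X => A p.1 p.2)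
    (hb : Continuous fun p : ℝ × X => b p.1 p.2) (hY : Continuous Y₀) (j : ℕ) :
    Continuous fun p : ℝ × X => picardTerm A b Y₀ j p.1 p.2 := by
  have key : ∀ g : ℝ → X → E, Continuous (fun p : ℝ × X => g p.1 p.2) →
      Continuous fun p : ℝ × X => ∫ s in (0 : ℝ)..p.1, g s p.2 := by
    intro g hg
    exact intervalIntegral.continuous_parametric_intervalIntegral_of_continuous
      (f := fun (p : ℝ × X) s => g s p.2) (by
        exact hg.comp (continuous_snd.prodMk (continuous_snd.comp continuous_fst))) continuous_fst
  induction j with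
  | zero => exact (hY.comp continuous_snd).add (key b hb)
  | succ j ih => exact key (fun s x => A s x (picardTerm A b Y₀ j s x)) (hA.clm_apply ih)

/-- The explicit series is used because every term is jointly continuous in time and parameter. The
solution is then a pointwise limit of continuous functions of the parameter, hence measurable,
without any bound uniform in the parameter. -/
theorem exists_solution_linear_ode [CompleteSpace E] [MeasurableSpace X] [BorelSpace X] [MeasurableSpace E]
    [BorelSpace E] [SecondCountableTopology E] {T : ℝ} (hT : 0 ≤ T)
    (hA : Continuous fun p : ℝ × X => A p.1 p.2)
    (hb : Continuous fun p : ℝ × X => b p.1 p.2) (hY : Continuous Y₀) :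
    ∃ Y : ℝ → X → E, (∀ t ∈ Icc 0 T, Measurable (Y t)) ∧ ∀ x, Y 0 x = Y₀ x ∧
      ∀ t ∈ Icc 0 T, HasDerivWithinAt (fun t => Y t x) (A t x (Y t x) + b t x) (Icc 0 T) t := by
  set S := picardTerm A b Y₀
  have hSc : ∀ j, Continuous fun p : ℝ × X => S j p.1 p.2 := continuous_picardTerm hA hb hY
  have hSx : ∀ j x, Continuous fun t => S j t x := fun j x =>
    (hSc j).comp (continuous_id.prodMk continuous_const)
  have hAx : ∀ x, Continuous fun t => A t x := fun x =>
    hA.comp (continuous_id.prodMk continuous_const)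
  have hbx : ∀ x, Continuous fun t => b t x := fun x =>
    hb.comp (continuous_id.prodMk continuous_const)
  have hbound : ∀ x, ∃ C M : ℝ, 0 ≤ C ∧ 0 ≤ M ∧ (∀ t ∈ Icc 0 T, ‖A t x‖ ≤ M) ∧
      ∀ j, ∀ t ∈ Icc 0 T, ‖S j t x‖ ≤ C * ((M * T) ^ j / j.factorial) := by
    intro x
    obtain ⟨M, hM⟩ := isCompact_Icc.exists_bound_of_continuousOn (s := Icc 0 T) (hAx x).continuousOn
    obtain ⟨C, hC⟩ := isCompact_Icc.exists_bound_of_continuousOn (s := Icc 0 T) (hSx 0 x).continuousOn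
    have h0 : (0 : ℝ) ∈ Icc 0 T := ⟨le_rfl, hT⟩
    have hC0 : 0 ≤ C := (norm_nonneg _).trans (hC 0 h0)
    have hM0 : 0 ≤ M := (norm_nonneg _).trans (hM 0 h0)
    refine ⟨C, M, hC0, hM0, hM, fun j t ht => ?_⟩
    refine (norm_picardTerm_le hM hC j t ht).trans ?_
    rw [mul_pow, mul_div_assoc, mul_assoc, ← mul_div_assoc]
    have := ht.1
    gcongr
    exact ht.2
  have hsummable : ∀ C M : ℝ, Summable fun j : ℕ => C * ((M * T) ^ j / j.factorial) := fun C M =>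
    (Real.summable_pow_div_factorial (M * T)).mul_left C
  -- Clamping time to `[0,T]` makes the integrand continuous on the whole line, so the fundamental
  -- theorem of calculus applies at the end points as well.
  set p : ℝ → ℝ := fun t => max 0 (min T t)
  have hp : ∀ t, p t ∈ Icc 0 T := fun t => ⟨le_max_left _ _, max_le hT (min_le_left _ _)⟩
  have hpc : Continuous p := by fun_prop
  have hpe : ∀ t ∈ Icc 0 T, p t = t := fun t ht => by
    simp only [p]; rw [min_eq_right ht.2, max_eq_right ht.1]
  set Y : ℝ → X → E := fun t x => ∑' j, S j t x
  have hsumx : ∀ x, ∀ t ∈ Icc 0 T, HasSum (fun j => S j t x) (Y t x) := by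
    intro x t ht
    obtain ⟨C, M, hC, hM, -, hb⟩ := hbound x
    exact (Summable.of_norm_bounded (hsummable C M) fun j => hb j t ht).hasSum
  have hYc : ∀ x, Continuous fun t => Y (p t) x := by
    intro x
    obtain ⟨C, M, hC, hM, -, hb⟩ := hbound x
    exact continuous_tsum (fun j => (hSx j x).comp hpc) (hsummable C M) fun j t => hb j _ (hp t)
  have hYint : ∀ x, ∀ t ∈ Icc 0 T, Y t x = Y₀ x + ∫ s in (0 : ℝ)..t, (A s x (Y (p s) x) + b s x) := by
    intro x t ht
    obtain ⟨C, M, hC, hM, hAM, hbd⟩ := hbound x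
    have h1 : HasSum (fun j => ∫ s in (0 : ℝ)..t, A s x (S j s x)) (∫ s in (0 : ℝ)..t, A s x (Y (p s) x)) := by
      refine intervalIntegral.hasSum_integral_of_dominated_convergence
        (fun j _ => M * (C * ((M * T) ^ j / j.factorial))) (fun j => ?_) (fun j => ?_) ?_ ?_ ?_
      · exact ((hAx x).clm_apply (hSx j x)).aestronglyMeasurable
      · refine Eventually.of_forall fun s hs => ?_
        rw [uIoc_of_le ht.1] at hs
        have hs' : s ∈ Icc 0 T := ⟨hs.1.le, hs.2.trans ht.2⟩
        refine (ContinuousLinearMap.le_opNorm _ _).trans ?_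
        exact mul_le_mul (hAM s hs') (hbd j s hs') (norm_nonneg _) hM
      · exact Eventually.of_forall fun s _ => (hsummable C M).mul_left M
      · simp
      · refine Eventually.of_forall fun s hs => ?_
        rw [uIoc_of_le ht.1] at hs
        have hs' : s ∈ Icc 0 T := ⟨hs.1.le, hs.2.trans ht.2⟩
        rw [hpe s hs']
        exact (A s x).hasSum (hsumx x s hs')
    have h2 := (hsumx x t ht).summable.tsum_eq_zero_add
    have h3 : Y t x = S 0 t x + ∫ s in (0 : ℝ)..t, A s x (Y (p s) x) := by
      rw [← h1.tsum_eq]; exact h2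
    rw [h3, intervalIntegral.integral_add (((hAx x).clm_apply (hYc x)).intervalIntegrable _ _)
      ((hbx x).intervalIntegrable _ _)]
    change Y₀ x + _ + _ = _
    abel
  refine ⟨Y, fun t ht => ?_, fun x => ⟨?_, fun t ht => ?_⟩⟩
  · refine measurable_of_tendsto_metrizable (f := fun k : ℕ => fun x => ∑ j ∈ Finset.range k, S j t x)
      (fun k => ?_) ?_
    · exact (continuous_finsetSum _ fun j _ =>
        (hSc j).comp (continuous_const.prodMk continuous_id)).measurable
    · rw [tendsto_pi_nhds]
      exact fun x => (hsumx x t ht).tendsto_sum_nat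
  · rw [hYint x 0 ⟨le_rfl, hT⟩]; simp
  · have h1 : HasDerivAt (fun t => Y₀ x + ∫ s in (0 : ℝ)..t, (A s x (Y (p s) x) + b s x))
        (A t x (Y (p t) x) + b t x) t := by
      have hc : Continuous fun s => A s x (Y (p s) x) + b s x :=
        ((hAx x).clm_apply (hYc x)).add (hbx x)
      exact (intervalIntegral.integral_hasDerivAt_right (hc.intervalIntegrable _ _)
        (hc.stronglyMeasurableAtFilter _ _) hc.continuousAt).const_add _
    rw [hpe t ht] at h1
    exact h1.hasDerivWithinAt.congr (fun s hs => hYint x s hs) (hYint x t ht)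

theorem exists_solution_second_order [MeasurableSpace X] [BorelSpace X] {T : ℝ} (hT : 0 ≤ T)
    {P Q F : ℝ → X → ℂ} {y₀ y₁ : X → ℂ} (hP : Continuous fun p : ℝ × X => P p.1 p.2)
    (hQ : Continuous fun p : ℝ × X => Q p.1 p.2) (hF : Continuous fun p : ℝ × X => F p.1 p.2)
    (hy₀ : Continuous y₀) (hy₁ : Continuous y₁) :
    ∃ y z : ℝ → X → ℂ, (∀ t ∈ Icc 0 T, Measurable (y t)) ∧ (∀ t ∈ Icc 0 T, Measurable (z t)) ∧
      ∀ x, y 0 x = y₀ x ∧ z 0 x = y₁ x ∧ ∀ t ∈ Icc 0 T,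
        HasDerivWithinAt (fun t => y t x) (z t x) (Icc 0 T) t ∧
        HasDerivWithinAt (fun t => z t x) (F t x - P t x * y t x - Q t x * z t x) (Icc 0 T) t := by
  let fst := ContinuousLinearMap.fst ℂ ℂ ℂ
  let snd := ContinuousLinearMap.snd ℂ ℂ ℂ
  let A₀ : ℂ × ℂ →L[ℂ] ℂ × ℂ := snd.prod 0
  let A₁ : ℂ × ℂ →L[ℂ] ℂ × ℂ := ContinuousLinearMap.prod 0 (-fst)
  let A₂ : ℂ × ℂ →L[ℂ] ℂ × ℂ := ContinuousLinearMap.prod 0 (-snd)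
  obtain ⟨Y, hYm, hY⟩ := exists_solution_linear_ode (T := T) (E := ℂ × ℂ) (X := X) hT
    (A := fun t x => (A₀ + P t x • A₁ + Q t x • A₂).restrictScalars ℝ)
    (b := fun t x => (0, F t x)) (Y₀ := fun x => (y₀ x, y₁ x)) (by
      have : Continuous fun p : ℝ × X => A₀ + P p.1 p.2 • A₁ + Q p.1 p.2 • A₂ :=
        (continuous_const.add (hP.smul continuous_const)).add (hQ.smul continuous_const)
      exact (ContinuousLinearMap.restrictScalarsL ℂ (ℂ × ℂ) (ℂ × ℂ) ℝ ℝ).continuous.comp this)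
    (continuous_const.prodMk hF) (hy₀.prodMk hy₁)
  refine ⟨fun t x => (Y t x).1, fun t x => (Y t x).2, fun t ht => (hYm t ht).fst,
    fun t ht => (hYm t ht).snd, fun x => ⟨by simp [(hY x).1], by simp [(hY x).1], fun t ht => ?_⟩⟩
  have h := (hY x).2 t ht
  refine ⟨?_, ?_⟩
  · have h1 := (ContinuousLinearMap.fst ℝ ℂ ℂ).hasFDerivAt.comp_hasDerivWithinAt t h
    refine HasDerivWithinAt.congr_deriv (f := fun t => (Y t x).1) h1 ?_
    simp [A₀, A₁, A₂, fst, snd]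
  · have h1 := (ContinuousLinearMap.snd ℝ ℂ ℂ).hasFDerivAt.comp_hasDerivWithinAt t h
    refine HasDerivWithinAt.congr_deriv (f := fun t => (Y t x).2) h1 ?_
    simp [A₀, A₁, A₂, fst, snd]
    ring
end
end VeryWeak

/-! ### Differentiation under the integral and Fourier transforms of time-dependent families. -/

namespace VeryWeak

/-- Convexity of `S` lets the mean value inequality convert the bound on the derivatives into a
Lipschitz bound on `S`; the difference quotients are then dominated. Working within `S` covers
one-sided time derivatives at `0` and `T`. -/
theorem hasFDerivWithinAt_integral_of_dominated {α H V : Type*} [MeasurableSpace α] {μ : Measure α}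
    [NormedAddCommGroup H] [NormedSpace ℝ H] [NormedAddCommGroup V] [NormedSpace ℝ V]
    [CompleteSpace V] {F : H → α → V} {F' : H → α → H →L[ℝ] V} {S : Set H} {z₀ : H}
    {bound : α → ℝ} (hS : Convex ℝ S) (hz₀ : z₀ ∈ S)
    (hF_meas : ∀ z ∈ S, AEStronglyMeasurable (F z) μ) (hF_int : Integrable (F z₀) μ)
    (hF'_meas : AEStronglyMeasurable (F' z₀) μ) (h_bound : ∀ a, ∀ z ∈ S, ‖F' z a‖ ≤ bound a)
    (bound_int : Integrable bound μ)
    (h_diff : ∀ a, ∀ z ∈ S, HasFDerivWithinAt (fun z => F z a) (F' z a) S z) :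
    HasFDerivWithinAt (fun z => ∫ a, F z a ∂μ) (∫ a, F' z₀ a ∂μ) S z₀ := by
  have hlip : ∀ a, ∀ z ∈ S, ‖F z a - F z₀ a‖ ≤ bound a * ‖z - z₀‖ := fun a z hz =>
    hS.norm_image_sub_le_of_norm_hasFDerivWithin_le (fun z hz => h_diff a z hz)
      (fun z hz => h_bound a z hz) hz₀ hz
  have hF_int' : ∀ z ∈ S, Integrable (F z) μ := fun z hz =>
    integrable_of_norm_sub_le (hF_meas z hz) hF_int (bound_int.mul_const ‖z - z₀‖)
      (Eventually.of_forall fun a => by rw [norm_sub_rev]; exact hlip a z hz)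
  have hF'_int : Integrable (F' z₀) μ :=
    bound_int.mono' hF'_meas (Eventually.of_forall fun a => h_bound a z₀ hz₀)
  have nneg : ∀ z : H, 0 ≤ ‖z - z₀‖⁻¹ := fun z => inv_nonneg.mpr (norm_nonneg _)
  have heq : ∀ᶠ z in 𝓝[S] z₀, ‖z - z₀‖⁻¹ *
      ‖((∫ a, F z a ∂μ) - ∫ a, F z₀ a ∂μ) - (∫ a, F' z₀ a ∂μ) (z - z₀)‖ =
      ‖∫ a, ‖z - z₀‖⁻¹ • (F z a - F z₀ a - F' z₀ a (z - z₀)) ∂μ‖ := by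
    filter_upwards [self_mem_nhdsWithin] with z hz
    rw [← norm_smul_of_nonneg (nneg _), integral_smul, integral_sub, integral_sub,
      ← ContinuousLinearMap.integral_apply hF'_int]
    exacts [hF_int' z hz, hF_int, (hF_int' z hz).sub hF_int, hF'_int.apply_continuousLinearMap _]
  rw [hasFDerivWithinAt_iff_tendsto, tendsto_congr' heq, ← tendsto_zero_iff_norm_tendsto_zero, ←
    show (∫ a : α, ‖z₀ - z₀‖⁻¹ • (F z₀ a - F z₀ a - (F' z₀ a) (z₀ - z₀)) ∂μ) = 0 by simp]
  refine tendsto_integral_filter_of_dominated_convergence (bound := fun a => bound a + ‖F' z₀ a‖)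
    ?_ ?_ (bound_int.add hF'_int.norm) ?_
  · filter_upwards [self_mem_nhdsWithin] with z hz
    exact (((hF_meas _ hz).sub hF_int.1).sub (hF'_meas.apply_continuousLinearMap _)).const_smul _
  · filter_upwards [self_mem_nhdsWithin] with z hz
    refine Eventually.of_forall fun a => ?_
    rw [norm_smul_of_nonneg (nneg _)]
    rcases eq_or_ne z z₀ with rfl | hne
    · have := (norm_nonneg _).trans (h_bound a z hz)
      simp only [sub_self, norm_zero, inv_zero, zero_mul]
      positivity
    · have hp : 0 < ‖z - z₀‖ := norm_pos_iff.2 (sub_ne_zero.2 hne)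
      rw [inv_mul_le_iff₀ hp]
      refine (norm_sub_le _ _).trans ?_
      have := (F' z₀ a).le_opNorm (z - z₀)
      have := hlip a z hz
      nlinarith
  · refine Eventually.of_forall fun a => ?_
    have ha := h_diff a z₀ hz₀
    suffices h : Tendsto (fun z => ‖z - z₀‖⁻¹ • (F z a - F z₀ a - F' z₀ a (z - z₀))) (𝓝[S] z₀) (𝓝 0) by
      simpa using h
    rw [tendsto_zero_iff_norm_tendsto_zero]
    have e : (fun z => ‖‖z - z₀‖⁻¹ • (F z a - F z₀ a - F' z₀ a (z - z₀))‖) = fun z =>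
        ‖z - z₀‖⁻¹ * ‖F z a - F z₀ a - F' z₀ a (z - z₀)‖ := by
      ext z; rw [norm_smul_of_nonneg (nneg _)]
    rw [e]
    exact hasFDerivWithinAt_iff_tendsto.1 ha

theorem hasDerivWithinAt_integral_of_dominated {α V : Type*} [MeasurableSpace α] {μ : Measure α}
    [NormedAddCommGroup V] [NormedSpace ℝ V] [CompleteSpace V] {F F' : ℝ → α → V} {S : Set ℝ}
    {t₀ : ℝ} {bound : α → ℝ} (hS : Convex ℝ S) (ht₀ : t₀ ∈ S)
    (hF_meas : ∀ t ∈ S, AEStronglyMeasurable (F t) μ) (hF_int : Integrable (F t₀) μ)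
    (hF'_meas : AEStronglyMeasurable (F' t₀) μ) (h_bound : ∀ a, ∀ t ∈ S, ‖F' t a‖ ≤ bound a)
    (bound_int : Integrable bound μ)
    (h_diff : ∀ a, ∀ t ∈ S, HasDerivWithinAt (fun t => F t a) (F' t a) S t) :
    HasDerivWithinAt (fun t => ∫ a, F t a ∂μ) (∫ a, F' t₀ a ∂μ) S t₀ := by
  let L := ContinuousLinearMap.smulRightL ℝ ℝ V (1 : ℝ →L[ℝ] ℝ)
  have hL : ∀ v, L v = ContinuousLinearMap.toSpanSingleton ℝ v := fun v => by ext; simp [L]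
  have hF'_int : Integrable (F' t₀) μ :=
    bound_int.mono' hF'_meas (Eventually.of_forall fun a => h_bound a t₀ ht₀)
  have h := hasFDerivWithinAt_integral_of_dominated (F' := fun t a => L (F' t a)) (bound := bound)
    hS ht₀ hF_meas hF_int (L.continuous.comp_aestronglyMeasurable hF'_meas) (fun a t ht => by
      rw [hL, ContinuousLinearMap.norm_toSpanSingleton]; exact h_bound a t ht) bound_int
    (fun a t ht => by rw [hL]; exact (h_diff a t ht).hasFDerivWithinAt)
  rw [L.integral_comp_comm hF'_int, hL] at h
  simpa using h.hasDerivWithinAt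

/-- Families of functions of `(t, ξ)` that are successive `t`-derivatives and decay rapidly. -/
structure IsTower {n : ℕ} (T : ℝ) (w : ℕ → ℝ → Sp n → ℂ) : Prop where
  meas : ∀ k, ∀ t ∈ Icc 0 T, AEStronglyMeasurable (w k t) volume
  deriv : ∀ k ξ, ∀ t ∈ Icc 0 T, HasDerivWithinAt (fun t => w k t ξ) (w (k + 1) t ξ) (Icc 0 T) t
  bound : ∀ k m, ∃ g : Sp n → ℝ, Integrable g ∧ ∀ t ∈ Icc 0 T, ∀ ξ, ‖ξ‖ ^ m * ‖w k t ξ‖ ≤ g ξ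

variable {n : ℕ} {T : ℝ} {w : ℕ → ℝ → Sp n → ℂ}

theorem IsTower.integrable_pow_mul (hw : IsTower T w) (k m : ℕ) {t : ℝ} (ht : t ∈ Icc 0 T) :
    Integrable fun ξ => ‖ξ‖ ^ m * ‖w k t ξ‖ := by
  obtain ⟨g, hg, hb⟩ := hw.bound k m
  refine hg.mono' ((by fun_prop : Continuous fun ξ : Sp n => ‖ξ‖ ^ m).aestronglyMeasurable.mul
    (hw.meas k t ht).norm) (Eventually.of_forall fun ξ => ?_)
  rw [Real.norm_of_nonneg (by positivity)]
  exact hb t ht ξ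

theorem IsTower.integrable (hw : IsTower T w) (k : ℕ) {t : ℝ} (ht : t ∈ Icc 0 T) :
    Integrable (w k t) := by
  have := hw.integrable_pow_mul k 0 ht
  simp only [pow_zero, one_mul] at this
  exact (integrable_norm_iff (hw.meas k t ht)).1 this

theorem IsTower.shift (hw : IsTower T w) : IsTower T fun k => w (k + 1) where
  meas k := hw.meas (k + 1)
  deriv k := hw.deriv (k + 1)
  bound k := hw.bound (k + 1)

theorem IsTower.mul_coord (hw : IsTower T w) (c : ℂ) (i : Fin n) :
    IsTower T fun k t ξ => c * (ξ i : ℂ) * w k t ξ where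
  meas k t ht := (by fun_prop : Continuous fun ξ : Sp n => c * (ξ i : ℂ)).aestronglyMeasurable.mul
    (hw.meas k t ht)
  deriv k ξ t ht := (hw.deriv k ξ t ht).const_mul _
  bound k m := by
    obtain ⟨g, hg, hb⟩ := hw.bound k (m + 1)
    refine ⟨fun ξ => ‖c‖ * g ξ, hg.const_mul _, fun t ht ξ => ?_⟩
    have h1 : ‖(ξ i : ℂ)‖ ≤ ‖ξ‖ := by
      rw [Complex.norm_real]; exact PiLp.norm_apply_le ξ i
    calc _ = ‖c‖ * (‖ξ‖ ^ m * (‖(ξ i : ℂ)‖ * ‖w k t ξ‖)) := by rw [norm_mul, norm_mul]; ring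
      _ ≤ ‖c‖ * (‖ξ‖ ^ m * (‖ξ‖ * ‖w k t ξ‖)) := by gcongr
      _ = ‖c‖ * (‖ξ‖ ^ (m + 1) * ‖w k t ξ‖) := by ring
      _ ≤ _ := mul_le_mul_of_nonneg_left (hb t ht ξ) (norm_nonneg _)

open FourierTransform Real VectorFourier

theorem norm_fourierChar_smul_fourierPowSMulRight_le (f : Sp n → ℂ) (x ξ : Sp n) (m : ℕ) :
    ‖(𝐞 (-inner ℝ ξ x) • fourierPowSMulRight (innerSL ℝ) f ξ m : Sp n [×m]→L[ℝ] ℂ)‖ ≤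
      (2 * π) ^ m * (‖ξ‖ ^ m * ‖f ξ‖) := by
  have h1 := norm_fourierPowSMulRight_le (innerSL ℝ (E := Sp n)) f ξ m
  have h2 : ‖innerSL ℝ (E := Sp n)‖ ≤ 1 := norm_innerSL_le ℝ
  have h3 : (2 * π * ‖innerSL ℝ (E := Sp n)‖) ^ m ≤ (2 * π) ^ m :=
    pow_le_pow_left₀ (by positivity) (mul_le_of_le_one_right (by positivity) h2) m
  simp only [Circle.smul_def]
  rw [norm_smul (𝐞 (-inner ℝ ξ x) : ℂ) (fourierPowSMulRight (innerSL ℝ) f ξ m : Sp n [×m]→L[ℝ] ℂ),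
    Circle.norm_coe, one_mul]
  refine h1.trans ?_
  rw [mul_assoc]
  gcongr

/-- The integrand of the `m`-th `x`-derivative depends on `f` only through `f ξ`, and continuously
and linearly. Time derivatives therefore pass through it by the chain rule. -/
theorem exists_fourierChar_smul_fourierPowSMulRight_eq (x ξ : Sp n) (m : ℕ) :
    ∃ A : ℂ →L[ℝ] (Sp n [×m]→L[ℝ] ℂ), ∀ f : Sp n → ℂ,
      (𝐞 (-inner ℝ ξ x) • fourierPowSMulRight (innerSL ℝ) f ξ m : Sp n [×m]→L[ℝ] ℂ) =
        A (f ξ) := by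
  refine ⟨((𝐞 (-inner ℝ ξ x) : ℂ) * (-(2 * π * Complex.I)) ^ m) •
    ContinuousMultilinearMap.smulRightL ℝ (fun _ : Fin m => Sp n) ℂ
      (ContinuousMultilinearMap.compContinuousLinearMapLRight
        (ContinuousMultilinearMap.mkPiAlgebra ℝ (Fin m) ℝ) (fun _ => innerSL ℝ ξ)), fun f => ?_⟩
  rw [fourierPowSMulRight_eq_comp]
  ext v
  simp only [Circle.smul_def]
  simp [mul_assoc]
  left; rfl

theorem IsTower.hasDerivWithinAt_fourierPow (hw : IsTower T w) (k m : ℕ) (x : Sp n) {t : ℝ}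
    (ht : t ∈ Icc 0 T) :
    HasDerivWithinAt (fun t => 𝓕 (fun ξ => fourierPowSMulRight (innerSL ℝ) (w k t) ξ m) x)
      (𝓕 (fun ξ => fourierPowSMulRight (innerSL ℝ) (w (k + 1) t) ξ m) x) (Icc 0 T) t := by
  obtain ⟨g, hg, hb⟩ := hw.bound (k + 1) m
  have hmeas : ∀ k, ∀ t ∈ Icc 0 T, AEStronglyMeasurable
      (fun ξ : Sp n => 𝐞 (-inner ℝ ξ x) • fourierPowSMulRight (innerSL ℝ) (w k t) ξ m) volume := by
    intro k t ht
    simp only [Circle.smul_def]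
    exact AEStronglyMeasurable.smul
      (by fun_prop : Continuous fun ξ : Sp n => (𝐞 (-inner ℝ ξ x) : ℂ)).aestronglyMeasurable
      ((hw.meas k t ht).fourierPowSMulRight _ m)
  simp only [Real.fourier_eq]
  refine hasDerivWithinAt_integral_of_dominated
    (F := fun t ξ => 𝐞 (-inner ℝ ξ x) • fourierPowSMulRight (innerSL ℝ) (w k t) ξ m)
    (F' := fun t ξ => 𝐞 (-inner ℝ ξ x) • fourierPowSMulRight (innerSL ℝ) (w (k + 1) t) ξ m)
    (bound := fun ξ => (2 * π) ^ m * g ξ) (convex_Icc 0 T) ht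
    (hmeas k) ?_ (hmeas (k + 1) t ht) (fun ξ t ht => ?_) (hg.const_mul _) fun ξ t ht => ?_
  · refine (integrable_fourierPowSMulRight (innerSL ℝ) (hw.integrable_pow_mul k m ht)
      (hw.meas k t ht)).norm.mono' (hmeas k t ht) (Eventually.of_forall fun ξ => ?_)
    simp only [Circle.smul_def]
    rw [norm_smul (𝐞 (-inner ℝ ξ x) : ℂ)
      (fourierPowSMulRight (innerSL ℝ) (w k t) ξ m : Sp n [×m]→L[ℝ] ℂ), Circle.norm_coe, one_mul]
  · refine (norm_fourierChar_smul_fourierPowSMulRight_le _ _ _ _).trans ?_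
    exact mul_le_mul_of_nonneg_left (hb t ht ξ) (by positivity)
  · obtain ⟨A, hA⟩ := exists_fourierChar_smul_fourierPowSMulRight_eq x ξ m
    simp only [hA]
    exact A.hasFDerivAt.comp_hasDerivWithinAt t (hw.deriv k ξ t ht)

theorem IsTower.iteratedFDeriv_fourier (hw : IsTower T w) (k m : ℕ) (x : Sp n) {t : ℝ}
    (ht : t ∈ Icc 0 T) :
    iteratedFDeriv ℝ m (𝓕 (w k t)) x =
      𝓕 (fun ξ => (fourierPowSMulRight (innerSL ℝ) (w k t) ξ m : Sp n [×m]→L[ℝ] ℂ)) x := by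
  rw [Real.iteratedFDeriv_fourier (N := ⊤) (fun j _ => hw.integrable_pow_mul k j ht)
    (hw.meas k t ht) le_top]

theorem IsTower.norm_iteratedFDeriv_fourier_le (hw : IsTower T w) (k m : ℕ) (x : Sp n) {t : ℝ}
    (ht : t ∈ Icc 0 T) :
    ‖iteratedFDeriv ℝ m (𝓕 (w k t)) x‖ ≤ (2 * π) ^ m * ∫ ξ, ‖ξ‖ ^ m * ‖w k t ξ‖ := by
  rw [hw.iteratedFDeriv_fourier k m x ht, Real.fourier_eq, ← integral_const_mul]
  exact norm_integral_le_of_norm_le ((hw.integrable_pow_mul k m ht).const_mul _)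
    (Eventually.of_forall fun ξ => norm_fourierChar_smul_fourierPowSMulRight_le _ _ _ _)

theorem IsTower.iteratedDerivWithin_iteratedFDeriv (hw : IsTower T w) (hT : 0 < T) (k m : ℕ)
    (x : Sp n) {t : ℝ} (ht : t ∈ Icc 0 T) :
    iteratedDerivWithin k (fun τ => iteratedFDeriv ℝ m (𝓕 (w 0 τ)) x) (Icc 0 T) t =
      iteratedFDeriv ℝ m (𝓕 (w k t)) x := by
  induction k generalizing t with
  | zero => simp
  | succ k ih =>
    rw [iteratedDerivWithin_succ]
    have : HasDerivWithinAt (fun τ => iteratedFDeriv ℝ m (𝓕 (w k τ)) x)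
        (iteratedFDeriv ℝ m (𝓕 (w (k + 1) t)) x) (Icc 0 T) t := by
      rw [hw.iteratedFDeriv_fourier (k + 1) m x ht]
      exact (hw.hasDerivWithinAt_fourierPow k m x ht).congr_of_mem
        (fun τ hτ => hw.iteratedFDeriv_fourier k m x hτ) ht
    rw [derivWithin_congr (fun τ hτ => ih hτ) (ih ht)]
    exact this.derivWithin (uniqueDiffOn_Icc hT t ht)

theorem IsTower.hasDerivWithinAt_fourier (hw : IsTower T w) (k : ℕ) (x : Sp n) {t : ℝ}
    (ht : t ∈ Icc 0 T) :
    HasDerivWithinAt (fun τ => 𝓕 (w k τ) x) (𝓕 (w (k + 1) t) x) (Icc 0 T) t := by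
  obtain ⟨g, hg, hb⟩ := hw.bound (k + 1) 0
  have hmeas : ∀ k, ∀ t ∈ Icc 0 T, AEStronglyMeasurable
      (fun ξ : Sp n => 𝐞 (-inner ℝ ξ x) • w k t ξ) volume := by
    intro k t ht
    simp only [Circle.smul_def]
    exact AEStronglyMeasurable.smul
      (by fun_prop : Continuous fun ξ : Sp n => (𝐞 (-inner ℝ ξ x) : ℂ)).aestronglyMeasurable
      (hw.meas k t ht)
  simp only [Real.fourier_eq]
  refine hasDerivWithinAt_integral_of_dominated
    (F := fun t ξ => 𝐞 (-inner ℝ ξ x) • w k t ξ)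
    (F' := fun t ξ => 𝐞 (-inner ℝ ξ x) • w (k + 1) t ξ)
    (bound := g) (convex_Icc 0 T) ht
    (hmeas k) ?_ (hmeas (k + 1) t ht) (fun ξ t ht => ?_) hg fun ξ t ht => ?_
  · refine (hw.integrable k ht).norm.mono' (hmeas k t ht) (Eventually.of_forall fun ξ => ?_)
    rw [Circle.norm_smul]
  · rw [Circle.norm_smul]
    simpa using hb t ht ξ
  · simp only [Circle.smul_def]
    exact (hw.deriv k ξ t ht).const_smul (𝐞 (-inner ℝ ξ x) : ℂ)

theorem IsTower.iteratedDerivWithin_fourier (hw : IsTower T w) (hT : 0 < T) (k : ℕ)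
    (x : Sp n) {t : ℝ} (ht : t ∈ Icc 0 T) :
    iteratedDerivWithin k (fun τ => 𝓕 (w 0 τ) x) (Icc 0 T) t = 𝓕 (w k t) x := by
  induction k generalizing t with
  | zero => simp
  | succ k ih =>
    rw [iteratedDerivWithin_succ, derivWithin_congr (fun τ hτ => ih hτ) (ih ht)]
    exact (hw.hasDerivWithinAt_fourier k x ht).derivWithin (uniqueDiffOn_Icc hT t ht)

theorem pd_fourier {v : Sp n → ℂ} (h0 : Integrable v) (h1 : Integrable fun ξ => ‖ξ‖ * ‖v ξ‖)
    (i : Fin n) (x : Sp n) :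
    pd i (𝓕 v) x = 𝓕 (fun ξ => -(2 * π * Complex.I) * (ξ i : ℂ) * v ξ) x := by
  have hI : Integrable (fourierSMulRight (innerSL ℝ) v) := by
    refine (h1.const_mul (2 * π * ‖innerSL ℝ (E := Sp n)‖)).mono'
      h0.1.fourierSMulRight (Eventually.of_forall fun ξ => ?_)
    refine (norm_fourierSMulRight_le _ _ _).trans (le_of_eq (by ring))
  rw [pd, Real.fderiv_fourier h0 h1, Real.fourier_continuousLinearMap_apply hI]
  refine congrArg (fun g : Sp n → ℂ => 𝓕 g x) (funext fun ξ => ?_)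
  have : (innerSL ℝ ξ : Sp n →L[ℝ] ℝ) (EuclideanSpace.single i 1) = ξ i := by
    change inner ℝ ξ (EuclideanSpace.single i 1) = _
    simp [EuclideanSpace.inner_single_right]
  rw [fourierSMulRight_apply, this, Complex.real_smul, smul_eq_mul]
  ring

/-- The linear map on `ℝ × ℝⁿ` with given partial derivatives. -/
noncomputable def partialsCLM (a : ℂ) (b : Fin n → ℂ) : ℝ × Sp n →L[ℝ] ℂ :=
  ContinuousLinearMap.smulRightL ℝ _ ℂ (ContinuousLinearMap.fst ℝ ℝ (Sp n)) a +
    ∑ i, ContinuousLinearMap.smulRightL ℝ _ ℂ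
      ((EuclideanSpace.proj i : Sp n →L[ℝ] ℝ) ∘L ContinuousLinearMap.snd ℝ ℝ (Sp n)) (b i)

theorem partialsCLM_apply (a : ℂ) (b : Fin n → ℂ) (z : ℝ × Sp n) :
    partialsCLM a b z = z.1 • a + ∑ i, z.2 i • b i := by
  simp [partialsCLM]

theorem norm_partialsCLM_le (a : ℂ) (b : Fin n → ℂ) :
    ‖partialsCLM a b‖ ≤ ‖a‖ + ∑ i, ‖b i‖ := by
  refine ContinuousLinearMap.opNorm_le_bound _ (by positivity) fun z => ?_
  rw [partialsCLM_apply, add_mul, Finset.sum_mul]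
  refine (norm_add_le _ _).trans (add_le_add ?_ ((norm_sum_le _ _).trans
    (Finset.sum_le_sum fun i _ => ?_)))
  · rw [norm_smul, mul_comm]
    exact mul_le_mul_of_nonneg_left (norm_fst_le z) (norm_nonneg _)
  · rw [norm_smul, mul_comm]
    exact mul_le_mul_of_nonneg_left ((PiLp.norm_apply_le z.2 i).trans (norm_snd_le z))
      (norm_nonneg _)

theorem aestronglyMeasurable_partialsCLM {α : Type*} [MeasurableSpace α] {μ : Measure α}
    {a : α → ℂ} {b : Fin n → α → ℂ} (ha : AEStronglyMeasurable a μ)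
    (hb : ∀ i, AEStronglyMeasurable (b i) μ) :
    AEStronglyMeasurable (fun v => partialsCLM (a v) fun i => b i v) μ := by
  unfold partialsCLM
  refine AEStronglyMeasurable.add (ContinuousLinearMap.continuous _ |>.comp_aestronglyMeasurable ha)
    (Finset.aestronglyMeasurable_fun_sum _ fun i _ =>
      ContinuousLinearMap.continuous _ |>.comp_aestronglyMeasurable (hb i))

theorem integral_partialsCLM {α : Type*} [MeasurableSpace α] {μ : Measure α}
    {a : α → ℂ} {b : Fin n → α → ℂ} (ha : Integrable a μ) (hb : ∀ i, Integrable (b i) μ) :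
    ∫ v, partialsCLM (a v) (fun i => b i v) ∂μ = partialsCLM (∫ v, a v ∂μ) fun i => ∫ v, b i v ∂μ := by
  unfold partialsCLM
  rw [integral_add (ContinuousLinearMap.integrable_comp _ ha)
    (integrable_finsetSum _ fun i _ => ContinuousLinearMap.integrable_comp _ (hb i)),
    integral_finsetSum _ fun i _ => ContinuousLinearMap.integrable_comp _ (hb i),
    ContinuousLinearMap.integral_comp_comm _ ha]
  congr 1
  exact Finset.sum_congr rfl fun i _ => ContinuousLinearMap.integral_comp_comm _ (hb i)

/-- Each partial derivative is again the Fourier transform of a tower: the time derivative shifts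
the tower and `∂ᵢ` multiplies it by `-2πi ξᵢ`. -/
theorem IsTower.hasFDerivWithinAt_fourier (hw : IsTower T w) {z : ℝ × Sp n}
    (hz : z ∈ Icc 0 T ×ˢ (univ : Set (Sp n))) :
    HasFDerivWithinAt (fun z : ℝ × Sp n => 𝓕 (w 0 z.1) z.2)
      (partialsCLM (𝓕 (w 1 z.1) z.2)
        fun i => 𝓕 (fun ξ => -(2 * π * Complex.I) * (ξ i : ℂ) * w 0 z.1 ξ) z.2)
      (Icc 0 T ×ˢ univ) z := by
  have hS : Convex ℝ (Icc 0 T ×ˢ (univ : Set (Sp n))) := (convex_Icc 0 T).prod convex_univ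
  have hi := fun i => hw.mul_coord (-(2 * π * Complex.I)) i
  have hmeas : ∀ {v : Sp n → ℂ} (x : Sp n), AEStronglyMeasurable v volume → AEStronglyMeasurable
      (fun ξ : Sp n => 𝐞 (-inner ℝ ξ x) • v ξ) volume := by
    intro v x hv
    simp only [Circle.smul_def]
    exact AEStronglyMeasurable.smul
      (by fun_prop : Continuous fun ξ : Sp n => (𝐞 (-inner ℝ ξ x) : ℂ)).aestronglyMeasurable hv
  have hint : ∀ {v : Sp n → ℂ} (x : Sp n), Integrable v → Integrable
      (fun ξ : Sp n => 𝐞 (-inner ℝ ξ x) • v ξ) volume := by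
    intro v x hv
    refine hv.norm.mono' (hmeas x hv.1) (Eventually.of_forall fun ξ => ?_)
    rw [Circle.norm_smul]
  obtain ⟨g, hg, hb⟩ := hw.bound 1 0
  choose gi hgi hbi using fun i => (hi i).bound 0 0
  simp only [Real.fourier_eq]
  rw [← integral_partialsCLM (hint _ (hw.integrable 1 hz.1))
    fun i => hint _ ((hi i).integrable 0 hz.1)]
  refine hasFDerivWithinAt_integral_of_dominated
    (F := fun (z : ℝ × Sp n) ξ => 𝐞 (-inner ℝ ξ z.2) • w 0 z.1 ξ)
    (F' := fun (z : ℝ × Sp n) ξ => partialsCLM (𝐞 (-inner ℝ ξ z.2) • w 1 z.1 ξ)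
      fun i => 𝐞 (-inner ℝ ξ z.2) • (-(2 * π * Complex.I) * (ξ i : ℂ) * w 0 z.1 ξ))
    (bound := fun ξ => g ξ + ∑ i, gi i ξ) hS hz
    (fun z hz => hmeas z.2 (hw.meas 0 z.1 hz.1)) (hint z.2 (hw.integrable 0 hz.1))
    (aestronglyMeasurable_partialsCLM (hmeas z.2 (hw.meas 1 z.1 hz.1))
      fun i => hmeas z.2 ((hi i).meas 0 z.1 hz.1)) (fun ξ z hz => ?_)
    (hg.add (integrable_finsetSum _ fun i _ => hgi i)) fun ξ z hz => ?_
  · refine (norm_partialsCLM_le _ _).trans (add_le_add ?_ (Finset.sum_le_sum fun i _ => ?_))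
    · rw [Circle.norm_smul]; simpa using hb z.1 hz.1 ξ
    · rw [Circle.norm_smul]; simpa using hbi i z.1 hz.1 ξ
  · have h1 : HasFDerivWithinAt (fun z : ℝ × Sp n => w 0 z.1 ξ)
        (ContinuousLinearMap.smulRight (ContinuousLinearMap.fst ℝ ℝ (Sp n)) (w 1 z.1 ξ))
        (Icc 0 T ×ˢ univ) z := by
      have := (hw.deriv 0 ξ z.1 hz.1).hasFDerivWithinAt.comp z
        (hasFDerivWithinAt_fst (s := Icc 0 T ×ˢ (univ : Set (Sp n)))) (fun z hz => hz.1)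
      exact this.congr_fderiv (ContinuousLinearMap.ext fun y => by simp)
    have h2 : HasFDerivWithinAt (fun z : ℝ × Sp n => (𝐞 (-inner ℝ ξ z.2) : ℂ)) _
        (Icc 0 T ×ˢ univ) z :=
      ((hasFDerivAt_fourierChar_neg_bilinear_right (innerSL ℝ) ξ z.2).comp z
        (hasFDerivAt_snd (𝕜 := ℝ) (E := ℝ) (F := Sp n))).hasFDerivWithinAt
    have h3 := h2.mul h1
    simp only [Circle.smul_def, smul_eq_mul]
    refine h3.congr_fderiv (ContinuousLinearMap.ext fun y => ?_)
    rw [partialsCLM_apply]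
    have : (innerSL ℝ ξ : Sp n →L[ℝ] ℝ) y.2 = ∑ i, y.2 i * ξ i := by
      change inner ℝ ξ y.2 = _
      simp [PiLp.inner_apply]
    have h4 : (𝐞 (-inner ℝ ξ z.2) : ℂ) = 𝐞 (-(innerSL ℝ ξ : Sp n →L[ℝ] ℝ) z.2) := rfl
    simp only [h4, Complex.real_smul, FunLike.coe_add, Pi.add_apply, FunLike.coe_smul,
      Pi.smul_apply, ContinuousLinearMap.smulRight_apply, ContinuousLinearMap.coe_fst',
      ContinuousLinearMap.comp_apply, ContinuousLinearMap.coe_snd', smul_eq_mul]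
    rw [Complex.ofRealCLM_apply, this, Complex.ofReal_sum, Finset.mul_sum, Finset.mul_sum]
    congr 1
    · ring
    · refine Finset.sum_congr rfl fun i _ => ?_
      rw [Complex.ofReal_mul]
      ring

/-- Towers are stable under `shift` and `mul_coord`, so the formula for the joint derivative can be
iterated. -/
theorem IsTower.contDiffOn_fourier (hw : IsTower T w) (hT : 0 < T) :
    ContDiffOn ℝ ∞ (fun z : ℝ × Sp n => 𝓕 (w 0 z.1) z.2) (Icc 0 T ×ˢ univ) := by
  have hU : UniqueDiffOn ℝ (Icc 0 T ×ˢ (univ : Set (Sp n))) :=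
    (uniqueDiffOn_Icc hT).prod uniqueDiffOn_univ
  rw [contDiffOn_infty]
  intro N
  induction N generalizing w with
  | zero =>
    rw [Nat.cast_zero, contDiffOn_zero]
    exact fun z hz => (hw.hasFDerivWithinAt_fourier hz).continuousWithinAt
  | succ N ih =>
    rw [Nat.cast_succ, contDiffOn_succ_iff_hasFDerivWithinAt_of_uniqueDiffOn hU]
    refine ⟨by simp, _, ?_, fun z hz => hw.hasFDerivWithinAt_fourier hz⟩
    unfold partialsCLM
    refine ContDiffOn.add ((ContinuousLinearMap.contDiff _).comp_contDiffOn (ih hw.shift))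
      (ContDiffOn.sum fun i _ => (ContinuousLinearMap.contDiff _).comp_contDiffOn
        (ih (hw.mul_coord (-(2 * π * Complex.I)) i)))

end VeryWeak

/-! ### Gevrey weights: exponential decay against factorial bounds. -/

namespace VeryWeak

/-- Raise `x^m / m! ≤ exp x` to the power `s` with `x = (κ/s) r^(1/s)`, so that `exp (s x)` is
exactly the inverse of the exponential factor. -/
theorem pow_mul_exp_neg_rpow_le {s κ r : ℝ} (hs : 0 < s) (hκ : 0 < κ) (hr : 0 ≤ r) (m : ℕ) :
    r ^ m * Real.exp (-(κ * r ^ (1 / s))) ≤ ((s / κ) ^ s) ^ m * (m.factorial : ℝ) ^ s := by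
  set x := κ / s * r ^ (1 / s) with hx
  have hx0 : 0 ≤ x := by positivity
  have h1 : x ^ m / m.factorial ≤ Real.exp x := Real.pow_div_factorial_le_exp x hx0 m
  have h2 : x ^ m ≤ Real.exp x * m.factorial := by
    rwa [div_le_iff₀ (by positivity)] at h1
  have h3 : (x ^ m) ^ s ≤ (Real.exp x * m.factorial) ^ s :=
    Real.rpow_le_rpow (by positivity) h2 hs.le
  have h4 : (x ^ m) ^ s = ((κ / s) ^ s) ^ m * r ^ m := by
    rw [← Real.rpow_natCast x, ← Real.rpow_mul hx0, mul_comm, Real.rpow_mul hx0, Real.rpow_natCast,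
      hx, Real.mul_rpow (by positivity) (by positivity), ← Real.rpow_mul hr,
      one_div_mul_cancel hs.ne', Real.rpow_one, mul_pow]
  have h5 : (Real.exp x * m.factorial) ^ s = Real.exp (κ * r ^ (1 / s)) * (m.factorial : ℝ) ^ s := by
    rw [Real.mul_rpow (by positivity) (by positivity), ← Real.exp_mul, hx]
    congr 2
    field_simp
  rw [h4, h5] at h3
  have h6 : ((s / κ) ^ s) ^ m * ((κ / s) ^ s) ^ m = 1 := by
    rw [← mul_pow, ← Real.mul_rpow (by positivity) (by positivity), div_mul_div_cancel₀ hκ.ne',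
      div_self hs.ne', Real.one_rpow, one_pow]
  calc r ^ m * Real.exp (-(κ * r ^ (1 / s)))
      = ((s / κ) ^ s) ^ m * (((κ / s) ^ s) ^ m * r ^ m) * Real.exp (-(κ * r ^ (1 / s))) := by
        rw [← mul_assoc, h6, one_mul]
    _ ≤ ((s / κ) ^ s) ^ m * (Real.exp (κ * r ^ (1 / s)) * (m.factorial : ℝ) ^ s) *
        Real.exp (-(κ * r ^ (1 / s))) := by gcongr
    _ = ((s / κ) ^ s) ^ m * (m.factorial : ℝ) ^ s *
        (Real.exp (κ * r ^ (1 / s)) * Real.exp (-(κ * r ^ (1 / s)))) := by ring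
    _ = _ := by rw [← Real.exp_add]; simp

/-- The converse direction. Taking `s`-th roots turns the bounds into bounds for the terms of an
exponential series; the extra factors `2^(-m)` allow summation over `m`, which gives `Z exp (X/2) ≤
2`. -/
theorem le_exp_neg_rpow_of_pow_mul_le {s A B r y : ℝ} (hs : 0 < s) (hA : 0 < A) (hB : 0 < B)
    (hr : 0 ≤ r) (hy : 0 ≤ y) (h : ∀ m : ℕ, r ^ m * y ≤ B * A ^ m * (m.factorial : ℝ) ^ s) :
    y ≤ 2 ^ s * B * Real.exp (-(s / 2 * (r / A) ^ (1 / s))) := by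
  set X := (r / A) ^ (1 / s) with hX
  have hX0 : 0 ≤ X := by positivity
  set Z := (y / B) ^ (1 / s) with hZ
  have hZ0 : 0 ≤ Z := by positivity
  have key : ∀ m : ℕ, Z * ((X / 2) ^ m / m.factorial) ≤ (1 / 2) ^ m := by
    intro m
    have h1 : y / B * (r / A) ^ m ≤ (m.factorial : ℝ) ^ s := by
      rw [div_pow, div_mul_div_comm, div_le_iff₀ (by positivity)]
      calc y * r ^ m = r ^ m * y := mul_comm _ _
        _ ≤ _ := h m
        _ = _ := by ring
    have h2 := Real.rpow_le_rpow (by positivity) h1 (by positivity : 0 ≤ 1 / s)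
    rw [← Real.rpow_mul (by positivity), mul_one_div_cancel hs.ne', Real.rpow_one,
      Real.mul_rpow (by positivity) (by positivity), ← Real.rpow_natCast, ← Real.rpow_mul
      (by positivity), mul_comm (m : ℝ), Real.rpow_mul (by positivity), Real.rpow_natCast] at h2
    rw [div_pow, div_div, ← mul_div_assoc, div_le_iff₀ (by positivity)]
    calc Z * X ^ m ≤ m.factorial := h2
      _ = (1 / 2) ^ m * (2 ^ m * m.factorial) := by
        rw [← mul_assoc, ← mul_pow]; norm_num
  have h1 : HasSum (fun m : ℕ => Z * ((X / 2) ^ m / m.factorial)) (Z * Real.exp (X / 2)) := by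
    rw [Real.exp_eq_exp_ℝ]
    exact (NormedSpace.expSeries_div_hasSum_exp (X / 2)).mul_left Z
  have h2 : Z * Real.exp (X / 2) ≤ 2 := hasSum_le key h1 hasSum_geometric_two
  have h3 : Z ≤ 2 * Real.exp (-(X / 2)) := by
    rw [Real.exp_neg, ← div_eq_mul_inv, le_div_iff₀ (Real.exp_pos _)]
    exact h2
  have h4 := Real.rpow_le_rpow hZ0 h3 hs.le
  rw [hZ, ← Real.rpow_mul (by positivity), one_div_mul_cancel hs.ne', Real.rpow_one,
    Real.mul_rpow (by positivity) (by positivity), ← Real.exp_mul, div_le_iff₀ hB] at h4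
  refine h4.trans (le_of_eq ?_)
  rw [show -(X / 2) * s = -(s / 2 * X) by ring]
  ring

/-- The weight `exp (-κ (‖ξ‖/η)^(1/s))`. -/
noncomputable def gevreyWeight {E : Type*} [Norm E] (s κ η : ℝ) (ξ : E) : ℝ :=
  Real.exp (-(κ * (‖ξ‖ / η) ^ (1 / s)))

section Weight

variable {E : Type*} [NormedAddCommGroup E] {s κ η : ℝ}

theorem gevreyWeight_pos (ξ : E) : 0 < gevreyWeight s κ η ξ := Real.exp_pos _

theorem gevreyWeight_half_mul (ξ : E) :
    gevreyWeight s (κ / 2) η ξ * gevreyWeight s (κ / 2) η ξ = gevreyWeight s κ η ξ := by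
  rw [gevreyWeight, gevreyWeight, ← Real.exp_add]
  congr 1
  ring

theorem pow_mul_gevreyWeight_le (hs : 0 < s) (hκ : 0 < κ) (hη : 0 < η) (m : ℕ) (ξ : E) :
    ‖ξ‖ ^ m * gevreyWeight s κ η ξ ≤ ((s / κ) ^ s * η) ^ m * (m.factorial : ℝ) ^ s := by
  have := pow_mul_exp_neg_rpow_le hs hκ (by positivity : 0 ≤ ‖ξ‖ / η) m
  rw [div_pow, div_mul_eq_mul_div, div_le_iff₀ (by positivity)] at this
  refine this.trans (le_of_eq ?_)
  rw [mul_pow]; ring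

theorem one_add_norm_pow_mul_gevreyWeight_le (hs : 0 < s) (hκ : 0 < κ) (j : ℕ) :
    ∃ C > 0, ∀ η ≥ 1, ∀ ξ : E, (1 + ‖ξ‖) ^ j * gevreyWeight s κ η ξ ≤ C * η ^ j := by
  refine ⟨2 ^ j * (1 + ((s / κ) ^ s) ^ j * (j.factorial : ℝ) ^ s), by positivity,
    fun η hη ξ => ?_⟩
  have hη0 : 0 < η := by linarith
  have h1 : (1 + ‖ξ‖) ^ j ≤ 2 ^ j * (1 + ‖ξ‖ ^ j) := by
    rcases le_total ‖ξ‖ 1 with h | h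
    · calc (1 + ‖ξ‖) ^ j ≤ 2 ^ j := by gcongr; linarith
        _ ≤ _ := le_mul_of_one_le_right (by positivity) (by linarith [pow_nonneg (norm_nonneg ξ) j])
    · calc (1 + ‖ξ‖) ^ j ≤ (2 * ‖ξ‖) ^ j := by gcongr; linarith
        _ = 2 ^ j * ‖ξ‖ ^ j := mul_pow _ _ _
        _ ≤ _ := by gcongr; linarith
  have h2 : gevreyWeight s κ η ξ ≤ η ^ j := by
    refine le_trans ?_ (one_le_pow₀ hη)
    rw [gevreyWeight, Real.exp_le_one_iff, neg_nonpos]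
    positivity
  have h3 := pow_mul_gevreyWeight_le hs hκ hη0 j ξ
  calc (1 + ‖ξ‖) ^ j * gevreyWeight s κ η ξ
      ≤ 2 ^ j * (1 + ‖ξ‖ ^ j) * gevreyWeight s κ η ξ := by
        gcongr; exact (gevreyWeight_pos ξ).le
    _ = 2 ^ j * (gevreyWeight s κ η ξ + ‖ξ‖ ^ j * gevreyWeight s κ η ξ) := by ring
    _ ≤ 2 ^ j * (η ^ j + ((s / κ) ^ s * η) ^ j * (j.factorial : ℝ) ^ s) := by gcongr
    _ = _ := by rw [mul_pow]; ring

/-- One half of the exponent pays for `‖ξ‖^m`, the other for the factor `(1 + ‖ξ‖)^(-j)` that makes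
integrals converge. The constant is independent of `η`. -/
theorem pow_mul_gevreyWeight_le_mul_inv (hs : 0 < s) (hκ : 0 < κ) (j : ℕ) :
    ∃ C > 0, ∀ η ≥ 1, ∀ m : ℕ, ∀ ξ : E, ‖ξ‖ ^ m * gevreyWeight s κ η ξ ≤
      C ^ (m + 1) * (m.factorial : ℝ) ^ s * η ^ (m + j) * ((1 + ‖ξ‖) ^ j)⁻¹ := by
  obtain ⟨C, hC, h⟩ := one_add_norm_pow_mul_gevreyWeight_le (E := E) hs (half_pos hκ) j
  refine ⟨max C ((s / (κ / 2)) ^ s), by positivity, fun η hη m ξ => ?_⟩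
  have hη0 : 0 < η := by linarith
  have h1 := pow_mul_gevreyWeight_le hs (half_pos hκ) hη0 m ξ
  have h2 := h η hη ξ
  rw [← div_eq_mul_inv, le_div_iff₀ (by positivity), ← gevreyWeight_half_mul]
  have h0 := (gevreyWeight_pos (s := s) (κ := κ / 2) (η := η) ξ).le
  calc ‖ξ‖ ^ m * (gevreyWeight s (κ / 2) η ξ * gevreyWeight s (κ / 2) η ξ) * (1 + ‖ξ‖) ^ j
      = (‖ξ‖ ^ m * gevreyWeight s (κ / 2) η ξ) *
        ((1 + ‖ξ‖) ^ j * gevreyWeight s (κ / 2) η ξ) := by ring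
    _ ≤ (((s / (κ / 2)) ^ s * η) ^ m * (m.factorial : ℝ) ^ s) * (C * η ^ j) := by gcongr
    _ ≤ ((max C ((s / (κ / 2)) ^ s) * η) ^ m * (m.factorial : ℝ) ^ s) *
        (max C ((s / (κ / 2)) ^ s) * η ^ j) := by
      gcongr
      · exact le_max_right _ _
      · exact le_max_left _ _
    _ = _ := by rw [mul_pow]; ring

end Weight

theorem integrable_inv_one_add_norm_pow (n : ℕ) :
    Integrable fun ξ : Sp n => ((1 + ‖ξ‖) ^ (n + 1))⁻¹ := by
  have := integrable_one_add_norm (μ := (volume : Measure (Sp n))) (r := ((n + 1 : ℕ) : ℝ))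
    (by simp)
  refine this.congr (Eventually.of_forall fun ξ => ?_)
  simp only
  rw [Real.rpow_neg (by positivity), Real.rpow_natCast]

variable {n : ℕ} {T s κ : ℝ}

/-- A tower whose members decay like `gevreyWeight`. -/
structure IsGevreyTower (T s κ η : ℝ) (w : ℕ → ℝ → Sp n → ℂ) (C : ℕ → ℝ) : Prop where
  meas : ∀ k, ∀ t ∈ Icc 0 T, AEStronglyMeasurable (w k t) volume
  deriv : ∀ k ξ, ∀ t ∈ Icc 0 T, HasDerivWithinAt (fun t => w k t ξ) (w (k + 1) t ξ) (Icc 0 T) t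
  bound : ∀ k, ∀ t ∈ Icc 0 T, ∀ ξ, ‖w k t ξ‖ ≤ C k * gevreyWeight s κ η ξ

open FourierTransform

/-- Integrate the weight bound with `j = n + 1`, the first integer power integrable on `ℝⁿ`.
Uniformity of `A` in `η` keeps the powers of `η`, later of `ε⁻¹`, explicit. -/
theorem exists_gevreyTower_bound (hs : 0 < s) (hκ : 0 < κ) (n : ℕ) : ∃ A > 0, ∀ η ≥ 1,
    ∀ (w : ℕ → ℝ → Sp n → ℂ) (C : ℕ → ℝ), IsGevreyTower T s κ η w C →
      IsTower T w ∧ ∀ k m, ∀ t ∈ Icc 0 T, ∀ x, ‖iteratedFDeriv ℝ m (𝓕 (w k t)) x‖ ≤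
        C k * (A ^ (m + 1) * (m.factorial : ℝ) ^ s * η ^ (m + (n + 1))) := by
  obtain ⟨A, hA, h⟩ := pow_mul_gevreyWeight_le_mul_inv (E := Sp n) hs hκ (n + 1)
  set I := ∫ ξ : Sp n, ((1 + ‖ξ‖) ^ (n + 1))⁻¹ with hI
  have hI0 : 0 ≤ I := integral_nonneg fun ξ => by positivity
  refine ⟨2 * Real.pi * A * (I + 1), by positivity, fun η hη w C hw => ?_⟩
  have hC : ∀ k, ∀ t ∈ Icc 0 T, 0 ≤ C k := fun k t ht => by
    have := (norm_nonneg _).trans (hw.bound k t ht 0)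
    exact nonneg_of_mul_nonneg_left this (gevreyWeight_pos _)
  have hb : ∀ k m, ∀ t ∈ Icc 0 T, ∀ ξ, ‖ξ‖ ^ m * ‖w k t ξ‖ ≤
      C k * (A ^ (m + 1) * (m.factorial : ℝ) ^ s * η ^ (m + (n + 1))) *
        ((1 + ‖ξ‖) ^ (n + 1))⁻¹ := by
    intro k m t ht ξ
    calc ‖ξ‖ ^ m * ‖w k t ξ‖ ≤ ‖ξ‖ ^ m * (C k * gevreyWeight s κ η ξ) := by
          gcongr; exact hw.bound k t ht ξ
      _ = C k * (‖ξ‖ ^ m * gevreyWeight s κ η ξ) := by ring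
      _ ≤ C k * (A ^ (m + 1) * (m.factorial : ℝ) ^ s * η ^ (m + (n + 1)) *
        ((1 + ‖ξ‖) ^ (n + 1))⁻¹) := mul_le_mul_of_nonneg_left (h η hη m ξ) (hC k t ht)
      _ = _ := by ring
  have hT : IsTower T w := ⟨hw.meas, hw.deriv, fun k m =>
    ⟨_, (integrable_inv_one_add_norm_pow n).const_mul _, hb k m⟩⟩
  refine ⟨hT, fun k m t ht x => (hT.norm_iteratedFDeriv_fourier_le k m x ht).trans ?_⟩
  have hCk := hC k t ht
  have hη0 : 0 ≤ η := by linarith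
  calc (2 * Real.pi) ^ m * ∫ ξ, ‖ξ‖ ^ m * ‖w k t ξ‖
      ≤ (2 * Real.pi) ^ m * (C k * (A ^ (m + 1) * (m.factorial : ℝ) ^ s * η ^ (m + (n + 1))) * I) := by
        gcongr
        rw [hI, ← integral_const_mul]
        exact integral_mono (hT.integrable_pow_mul k m ht)
          ((integrable_inv_one_add_norm_pow n).const_mul _) (hb k m t ht)
    _ ≤ (2 * Real.pi) ^ (m + 1) * (C k * (A ^ (m + 1) * (m.factorial : ℝ) ^ s *
          η ^ (m + (n + 1))) * (I + 1) ^ (m + 1)) := by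
        gcongr
        · linarith [Real.two_le_pi]
        · omega
        · calc I ≤ I + 1 := by linarith
            _ ≤ (I + 1) ^ (m + 1) := le_self_pow₀ (by linarith) (by omega)
    _ = _ := by rw [mul_pow, mul_pow]; ring

/-- Fourier transforms of nets of towers of moderate size form a moderate net. -/
theorem isTimeGevreyModerate_fourier (hT : 0 < T) (hs : 0 < s) (hκ : 0 < κ) {η : ℝ → ℝ} {B : ℝ}
    (hB : 0 < B) (hη : ∀ ε ∈ Ioc (0 : ℝ) 1, 1 ≤ η ε ∧ η ε ≤ B * ε⁻¹)
    {w : ℝ → ℕ → ℝ → Sp n → ℂ} {D : ℕ → ℝ} {M : ℕ → ℕ} (hD : ∀ k, 0 < D k)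
    (hw : ∀ ε ∈ Ioc (0 : ℝ) 1,
      IsGevreyTower T s κ (η ε) (w ε) (fun k => D k * (ε ^ M k)⁻¹)) :
    IsTimeGevreyModerate T s fun ε t => 𝓕 (w ε 0 t) := by
  obtain ⟨A, hA, h⟩ := exists_gevreyTower_bound (T := T) hs hκ n
  refine ⟨fun ε hε => ((h _ (hη ε hε).1 _ _ (hw ε hε)).1).contDiffOn_fourier hT, fun K _ => ?_⟩
  -- The spatial constants are fixed before the time order `k`; all dependence on `k` sits in `M k`
  -- and `D k`.
  refine ⟨n + 1, A * B, by positivity, fun k => ⟨M k, D k * B ^ n, by have := hD k; positivity,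
    fun ε hε m t ht x _ => ?_⟩⟩
  obtain ⟨hw1, hw2⟩ := h _ (hη ε hε).1 _ _ (hw ε hε)
  rw [hw1.iteratedDerivWithin_iteratedFDeriv hT k m x ht]
  refine (hw2 k m t ht x).trans ?_
  have hD' := hD k
  have hε0 := hε.1
  have h1 := hη ε hε
  have hη0 : 0 ≤ η ε := by linarith
  calc D k * (ε ^ M k)⁻¹ * (A ^ (m + 1) * (m.factorial : ℝ) ^ s * η ε ^ (m + (n + 1)))
      ≤ D k * (ε ^ M k)⁻¹ * (A ^ (m + 1) * (m.factorial : ℝ) ^ s * (B * ε⁻¹) ^ (m + (n + 1))) := by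
        gcongr; exact h1.2
    _ = D k * B ^ n * (ε ^ M k)⁻¹ * ((A * B) ^ (m + 1) * (m.factorial : ℝ) ^ s *
          (ε ^ (n + 1 + m))⁻¹) := by
        rw [mul_pow, mul_pow, inv_pow, add_comm (n + 1) m]; ring

end VeryWeak

/-! ### The Gevrey mollifier and the frequency decay of regularised distributions. -/

namespace VeryWeak
open LineDeriv

theorem factorial_rpow_add_le {s : ℝ} (hs : 0 ≤ s) (m l : ℕ) :
    ((m + l).factorial : ℝ) ^ s ≤
      (2 ^ s) ^ (m + l) * (m.factorial : ℝ) ^ s * (l.factorial : ℝ) ^ s := by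
  have h : ((m + l).factorial : ℝ) ≤ 2 ^ (m + l) * m.factorial * l.factorial := by
    rw [← Nat.add_choose_mul_factorial_mul_factorial]
    push_cast
    gcongr
    exact_mod_cast Nat.choose_le_two_pow _ _
  calc ((m + l).factorial : ℝ) ^ s ≤ (2 ^ (m + l) * m.factorial * l.factorial) ^ s :=
        Real.rpow_le_rpow (by positivity) h hs
    _ = _ := by
      rw [Real.mul_rpow (by positivity) (by positivity), Real.mul_rpow (by positivity)
        (by positivity), ← Real.rpow_natCast 2, ← Real.rpow_mul (by norm_num), mul_comm _ s,
        Real.rpow_mul (by norm_num), Real.rpow_natCast]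

theorem factorial_rpow_mul_le {s : ℝ} (hs : 0 ≤ s) {i m : ℕ} (hi : i ≤ m) :
    (i.factorial : ℝ) ^ s * ((m - i).factorial : ℝ) ^ s ≤ (m.factorial : ℝ) ^ s := by
  rw [← Real.mul_rpow (by positivity) (by positivity)]
  refine Real.rpow_le_rpow (by positivity) ?_ hs
  exact_mod_cast Nat.le_of_dvd (Nat.factorial_pos m) (Nat.factorial_mul_factorial_dvd_factorial hi)

variable {n : ℕ} {s : ℝ} {φ : Sp n → ℂ} {χ : Sp n → ℝ}

theorem IsGevreyMollifierPair.contDiff (h : IsGevreyMollifierPair s φ χ) (δ : ℝ) :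
    ContDiff ℝ ∞ (gevreyMollifier φ χ δ) := by
  have h1 := h.smooth
  have h2 := h.cutoff_smooth
  unfold gevreyMollifier
  refine (contDiff_const.mul (h1.comp (contDiff_const_smul _))).mul
    (Complex.ofRealCLM.contDiff.comp (h2.comp (contDiff_const_smul _)))

theorem IsGevreyMollifierPair.eq_zero (h : IsGevreyMollifierPair s φ χ) {δ : ℝ}
    (hδ : 1 ≤ |Real.log δ|) (x : Sp n) (hx : 2 < ‖x‖) : gevreyMollifier φ χ δ x = 0 := by
  rw [gevreyMollifier, h.cutoff_zero, Complex.ofReal_zero, mul_zero]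
  rw [norm_smul, Real.norm_eq_abs, abs_abs]
  nlinarith [norm_nonneg x]

/-- Leibniz' rule: rescaling `φ` costs `δ⁻¹` per derivative, rescaling the cut-off costs `|log δ| ≤
δ⁻¹`, and products of factorials are at most the factorial of the total order. -/
theorem IsGevreyMollifierPair.exists_norm_iteratedFDeriv_le (h : IsGevreyMollifierPair s φ χ)
    (hs : 0 ≤ s) : ∃ A ≥ 1, ∀ δ ∈ Ioc (0 : ℝ) 1, ∀ (m : ℕ) (x : Sp n),
      ‖iteratedFDeriv ℝ m (gevreyMollifier φ χ δ) x‖ ≤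
        A ^ (m + 2) * δ⁻¹ ^ (n + m) * (m.factorial : ℝ) ^ s := by
  obtain ⟨C, hC, hφ⟩ := h.gelfandShilov
  obtain ⟨c, hc, hχ⟩ := h.cutoff_gevrey (Metric.closedBall 0 2) (isCompact_closedBall _ _)
  have hχ' : ∀ (m : ℕ) (x : Sp n), ‖iteratedFDeriv ℝ m χ x‖ ≤ c ^ (m + 1) * (m.factorial : ℝ) ^ s := by
    intro m x
    -- Outside the ball of radius 2 the cut-off is locally zero, so the bound on one compact set
    -- holds everywhere.
    by_cases hx : ‖x‖ ≤ 2
    · exact hχ m x (by simpa using hx)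
    · have : x ∉ tsupport χ := by
        intro hx'
        have hsub : tsupport χ ⊆ Metric.closedBall (0 : Sp n) 2 := by
          refine closure_minimal (fun y hy => ?_) Metric.isClosed_closedBall
          by_contra hy'
          refine hy (h.cutoff_zero y ?_)
          simp only [Metric.mem_closedBall, dist_zero_right, not_le] at hy'
          exact hy'.le
        exact hx (by simpa using hsub hx')
      rw [image_eq_zero_of_notMem_tsupport
        (fun h' => this (tsupport_iteratedFDeriv_subset (𝕜 := ℝ) m h')), norm_zero]
      positivity
  set A₀ := max 1 (max C c) with hA₀
  have hA1 : 1 ≤ A₀ := le_max_left _ _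
  have hAC : C ≤ A₀ := (le_max_left _ _).trans (le_max_right _ _)
  have hAc : c ≤ A₀ := (le_max_right _ _).trans (le_max_right _ _)
  refine ⟨2 * A₀, by linarith, fun δ hδ m x => ?_⟩
  have hδ0 := hδ.1
  have hinv : 1 ≤ δ⁻¹ := (one_le_inv₀ hδ0).2 hδ.2
  have hlog : |Real.log δ| ≤ δ⁻¹ := by
    rw [abs_of_nonpos (Real.log_nonpos hδ0.le hδ.2), ← Real.log_inv]
    exact (Real.log_le_sub_one_of_pos (by positivity)).trans (by linarith)
  have h1 : ∀ i : ℕ, ‖iteratedFDeriv ℝ i (fun x => (((δ ^ n)⁻¹ : ℝ) : ℂ) * φ (δ⁻¹ • x)) x‖ ≤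
      δ⁻¹ ^ n * (δ⁻¹ ^ i * (A₀ ^ (i + 1) * (i.factorial : ℝ) ^ s)) := by
    intro i
    have hsm : ContDiff ℝ i fun x => φ (δ⁻¹ • x) :=
      (h.smooth.of_le (mod_cast le_top)).comp (contDiff_const_smul _)
    have := iteratedFDeriv_const_smul_apply' (a := (((δ ^ n)⁻¹ : ℝ) : ℂ)) (hsm.contDiffAt (x := x))
    simp only [smul_eq_mul] at this
    rw [this, iteratedFDeriv_comp_const_smul _ (h.smooth.of_le (mod_cast le_top)), norm_smul,
      norm_smul, Complex.norm_real, Real.norm_of_nonneg (by positivity),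
      Real.norm_of_nonneg (by positivity), ← inv_pow δ n]
    gcongr
    refine (by simpa using hφ 0 i (δ⁻¹ • x) : _ ≤ C ^ (i + 1) * (i.factorial : ℝ) ^ s).trans ?_
    gcongr
  have h2 : ∀ i : ℕ, ‖iteratedFDeriv ℝ i (fun x => ((χ (|Real.log δ| • x) : ℝ) : ℂ)) x‖ ≤
      δ⁻¹ ^ i * (A₀ ^ (i + 1) * (i.factorial : ℝ) ^ s) := by
    intro i
    have hsm : ContDiff ℝ i fun x => χ (|Real.log δ| • x) :=
      (h.cutoff_smooth.of_le (mod_cast le_top)).comp (contDiff_const_smul _)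
    have := Complex.ofRealLI.norm_iteratedFDeriv_comp_left (hsm.contDiffAt (x := x)) le_rfl
    change ‖iteratedFDeriv ℝ i (Complex.ofRealLI ∘ fun x => χ (|Real.log δ| • x)) x‖ ≤ _
    rw [this, iteratedFDeriv_comp_const_smul _ (h.cutoff_smooth.of_le (mod_cast le_top)), norm_smul,
      Real.norm_of_nonneg (by positivity)]
    gcongr
    refine (hχ' i _).trans ?_
    gcongr
  have hsm1 : ContDiff ℝ ∞ (fun x => (((δ ^ n)⁻¹ : ℝ) : ℂ) * φ (δ⁻¹ • x)) :=
    contDiff_const.mul (h.smooth.comp (contDiff_const_smul _))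
  have hsm2 : ContDiff ℝ ∞ (fun x : Sp n => ((χ (|Real.log δ| • x) : ℝ) : ℂ)) :=
    Complex.ofRealCLM.contDiff.comp (h.cutoff_smooth.comp (contDiff_const_smul _))
  refine (norm_iteratedFDeriv_mul_le hsm1 hsm2 x (n := m) (mod_cast le_top)).trans ?_
  calc ∑ i ∈ Finset.range (m + 1), (m.choose i : ℝ) *
        ‖iteratedFDeriv ℝ i (fun x => (((δ ^ n)⁻¹ : ℝ) : ℂ) * φ (δ⁻¹ • x)) x‖ *
        ‖iteratedFDeriv ℝ (m - i) (fun x => ((χ (|Real.log δ| • x) : ℝ) : ℂ)) x‖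
      ≤ ∑ i ∈ Finset.range (m + 1), (m.choose i : ℝ) *
          (A₀ ^ (m + 2) * δ⁻¹ ^ (n + m) * (m.factorial : ℝ) ^ s) := by
        refine Finset.sum_le_sum fun i hi => ?_
        have him : i ≤ m := Nat.lt_succ_iff.1 (Finset.mem_range.1 hi)
        rw [mul_assoc]
        refine mul_le_mul_of_nonneg_left ?_ (by positivity)
        calc _ ≤ δ⁻¹ ^ n * (δ⁻¹ ^ i * (A₀ ^ (i + 1) * (i.factorial : ℝ) ^ s)) *
              (δ⁻¹ ^ (m - i) * (A₀ ^ (m - i + 1) * ((m - i).factorial : ℝ) ^ s)) :=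
              mul_le_mul (h1 i) (h2 (m - i)) (norm_nonneg _) (by positivity)
          _ = δ⁻¹ ^ n * (δ⁻¹ ^ i * δ⁻¹ ^ (m - i)) * (A₀ ^ (i + 1) * A₀ ^ (m - i + 1)) *
              ((i.factorial : ℝ) ^ s * ((m - i).factorial : ℝ) ^ s) := by ring
          _ ≤ δ⁻¹ ^ n * (δ⁻¹ ^ i * δ⁻¹ ^ (m - i)) * (A₀ ^ (i + 1) * A₀ ^ (m - i + 1)) *
              (m.factorial : ℝ) ^ s := by
              gcongr; exact factorial_rpow_mul_le hs him
          _ = _ := by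
              rw [← pow_add, ← pow_add, ← pow_add]
              rw [show i + (m - i) = m by omega, show i + 1 + (m - i + 1) = m + 2 by omega]
              ring
    _ = 2 ^ m * (A₀ ^ (m + 2) * δ⁻¹ ^ (n + m) * (m.factorial : ℝ) ^ s) := by
        rw [← Finset.sum_mul]
        congr 1
        exact_mod_cast Nat.sum_range_choose m
    _ ≤ 2 ^ (m + 2) * (A₀ ^ (m + 2) * δ⁻¹ ^ (n + m) * (m.factorial : ℝ) ^ s) := by
        gcongr
        · norm_num
        · omega
    _ = _ := by rw [mul_pow]; ring

theorem norm_iteratedFDeriv_iterate_lineDerivOp_le {E : Type*} [NormedAddCommGroup E]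
    [NormedSpace ℝ E] (θ : 𝓢(E, ℂ)) {v : E} (hv : ‖v‖ ≤ 1)
    (m l : ℕ) (z : E) :
    ‖iteratedFDeriv ℝ l ((∂_{v})^[m] θ : 𝓢(E, ℂ)) z‖ ≤ ‖iteratedFDeriv ℝ (l + m) θ z‖ := by
  induction m generalizing l with
  | zero => simp
  | succ m ih =>
    rw [Function.iterate_succ_apply', iteratedFDeriv_lineDerivOp]
    refine (ContinuousLinearMap.le_opNorm _ _).trans ?_
    rw [norm_fderiv_iteratedFDeriv]
    refine (mul_le_of_le_one_right (norm_nonneg _) hv).trans ((ih (l + 1)).trans (le_of_eq ?_))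
    rw [show l + 1 + m = l + (m + 1) by omega]

theorem iterate_lineDerivOp_eq_zero_of_support {E : Type*} [NormedAddCommGroup E]
    [NormedSpace ℝ E] {θ : 𝓢(E, ℂ)} {r : ℝ} (hs : ∀ y, r < ‖y‖ → θ y = 0) (v : E) (m : ℕ)
    (y : E) (hy : r < ‖y‖) : ((∂_{v})^[m] θ : 𝓢(E, ℂ)) y = 0 := by
  induction m generalizing y with
  | zero => exact hs y hy
  | succ m ih =>
    rw [Function.iterate_succ_apply']
    exact lineDerivOp_eq_zero_of_support ih v y hy

theorem exists_norm_le_mul_norm_coord (hn : 0 < n) (ξ : Sp n) : ∃ i, ‖ξ‖ ≤ n * |ξ i| := by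
  have : Nonempty (Fin n) := ⟨⟨0, hn⟩⟩
  obtain ⟨i, hi⟩ := Finite.exists_max fun i => |ξ i|
  refine ⟨i, ?_⟩
  have h1 : ‖ξ‖ = ‖∑ j, ξ j • EuclideanSpace.single j (1 : ℝ)‖ := by
    conv_lhs => rw [← (EuclideanSpace.basisFun (Fin n) ℝ).sum_repr ξ]
    simp
  rw [h1]
  refine (norm_sum_le _ _).trans ?_
  calc ∑ j, ‖ξ j • EuclideanSpace.single j (1 : ℝ)‖ ≤ ∑ _j : Fin n, |ξ i| :=
        Finset.sum_le_sum fun j _ => by rw [norm_smul]; simpa using hi j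
    _ = _ := by simp

open FourierTransform

theorem fourierInv_iterate_lineDerivOp (G : 𝓢(Sp n, ℂ)) (i : Fin n) (m : ℕ) (ξ : Sp n) :
    (𝓕⁻ ((∂_{EuclideanSpace.single i (1 : ℝ)})^[m] G : 𝓢(Sp n, ℂ)) : 𝓢(Sp n, ℂ)) ξ =
      (-(2 * Real.pi * Complex.I) * (ξ i : ℂ)) ^ m * (𝓕⁻ G : 𝓢(Sp n, ℂ)) ξ := by
  induction m with
  | zero => simp
  | succ m ih =>
    have ht : (inner ℝ · (EuclideanSpace.single i (1 : ℝ)) : Sp n → ℝ).HasTemperateGrowth := by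
      fun_prop
    rw [Function.iterate_succ_apply', SchwartzMap.fourierInv_lineDerivOp_eq, smul_apply,
      SchwartzMap.smulLeftCLM_apply_apply ht, ih]
    simp [EuclideanSpace.inner_single_right]
    ring

/-- Uniform bounds for the regularisations of compactly supported distributions of bounded order
and support, and decay of their Fourier transforms. -/
theorem IsGevreyMollifierPair.exists_conv_bound (h : IsGevreyMollifierPair s φ χ) (hn : 0 < n)
    (hs : 0 < s) (N : ℕ) {C R : ℝ} (hC : 0 ≤ C) (hR : 0 ≤ R) :
    ∃ κ > 0, ∃ D > 0, ∃ M : ℕ, ∀ δ ∈ Ioc (0 : ℝ) 1, 1 ≤ |Real.log δ| → ∀ u : 𝓢'(Sp n, ℂ),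
      HasOrder u N C → Distribution.dsupport u ⊆ Metric.closedBall 0 R →
      ∃ G : 𝓢(Sp n, ℂ), (∀ x, G x = conv u (gevreyMollifier φ χ δ) x) ∧
        (∀ x, R + 2 < ‖x‖ → G x = 0) ∧ (∀ x, ‖G x‖ ≤ D * δ⁻¹ ^ M) ∧
        ∀ ξ, ‖(𝓕⁻ G : 𝓢(Sp n, ℂ)) ξ‖ ≤ D * δ⁻¹ ^ M * gevreyWeight s κ δ⁻¹ ξ := by
  obtain ⟨A, hA, hb⟩ := h.exists_norm_iteratedFDeriv_le hs.le
  -- The extra `2^s` per derivative pays for splitting `(l + m)!` into `l! m!`, where `l ≤ N` comes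
  -- from the order of the distribution.
  set A₂ := A * 2 ^ s with hA₂
  have hA0 : 0 < A := by linarith
  have h2s : 1 ≤ (2 : ℝ) ^ s := Real.one_le_rpow (by norm_num) hs.le
  have hA₂1 : 1 ≤ A₂ := one_le_mul_of_one_le_of_one_le hA h2s
  set V := (volume (Metric.closedBall (0 : Sp n) (R + 2))).toReal with hV
  set P := C * (1 + ((R + 2) + 2)) ^ N * (A₂ ^ (N + 2) * (N.factorial : ℝ) ^ s) with hP
  have hP0 : 0 ≤ P := by positivity
  have hnpos : (0 : ℝ) < n := by exact_mod_cast hn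
  refine ⟨s / 2 * (1 / (n * A₂)) ^ (1 / s), by positivity, 2 ^ s * (V + 1) * (P + 1), by positivity,
    n + N, fun δ hδ hlog u hu hus => ?_⟩
  have hδ0 := hδ.1
  have hinv : 1 ≤ δ⁻¹ := (one_le_inv₀ hδ0).2 hδ.2
  have hz := fun x hx => h.eq_zero hlog x hx
  have hcs : HasCompactSupport (gevreyMollifier φ χ δ) :=
    HasCompactSupport.intro (isCompact_closedBall (0 : Sp n) 2) fun x hx => hz x (by simpa using hx)
  set θ : 𝓢(Sp n, ℂ) := hcs.toSchwartzMap (h.contDiff δ) with hθ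
  have hθe : (θ : Sp n → ℂ) = gevreyMollifier φ χ δ := rfl
  obtain ⟨G, hG⟩ := exists_schwartz_eq_conv u θ (by norm_num : (0 : ℝ) ≤ 2) hz hus
  have hzero : ∀ (v : Sp n) (m : ℕ) (x : Sp n), R + 2 < ‖x‖ →
      ((∂_{v})^[m] G : 𝓢(Sp n, ℂ)) x = 0 := fun v m x hx => by
    rw [hG]
    exact conv_eq_zero_of_support u _ (iterate_lineDerivOp_eq_zero_of_support hz v m) hus x hx
  have hbound : ∀ (v : Sp n), ‖v‖ ≤ 1 → ∀ (m : ℕ) (x : Sp n),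
      ‖((∂_{v})^[m] G : 𝓢(Sp n, ℂ)) x‖ ≤
        P * δ⁻¹ ^ (n + N) * (A₂ * δ⁻¹) ^ m * (m.factorial : ℝ) ^ s := by
    intro v hv m x
    by_cases hx : R + 2 < ‖x‖
    · rw [hzero v m x hx, norm_zero]; positivity
    push Not at hx
    rw [hG, conv_eq_reflTranslate]
    have hl : ∀ l ≤ N, ∀ y, ‖iteratedFDeriv ℝ l ((∂_{v})^[m] θ : 𝓢(Sp n, ℂ)) y‖ ≤
        A₂ ^ (N + 2) * (N.factorial : ℝ) ^ s * δ⁻¹ ^ (n + N) * (A₂ * δ⁻¹) ^ m *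
          (m.factorial : ℝ) ^ s := by
      intro l hl y
      refine (norm_iteratedFDeriv_iterate_lineDerivOp_le θ hv m l y).trans ?_
      rw [hθe]
      refine (hb δ hδ (l + m) y).trans ?_
      calc A ^ (l + m + 2) * δ⁻¹ ^ (n + (l + m)) * ((l + m).factorial : ℝ) ^ s
          ≤ A ^ (l + m + 2) * δ⁻¹ ^ (n + (l + m)) *
            ((2 ^ s) ^ (l + m) * (l.factorial : ℝ) ^ s * (m.factorial : ℝ) ^ s) := by
            gcongr; exact factorial_rpow_add_le hs.le l m
        _ ≤ A ^ (N + m + 2) * δ⁻¹ ^ (n + (N + m)) *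
            ((2 ^ s) ^ (N + 2 + m) * (N.factorial : ℝ) ^ s * (m.factorial : ℝ) ^ s) := by
            gcongr
            omega
        _ = _ := by
            rw [hA₂]
            ring
    refine (hu.norm_reflTranslate_le hC _ (by norm_num : (0 : ℝ) ≤ 2)
      (iterate_lineDerivOp_eq_zero_of_support hz v m) hl x).trans ?_
    calc _ ≤ C * ((1 + ((R + 2) + 2)) ^ N * (A₂ ^ (N + 2) * (N.factorial : ℝ) ^ s *
          δ⁻¹ ^ (n + N) * (A₂ * δ⁻¹) ^ m * (m.factorial : ℝ) ^ s)) := by gcongr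
      _ = _ := by rw [hP]; ring
  have h2s' : P ≤ 2 ^ s * (V + 1) * (P + 1) := by
    have : 0 ≤ V := ENNReal.toReal_nonneg
    calc P ≤ 1 * (P + 1) := by linarith
      _ ≤ _ := by
        gcongr
        exact one_le_mul_of_one_le_of_one_le h2s (by linarith)
  refine ⟨G, fun x => by simpa [hθe] using hG 0 0 x, fun x hx => by simpa using hzero 0 0 x hx,
    fun x => ?_, fun ξ => ?_⟩
  · refine (by simpa using hbound 0 (by simp) 0 x : ‖G x‖ ≤ P * δ⁻¹ ^ (n + N)).trans ?_
    gcongr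
  -- Differentiating `m` times in the direction of the largest coordinate of `ξ` multiplies the
  -- transform by a power comparable with `‖ξ‖^m`. The factorial bounds for all `m` then yield the
  -- exponential decay.
  · obtain ⟨i, hi⟩ := exists_norm_le_mul_norm_coord hn ξ
    have hV0 : 0 ≤ V := ENNReal.toReal_nonneg
    have key : ∀ m : ℕ, ‖ξ‖ ^ m * ‖(𝓕⁻ G : 𝓢(Sp n, ℂ)) ξ‖ ≤
        ((V + 1) * ((P + 1) * δ⁻¹ ^ (n + N))) * (n * A₂ * δ⁻¹) ^ m * (m.factorial : ℝ) ^ s := by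
      intro m
      set H : 𝓢(Sp n, ℂ) := (∂_{EuclideanSpace.single i (1 : ℝ)})^[m] G with hH
      have h1 : ‖(𝓕⁻ H : 𝓢(Sp n, ℂ)) ξ‖ ≤
          (P * δ⁻¹ ^ (n + N) * (A₂ * δ⁻¹) ^ m * (m.factorial : ℝ) ^ s) * V := by
        rw [SchwartzMap.fourierInv_coe, Real.fourierInv_eq]
        have hset : ∫ v, Real.fourierChar (inner ℝ v ξ) • H v =
            ∫ v in Metric.closedBall (0 : Sp n) (R + 2), Real.fourierChar (inner ℝ v ξ) • H v := by
          refine (setIntegral_eq_integral_of_forall_compl_eq_zero fun x hx => ?_).symm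
          rw [hH, hzero _ _ x (by simpa using hx), smul_zero]
        rw [hset]
        refine norm_setIntegral_le_of_norm_le_const measure_closedBall_lt_top fun x _ => ?_
        rw [Circle.norm_smul]
        exact hbound _ (by simp) m x
      have h2 : ‖(𝓕⁻ H : 𝓢(Sp n, ℂ)) ξ‖ = (2 * Real.pi * |ξ i|) ^ m * ‖(𝓕⁻ G : 𝓢(Sp n, ℂ)) ξ‖ := by
        rw [hH, fourierInv_iterate_lineDerivOp]
        simp [abs_of_pos Real.pi_pos]
      have h3 : ‖ξ‖ ≤ n * (2 * Real.pi * |ξ i|) := by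
        refine hi.trans ?_
        gcongr
        refine le_mul_of_one_le_left (abs_nonneg _) ?_
        linarith [Real.two_le_pi]
      calc ‖ξ‖ ^ m * ‖(𝓕⁻ G : 𝓢(Sp n, ℂ)) ξ‖
          ≤ (n * (2 * Real.pi * |ξ i|)) ^ m * ‖(𝓕⁻ G : 𝓢(Sp n, ℂ)) ξ‖ := by gcongr
        _ = n ^ m * ‖(𝓕⁻ H : 𝓢(Sp n, ℂ)) ξ‖ := by rw [h2, mul_pow]; ring
        _ ≤ n ^ m * ((P * δ⁻¹ ^ (n + N) * (A₂ * δ⁻¹) ^ m * (m.factorial : ℝ) ^ s) * V) := by gcongr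
        _ = (V * (P * δ⁻¹ ^ (n + N))) * (n * A₂ * δ⁻¹) ^ m * (m.factorial : ℝ) ^ s := by
          rw [mul_assoc (n : ℝ) A₂, mul_pow (n : ℝ)]; ring
        _ ≤ _ := by gcongr <;> linarith
    have := le_exp_neg_rpow_of_pow_mul_le hs (by positivity) (by positivity) (norm_nonneg ξ)
      (norm_nonneg _) key
    refine this.trans (le_of_eq ?_)
    rw [gevreyWeight, show ‖ξ‖ / (n * A₂ * δ⁻¹) = 1 / (n * A₂) * (‖ξ‖ / δ⁻¹) by field_simp,
      Real.mul_rpow (by positivity) (by positivity)]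
    ring_nf

end VeryWeak

/-! ### Regularisation on the time line. -/

namespace VeryWeak
open LineDeriv

variable {ψ : ℝ → ℝ}

theorem IsFriedrichsMollifier.contDiff_dilate (h : IsFriedrichsMollifier ψ) (δ : ℝ) :
    ContDiff ℝ ∞ (dilate ψ δ) := by
  have h1 := h.smooth
  unfold dilate
  exact Complex.ofRealCLM.contDiff.comp (contDiff_const.mul (h1.comp (contDiff_id.div_const δ)))

theorem IsFriedrichsMollifier.exists_dilate_eq_zero (h : IsFriedrichsMollifier ψ) :
    ∃ r ≥ 0, ∀ δ ∈ Ioc (0 : ℝ) 1, ∀ t, r < ‖t‖ → dilate ψ δ t = 0 := by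
  obtain ⟨r, hr⟩ := h.compactSupport.isCompact.isBounded.subset_closedBall 0
  refine ⟨max r 0, le_max_right _ _, fun δ hδ t ht => ?_⟩
  have : ψ (t / δ) = 0 := by
    by_contra hne
    have := hr (subset_tsupport _ hne)
    rw [mem_closedBall_zero_iff, norm_div, Real.norm_of_nonneg hδ.1.le, div_le_iff₀ hδ.1] at this
    have h1 : ‖t‖ ≤ max r 0 * δ := this.trans (by gcongr; exacts [hδ.1.le, le_max_left _ _])
    have h2 : max r 0 * δ ≤ max r 0 := mul_le_of_le_one_right (le_max_right _ _) hδ.2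
    linarith
  simp [dilate, this]

theorem IsFriedrichsMollifier.exists_norm_iteratedFDeriv_dilate_le (h : IsFriedrichsMollifier ψ)
    (k : ℕ) : ∃ B ≥ 0, ∀ δ > 0, ∀ t,
      ‖iteratedFDeriv ℝ k (dilate ψ δ) t‖ ≤ B * δ⁻¹ ^ (k + 1) := by
  obtain ⟨B, hB⟩ := (h.smooth.continuous_iteratedFDeriv (m := k) (mod_cast le_top)).norm.bddAbove_range_of_hasCompactSupport
    (h.compactSupport.iteratedFDeriv k).norm
  have hB' : ∀ t, ‖iteratedFDeriv ℝ k ψ t‖ ≤ B := fun t => hB ⟨t, rfl⟩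
  refine ⟨B, (norm_nonneg _).trans (hB' 0), fun δ hδ t => ?_⟩
  have e : dilate ψ δ = Complex.ofRealLI ∘ fun t => δ⁻¹ • ψ (δ⁻¹ • t) := by
    ext t
    simp [dilate, div_eq_inv_mul]
  have hsm : ContDiff ℝ k fun t => ψ (δ⁻¹ • t) :=
    (h.smooth.of_le (mod_cast le_top)).comp (contDiff_const_smul _)
  have hsm' : ContDiff ℝ k fun t => δ⁻¹ • ψ (δ⁻¹ • t) := (contDiff_const_smul δ⁻¹).comp hsm
  rw [e, Complex.ofRealLI.norm_iteratedFDeriv_comp_left hsm'.contDiffAt le_rfl,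
    iteratedFDeriv_const_smul_apply' hsm.contDiffAt,
    iteratedFDeriv_comp_const_smul _ (h.smooth.of_le (mod_cast le_top)), norm_smul, norm_smul,
    Real.norm_of_nonneg (by positivity), Real.norm_of_nonneg (by positivity)]
  calc δ⁻¹ * (δ⁻¹ ^ k * ‖iteratedFDeriv ℝ k ψ (δ⁻¹ • t)‖) ≤ δ⁻¹ * (δ⁻¹ ^ k * B) := by
        gcongr; exact hB' _
    _ = _ := by ring

theorem iteratedDeriv_conv (u : 𝓢'(ℝ, ℂ)) (θ : 𝓢(ℝ, ℂ)) {r : ℝ} (hr : 0 ≤ r)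
    (hs : ∀ y, r < ‖y‖ → θ y = 0) (k : ℕ) :
    iteratedDeriv k (conv u θ) = conv u ((∂_{(1 : ℝ)})^[k] θ : 𝓢(ℝ, ℂ)) := by
  induction k with
  | zero => simp
  | succ k ih =>
    rw [iteratedDeriv_succ, ih]
    ext t
    rw [Function.iterate_succ_apply', ← fderiv_apply_one_eq_deriv]
    exact fderiv_conv u _ hr (iterate_lineDerivOp_eq_zero_of_support hs 1 k) t 1

theorem IsFriedrichsMollifier.hasCompactSupport_dilate (h : IsFriedrichsMollifier ψ) {δ : ℝ}
    (hδ : δ ∈ Ioc (0 : ℝ) 1) : HasCompactSupport (dilate ψ δ) := by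
  obtain ⟨r, -, hr⟩ := h.exists_dilate_eq_zero
  exact HasCompactSupport.intro (isCompact_closedBall (0 : ℝ) r)
    fun x hx => hr δ hδ x (by simpa using hx)

theorem IsFriedrichsMollifier.contDiff_conv (h : IsFriedrichsMollifier ψ) (u : 𝓢'(ℝ, ℂ)) {δ : ℝ}
    (hδ : δ ∈ Ioc (0 : ℝ) 1) : ContDiff ℝ ∞ (conv u (dilate ψ δ)) := by
  obtain ⟨r, hr0, hr⟩ := h.exists_dilate_eq_zero
  exact VeryWeak.contDiff_conv u ((h.hasCompactSupport_dilate hδ).toSchwartzMap (h.contDiff_dilate δ))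
    hr0 (hr δ hδ)

/-- Besides the `k` derivatives, the powers of `δ⁻¹` come from the order `N` of `u` and the
normalisation of the mollifier. Thus the excess `M = N + 1` does not depend on `k`. -/
theorem IsFriedrichsMollifier.exists_conv_bound (h : IsFriedrichsMollifier ψ) (u : 𝓢'(ℝ, ℂ)) :
    ∃ M : ℕ, ∀ (k : ℕ) (S : ℝ), ∃ D > 0, ∀ δ ∈ Ioc (0 : ℝ) 1, ∀ t, |t| ≤ S →
      ‖iteratedDeriv k (conv u (dilate ψ δ)) t‖ ≤ D * δ⁻¹ ^ (k + M) := by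
  obtain ⟨r, hr0, hr⟩ := h.exists_dilate_eq_zero
  obtain ⟨N, C, hC, hu⟩ := exists_hasOrder u
  choose B hB0 hB using h.exists_norm_iteratedFDeriv_dilate_le
  refine ⟨N + 1, fun k S => ⟨C * ((1 + (|S| + r)) ^ N * ∑ l ∈ Finset.range (N + 1), B (l + k)) + 1,
    ?_, fun δ hδ t ht => ?_⟩⟩
  · have := Finset.sum_nonneg fun l (_ : l ∈ Finset.range (N + 1)) => hB0 (l + k)
    positivity
  set θ : 𝓢(ℝ, ℂ) := (h.hasCompactSupport_dilate hδ).toSchwartzMap (h.contDiff_dilate δ)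
  have hθe : (θ : ℝ → ℂ) = dilate ψ δ := rfl
  have hinv : 1 ≤ δ⁻¹ := (one_le_inv₀ hδ.1).2 hδ.2
  rw [← hθe, iteratedDeriv_conv u θ hr0 (hr δ hδ), conv_eq_reflTranslate]
  have hl : ∀ l ≤ N, ∀ y, ‖iteratedFDeriv ℝ l ((∂_{(1 : ℝ)})^[k] θ : 𝓢(ℝ, ℂ)) y‖ ≤
      (∑ l ∈ Finset.range (N + 1), B (l + k)) * δ⁻¹ ^ (k + (N + 1)) := by
    intro l hl y
    refine (norm_iteratedFDeriv_iterate_lineDerivOp_le θ (by simp) k l y).trans ?_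
    refine (hB (l + k) δ hδ.1 y).trans ?_
    exact mul_le_mul (Finset.single_le_sum (f := fun l => B (l + k)) (fun l _ => hB0 _)
      (Finset.mem_range.2 (by omega))) (pow_le_pow_right₀ hinv (by omega)) (by positivity)
      (Finset.sum_nonneg fun l _ => hB0 (l + k))
  refine (hu.norm_reflTranslate_le hC _ hr0
      (iterate_lineDerivOp_eq_zero_of_support (hr δ hδ) 1 k) hl t).trans ?_
  have hs0 := Finset.sum_nonneg fun l (_ : l ∈ Finset.range (N + 1)) => hB0 (l + k)
  have hδ0 := hδ.1
  have ht' : ‖t‖ ≤ |S| := ht.trans (le_abs_self S)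
  calc _ ≤ C * ((1 + (|S| + r)) ^ N * ((∑ l ∈ Finset.range (N + 1), B (l + k)) *
        δ⁻¹ ^ (k + (N + 1)))) := by gcongr
    _ = C * ((1 + (|S| + r)) ^ N * ∑ l ∈ Finset.range (N + 1), B (l + k)) *
        δ⁻¹ ^ (k + (N + 1)) := by ring
    _ ≤ _ := by gcongr; linarith

/-- The distribution is tested on a real nonnegative function. This keeps the regularised equations
weakly hyperbolic, which the energy needs. -/
theorem IsRealNonneg.conv_dilate {u : 𝓢'(ℝ, ℂ)} (hu : IsRealNonneg u)
    (h : IsFriedrichsMollifier ψ) {δ : ℝ} (hδ : δ ∈ Ioc (0 : ℝ) 1) (t : ℝ) :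
    0 ≤ (conv u (dilate ψ δ) t).re ∧ (conv u (dilate ψ δ) t).im = 0 := by
  set θ : 𝓢(ℝ, ℂ) := (h.hasCompactSupport_dilate hδ).toSchwartzMap (h.contDiff_dilate δ)
  have hθe : (θ : ℝ → ℂ) = dilate ψ δ := rfl
  have hδ0 := hδ.1
  rw [← hθe, conv_eq_reflTranslate]
  have him : ∀ x, (reflTranslate t θ x).im = 0 := fun x => by
    rw [reflTranslate_apply, hθe, dilate, Complex.ofReal_im]
  refine ⟨hu.nonneg _ fun x => ⟨?_, him x⟩, hu.real _ him⟩
  rw [reflTranslate_apply, hθe, dilate, Complex.ofReal_re]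
  have := h.nonneg ((t - x) / δ)
  positivity

/-- Regularisations of a distribution on the line at a scale bounded below by a power of `ε` are
moderate. -/
theorem IsFriedrichsMollifier.isSmoothModerate (h : IsFriedrichsMollifier ψ) (u : 𝓢'(ℝ, ℂ))
    {μ : ℝ → ℝ} {B : ℝ} (hμ : ∀ ε ∈ Ioc (0 : ℝ) 1, μ ε ∈ Ioc (0 : ℝ) 1 ∧ (μ ε)⁻¹ ≤ B * ε⁻¹) :
    IsSmoothModerate fun ε => conv u (dilate ψ (μ ε)) := by
  refine ⟨fun ε hε => h.contDiff_conv u (hμ ε hε).1, fun K hK k => ?_⟩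
  obtain ⟨M, hM⟩ := h.exists_conv_bound u
  obtain ⟨S, hS⟩ := hK.isBounded.subset_closedBall 0
  obtain ⟨D, hD, hb⟩ := hM k S
  have hB : 0 < B := by
    have := hμ 1 ⟨one_pos, le_rfl⟩
    have h1 := inv_pos.2 this.1.1
    simp only [inv_one, mul_one] at this
    linarith [this.2]
  refine ⟨k + M, D * B ^ (k + M), by positivity, fun ε hε t ht => ?_⟩
  have hi := inv_pos.2 (hμ ε hε).1.1
  refine (hb _ (hμ ε hε).1 t (by simpa using hS ht)).trans ?_
  rw [mul_assoc, ← inv_pow, ← mul_pow]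
  gcongr
  exact (hμ ε hε).2

end VeryWeak

/-! ### Regularisation of the right-hand side. -/

namespace VeryWeak
open LineDeriv FourierTransform

/-- The common order makes the convolutions Lipschitz in `x` near `x₀`, uniformly in `τ`; together
with continuity in `τ` at fixed `x₀` this gives joint continuity. -/
theorem continuous_conv_family {E : Type*} [NormedAddCommGroup E] [NormedSpace ℝ E]
    [FiniteDimensional ℝ E] {u : ℝ → 𝓢'(E, ℂ)} {N : ℕ} {C : ℝ}
    (hC : 0 ≤ C) (hu : ∀ τ, HasOrder (u τ) N C) (hcont : ∀ φ : 𝓢(E, ℂ), Continuous fun τ => u τ φ)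
    (θ : 𝓢(E, ℂ)) {r : ℝ} (hr : 0 ≤ r) (hs : ∀ y, r < ‖y‖ → θ y = 0) :
    Continuous fun p : ℝ × E => conv (u p.1) θ p.2 := by
  rw [continuous_iff_continuousAt]
  rintro ⟨τ₀, x₀⟩
  set B := ∑ l ∈ Finset.range (N + 1), SchwartzMap.seminorm ℂ 0 (l + 1) θ
  have hB : 0 ≤ B := Finset.sum_nonneg fun l _ => apply_nonneg _ _
  set L := C * ((1 + (‖x₀‖ + 1 + r)) ^ N * B) with hL
  have hL0 : 0 ≤ L := by positivity
  have hlip : ∀ τ, ∀ x ∈ Metric.ball x₀ 1, ‖conv (u τ) θ x - conv (u τ) θ x₀‖ ≤ L * ‖x - x₀‖ := by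
    intro τ x hx
    refine (convex_ball x₀ 1).norm_image_sub_le_of_norm_fderiv_le (𝕜 := ℝ)
      (fun y _ => (contDiff_conv (u τ) θ hr hs).differentiable (by simp) y) (fun y hy => ?_)
      (Metric.mem_ball_self one_pos) hx
    refine ContinuousLinearMap.opNorm_le_bound _ hL0 fun v => ?_
    rw [fderiv_conv (u τ) θ hr hs, conv_eq_reflTranslate]
    have hy' : ‖y‖ ≤ ‖x₀‖ + 1 := by
      have := norm_sub_norm_le y x₀
      rw [mem_ball_iff_norm] at hy
      linarith
    refine ((hu τ).norm_reflTranslate_le hC _ hr (B := B * ‖v‖)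
      (lineDerivOp_eq_zero_of_support hs v) (fun l hl z => ?_) y).trans ?_
    · rw [iteratedFDeriv_lineDerivOp]
      refine (ContinuousLinearMap.le_opNorm _ _).trans ?_
      gcongr
      rw [norm_fderiv_iteratedFDeriv]
      refine (by simpa using SchwartzMap.le_seminorm ℂ 0 (l + 1) θ z :
        _ ≤ SchwartzMap.seminorm ℂ 0 (l + 1) θ).trans ?_
      exact Finset.single_le_sum (f := fun l => SchwartzMap.seminorm ℂ 0 (l + 1) θ)
        (fun l _ => apply_nonneg _ _) (Finset.mem_range.2 (by omega))
    · rw [hL, mul_assoc, mul_assoc]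
      gcongr
  rw [ContinuousAt, tendsto_iff_norm_sub_tendsto_zero]
  have hlim : Tendsto (fun p : ℝ × E => L * ‖p.2 - x₀‖ +
      ‖conv (u p.1) θ x₀ - conv (u τ₀) θ x₀‖) (𝓝 (τ₀, x₀)) (𝓝 0) := by
    have hc : Continuous fun p : ℝ × E => L * ‖p.2 - x₀‖ +
        ‖conv (u p.1) θ x₀ - conv (u τ₀) θ x₀‖ := by
      simp only [conv_eq_reflTranslate]
      have := (hcont (reflTranslate x₀ θ)).comp (continuous_fst (X := ℝ) (Y := E))
      fun_prop
    simpa using hc.tendsto (τ₀, x₀)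
  refine squeeze_zero' (Eventually.of_forall fun p => norm_nonneg _) ?_ hlim
  have hball : ∀ᶠ p : ℝ × E in 𝓝 (τ₀, x₀), p.2 ∈ Metric.ball x₀ 1 :=
    continuous_snd.continuousAt.eventually_mem (Metric.ball_mem_nhds x₀ one_pos)
  filter_upwards [hball] with p hp
  calc _ = ‖(conv (u p.1) θ p.2 - conv (u p.1) θ x₀) +
        (conv (u p.1) θ x₀ - conv (u τ₀) θ x₀)‖ := by congr 1; ring
    _ ≤ _ := (norm_add_le _ _).trans (add_le_add (hlip _ _ hp) le_rfl)

theorem integrable_gevreyWeight {n : ℕ} {s κ η : ℝ} (hs : 0 < s) (hκ : 0 < κ) (hη : 1 ≤ η) :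
    Integrable fun ξ : Sp n => gevreyWeight s κ η ξ := by
  obtain ⟨C, hC, h⟩ := pow_mul_gevreyWeight_le_mul_inv (E := Sp n) hs hκ (n + 1)
  have hcont : Continuous fun ξ : Sp n => gevreyWeight s κ η ξ := by
    unfold gevreyWeight
    have : Continuous fun ξ : Sp n => (‖ξ‖ / η) ^ (1 / s) :=
      (continuous_norm.div_const η).rpow_const fun _ => Or.inr (by positivity)
    fun_prop
  refine ((integrable_inv_one_add_norm_pow n).const_mul (C * η ^ (n + 1))).mono'
    hcont.aestronglyMeasurable (Eventually.of_forall fun ξ => ?_)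
  rw [Real.norm_of_nonneg (gevreyWeight_pos ξ).le]
  simpa using h η hη 0 ξ

variable {n : ℕ} {T s : ℝ} {φ : Sp n → ℂ} {χ : Sp n → ℝ} {ψ : ℝ → ℝ} {f : ℝ → 𝓢'(Sp n, ℂ)}

/-- The regularised curve of distributions and its inverse Fourier transform. -/
theorem IsContinuousCurve.exists_conv_bound (hf : IsContinuousCurve T f) (hT : 0 < T)
    (h : IsGevreyMollifierPair s φ χ) (hn : 0 < n) (hs : 0 < s) :
    ∃ κ > 0, ∃ D > 0, ∃ M : ℕ, ∀ δ ∈ Ioc (0 : ℝ) 1, 1 ≤ |Real.log δ| →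
      ∃ G : ℝ → 𝓢(Sp n, ℂ),
        (∀ τ ∈ Icc 0 T, ∀ x, G τ x = conv (f τ) (gevreyMollifier φ χ δ) x) ∧
        (Continuous fun p : ℝ × Sp n => (𝓕⁻ (G p.1) : 𝓢(Sp n, ℂ)) p.2) ∧
        ∀ τ ξ, ‖(𝓕⁻ (G τ) : 𝓢(Sp n, ℂ)) ξ‖ ≤ D * δ⁻¹ ^ M * gevreyWeight s κ δ⁻¹ ξ := by
  obtain ⟨⟨K, hK, hsupp⟩, hcont⟩ := hf
  obtain ⟨R, hR⟩ := hK.isBounded.subset_closedBall 0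
  -- The curve is continued by its end values, so that continuity and bounds hold on the whole line.
  set u : ℝ → 𝓢'(Sp n, ℂ) := fun τ => f (projIcc 0 T hT.le τ) with hu
  have hucont : ∀ φ : 𝓢(Sp n, ℂ), Continuous fun τ => u τ φ := fun φ =>
    (hcont φ).comp_continuous (continuous_subtype_val.comp continuous_projIcc)
      fun τ => (projIcc 0 T hT.le τ).2
  -- Pairings with a fixed test function are bounded on the compact interval; uniform boundedness
  -- upgrades this to one order and one constant for the whole curve.
  obtain ⟨N, C, hC, hord⟩ := exists_hasOrder_of_pointwise_bounded u fun φ => by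
    obtain ⟨B, hB⟩ := isCompact_Icc.exists_bound_of_continuousOn (hcont φ)
    exact ⟨B, fun τ => hB _ (projIcc 0 T hT.le τ).2⟩
  have hus : ∀ τ, Distribution.dsupport (u τ) ⊆ Metric.closedBall 0 (max R 0) := fun τ =>
    (hsupp _ (projIcc 0 T hT.le τ).2).trans
      (hR.trans (Metric.closedBall_subset_closedBall (le_max_left _ _)))
  obtain ⟨κ, hκ, D, hD, M, hb⟩ := h.exists_conv_bound hn hs N hC (le_max_right R 0)
  refine ⟨κ, hκ, D, hD, M, fun δ hδ hlog => ?_⟩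
  choose G hG1 hG2 hG3 hG4 using fun τ => hb δ hδ hlog (u τ) (hord τ) (hus τ)
  refine ⟨G, fun τ hτ x => by rw [hG1, hu]; simp only [projIcc_of_mem hT.le hτ], ?_, hG4⟩
  have hz := fun x hx => h.eq_zero hlog x hx
  have hcs : HasCompactSupport (gevreyMollifier φ χ δ) :=
    HasCompactSupport.intro (isCompact_closedBall (0 : Sp n) 2) fun x hx => hz x (by simpa using hx)
  have hGc : Continuous fun p : ℝ × Sp n => G p.1 p.2 := by
    simp only [hG1]
    exact continuous_conv_family hC hord hucont (hcs.toSchwartzMap (h.contDiff δ))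
      (by norm_num : (0 : ℝ) ≤ 2) hz
  have hset : ∀ p : ℝ × Sp n, (𝓕⁻ (G p.1) : 𝓢(Sp n, ℂ)) p.2 =
      ∫ x in Metric.closedBall (0 : Sp n) (max R 0 + 2),
        Real.fourierChar (inner ℝ x p.2) • G p.1 x := by
    intro p
    rw [SchwartzMap.fourierInv_coe, Real.fourierInv_eq]
    refine (setIntegral_eq_integral_of_forall_compl_eq_zero fun x hx => ?_).symm
    rw [hG2 p.1 x (by simpa using hx), smul_zero]
  simp only [hset, Circle.smul_def]
  refine continuous_parametric_integral_of_continuous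
    (f := fun (p : ℝ × Sp n) x => (Real.fourierChar (inner ℝ x p.2) : ℂ) • G p.1 x) ?_
    (isCompact_closedBall _ _)
  have h1 : Continuous fun q : (ℝ × Sp n) × Sp n => G q.1.1 q.2 :=
    hGc.comp (by fun_prop : Continuous fun q : (ℝ × Sp n) × Sp n => (q.1.1, q.2))
  simp only [Function.uncurry_def]
  exact Continuous.smul (by fun_prop : Continuous fun q : (ℝ × Sp n) × Sp n =>
    (Real.fourierChar (inner ℝ q.2 q.1.2) : ℂ)) h1

/-- All time derivatives fall on the mollifier `Ψ`, so continuity of `g` in `τ` is enough. -/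
theorem isGevreyTower_integral {κ η Q : ℝ} {b : ℕ → ℝ} {Ψ : ℕ → ℝ → ℂ} {g : ℝ → Sp n → ℂ}
    (hT : 0 < T) (hΨd : ∀ k t, HasDerivAt (Ψ k) (Ψ (k + 1) t) t) (hΨb : ∀ k t, ‖Ψ k t‖ ≤ b k)
    (hg : Continuous fun p : ℝ × Sp n => g p.1 p.2)
    (hgb : ∀ τ ξ, ‖g τ ξ‖ ≤ Q * gevreyWeight s κ η ξ) :
    IsGevreyTower T s κ η (fun k t ξ => ∫ τ in (0 : ℝ)..T, Ψ k (t - τ) * g τ ξ)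
      (fun k => T * b k * Q) ∧
    ∀ k, Continuous fun z : ℝ × Sp n => ∫ τ in (0 : ℝ)..T, Ψ k (z.1 - τ) * g τ z.2 := by
  have hΨc : ∀ k, Continuous (Ψ k) := fun k =>
    continuous_iff_continuousAt.2 fun t => (hΨd k t).continuousAt
  have hb : ∀ k, 0 ≤ b k := fun k => (norm_nonneg _).trans (hΨb k 0)
  have hjc : ∀ k, Continuous fun z : ℝ × Sp n => ∫ τ in (0 : ℝ)..T, Ψ k (z.1 - τ) * g τ z.2 := by
    intro k
    refine intervalIntegral.continuous_parametric_intervalIntegral_of_continuous'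
      (f := fun (z : ℝ × Sp n) τ => Ψ k (z.1 - τ) * g τ z.2) ?_ 0 T
    have h1 : Continuous fun q : (ℝ × Sp n) × ℝ => g q.2 q.1.2 :=
      hg.comp (by fun_prop : Continuous fun q : (ℝ × Sp n) × ℝ => (q.2, q.1.2))
    have h2 : Continuous fun q : (ℝ × Sp n) × ℝ => Ψ k (q.1.1 - q.2) :=
      (hΨc k).comp (by fun_prop : Continuous fun q : (ℝ × Sp n) × ℝ => q.1.1 - q.2)
    exact h2.mul h1
  refine ⟨⟨fun k t _ => ?_, fun k ξ t ht => ?_, fun k t ht ξ => ?_⟩, hjc⟩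
  · exact ((hjc k).comp (by fun_prop : Continuous fun ξ : Sp n => (t, ξ))).aestronglyMeasurable
  · simp only [intervalIntegral.integral_of_le hT.le]
    have hgξ : Continuous fun τ => g τ ξ :=
      hg.comp (by fun_prop : Continuous fun τ : ℝ => (τ, ξ))
    have hc : ∀ k t, Continuous fun τ => Ψ k (t - τ) * g τ ξ := fun k t =>
      ((hΨc k).comp (by fun_prop : Continuous fun τ : ℝ => t - τ)).mul hgξ
    refine hasDerivWithinAt_integral_of_dominated (F := fun t τ => Ψ k (t - τ) * g τ ξ)
      (F' := fun t τ => Ψ (k + 1) (t - τ) * g τ ξ)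
      (bound := fun _ => b (k + 1) * (Q * gevreyWeight s κ η ξ))
      (convex_Icc 0 T) ht (fun t _ => (hc k t).aestronglyMeasurable)
      (((hc k t).intervalIntegrable 0 T).1) (hc (k + 1) t).aestronglyMeasurable
      (fun τ t _ => ?_) (integrable_const _) (fun τ t _ => ?_)
    · rw [norm_mul]
      exact mul_le_mul (hΨb _ _) (hgb τ ξ) (norm_nonneg _) (hb _)
    · exact (((hΨd k (t - τ)).comp_sub_const t τ).mul_const _).hasDerivWithinAt
  · refine (intervalIntegral.norm_integral_le_of_norm_le_const (C := b k *
      (Q * gevreyWeight s κ η ξ)) fun τ _ => ?_).trans ?_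
    · rw [norm_mul]
      exact mul_le_mul (hΨb _ _) (hgb τ ξ) (norm_nonneg _) (hb _)
    · rw [sub_zero, abs_of_pos hT]
      exact le_of_eq (by ring)

theorem fourier_integral_eq {κ η Q b : ℝ} {Ψ : ℝ → ℂ} {g : ℝ → Sp n → ℂ}
    (hs : 0 < s) (hκ : 0 < κ) (hη : 1 ≤ η) (hΨ : Continuous Ψ)
    (hΨb : ∀ t, ‖Ψ t‖ ≤ b) (hg : Continuous fun p : ℝ × Sp n => g p.1 p.2)
    (hgb : ∀ τ ξ, ‖g τ ξ‖ ≤ Q * gevreyWeight s κ η ξ) (t : ℝ) (x : Sp n) :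
    𝓕 (fun ξ => ∫ τ in (0 : ℝ)..T, Ψ (t - τ) * g τ ξ) x =
      ∫ τ in (0 : ℝ)..T, Ψ (t - τ) * 𝓕 (g τ) x := by
  have hint : Integrable (Function.uncurry fun τ ξ =>
      Real.fourierChar (-inner ℝ ξ x) • (Ψ (t - τ) * g τ ξ))
      ((volume.restrict (uIoc 0 T)).prod volume) := by
    have h1 : Continuous (Function.uncurry fun (τ : ℝ) (ξ : Sp n) =>
        Real.fourierChar (-inner ℝ ξ x) • (Ψ (t - τ) * g τ ξ)) := by
      simp only [Circle.smul_def, Function.uncurry_def]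
      refine Continuous.smul (by fun_prop : Continuous fun q : ℝ × Sp n =>
        (Real.fourierChar (-inner ℝ q.2 x) : ℂ)) ?_
      exact (hΨ.comp (by fun_prop : Continuous fun q : ℝ × Sp n => t - q.1)).mul hg
    have : IsFiniteMeasure (volume.restrict (uIoc 0 T)) :=
      ⟨by rw [Measure.restrict_apply_univ]; exact measure_Ioc_lt_top⟩
    have h2 := (integrable_const (μ := volume.restrict (uIoc 0 T)) (b * Q)).mul_prod
      (integrable_gevreyWeight (n := n) hs hκ hη)
    refine h2.mono' h1.aestronglyMeasurable (Eventually.of_forall fun q => ?_)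
    simp only [Function.uncurry_def]
    rw [Circle.norm_smul, norm_mul, mul_assoc]
    exact mul_le_mul (hΨb _) (hgb q.1 q.2) (norm_nonneg _) ((norm_nonneg _).trans (hΨb 0))
  have hswap := intervalIntegral_integral_swap hint
  rw [Real.fourier_eq]
  simp only [Circle.smul_def, ← intervalIntegral.integral_smul] at hswap ⊢
  rw [← hswap]
  refine intervalIntegral.integral_congr fun τ _ => ?_
  simp only [Real.fourier_eq]
  rw [← smul_eq_mul, ← integral_smul]
  refine integral_congr_ae (Eventually.of_forall fun ξ => ?_)
  simp only [smul_eq_mul, Circle.smul_def]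
  ring

/-- Time mollification of the inverse transforms gives the tower; Fubini (`fourier_integral_eq`)
identifies its Fourier transform with the regularised right-hand side. -/
theorem IsContinuousCurve.exists_mollifyRhs_tower (hf : IsContinuousCurve T f) (hT : 0 < T)
    (h : IsGevreyMollifierPair s φ χ) (hψ : IsFriedrichsMollifier ψ) (hn : 0 < n) (hs : 0 < s) :
    ∃ κ > 0, ∃ M : ℕ, ∃ D : ℕ → ℝ, (∀ k, 0 < D k) ∧ ∀ δ ∈ Ioc (0 : ℝ) 1, 1 ≤ |Real.log δ| →
      ∃ w : ℕ → ℝ → Sp n → ℂ, IsGevreyTower T s κ δ⁻¹ w (fun k => D k * δ⁻¹ ^ (k + M)) ∧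
        (∀ k, Continuous fun z : ℝ × Sp n => w k z.1 z.2) ∧
        ∀ t x, mollifyRhs T f ψ φ χ δ t x = 𝓕 (w 0 t) x := by
  obtain ⟨κ, hκ, D, hD, M, hb⟩ := hf.exists_conv_bound hT h hn hs
  choose B hB0 hB using hψ.exists_norm_iteratedFDeriv_dilate_le
  refine ⟨κ, hκ, M + 1, fun k => T * (B k + 1) * D, fun k => by have := hB0 k; positivity,
    fun δ hδ hlog => ?_⟩
  obtain ⟨G, hG, hGc, hGb⟩ := hb δ hδ hlog
  have hinv : 1 ≤ δ⁻¹ := (one_le_inv₀ hδ.1).2 hδ.2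
  have hδ0 := hδ.1
  have hsm := hψ.contDiff_dilate δ
  have hΨd : ∀ k t, HasDerivAt (iteratedDeriv k (dilate ψ δ)) (iteratedDeriv (k + 1) (dilate ψ δ) t)
      t := fun k t => by
    simp only [iteratedDeriv_succ]
    exact ((hsm.differentiable_iteratedDeriv k (mod_cast ENat.natCast_lt_top k)) t).hasDerivAt
  have hΨb : ∀ k t, ‖iteratedDeriv k (dilate ψ δ) t‖ ≤ B k * δ⁻¹ ^ (k + 1) := fun k t => by
    rw [← norm_iteratedFDeriv_eq_norm_iteratedDeriv]
    exact hB k δ hδ0 t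
  obtain ⟨h1, h2⟩ := isGevreyTower_integral hT hΨd hΨb hGc hGb
  refine ⟨_, ⟨h1.meas, h1.deriv, fun k t ht ξ => (h1.bound k t ht ξ).trans ?_⟩, h2, fun t x => ?_⟩
  · refine mul_le_mul_of_nonneg_right ?_ (gevreyWeight_pos ξ).le
    have := hB0 k
    calc _ = T * B k * D * δ⁻¹ ^ (k + (M + 1)) := by ring
      _ ≤ T * (B k + 1) * D * δ⁻¹ ^ (k + (M + 1)) := by gcongr; linarith
  · have h3 := fourier_integral_eq (T := T) hs hκ hinv hsm.continuous
      (fun t => by simpa using hΨb 0 t) hGc hGb t x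
    simp only [iteratedDeriv_zero]
    rw [h3, mollifyRhs]
    refine intervalIntegral.integral_congr fun τ hτ => ?_
    rw [uIcc_of_le hT.le] at hτ
    rw [← hG τ hτ x]
    congr 1
    have hinvG : 𝓕 (𝓕⁻ (G τ) : 𝓢(Sp n, ℂ)) = G τ := FourierTransform.fourier_fourierInv_eq _
    conv_lhs => rw [← hinvG]
    rw [SchwartzMap.fourier_coe]

end VeryWeak

/-! ### Higher time derivatives of solutions of the oscillator equation. -/

namespace VeryWeak

/-- The derivative is the limit of difference quotients inside `[0,T]`. They are set to zero outside
the interval so that every member of the approximating family is measurable. -/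
theorem aestronglyMeasurable_deriv {α : Type*} [MeasurableSpace α] {μ : Measure α} {T : ℝ}
    (hT : 0 < T) {v v' : ℝ → α → ℂ} (hv : ∀ t ∈ Icc 0 T, AEStronglyMeasurable (v t) μ)
    {t : ℝ} (ht : t ∈ Icc 0 T)
    (hd : ∀ a, HasDerivWithinAt (fun t => v t a) (v' t a) (Icc 0 T) t) :
    AEStronglyMeasurable (v' t) μ := by
  have hne : (𝓝[Icc 0 T \ {t}] t).NeBot :=
    accPt_principal_iff_nhdsWithin.1 ((uniqueDiffOn_Icc hT).uniqueDiffWithinAt ht).accPt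
  classical
  refine aestronglyMeasurable_of_tendsto_ae (𝓝[Icc 0 T \ {t}] t)
    (f := fun τ a => if τ ∈ Icc 0 T then slope (fun t => v t a) t τ else 0) (fun τ => ?_)
    (Eventually.of_forall fun a => ?_)
  · by_cases hτ : τ ∈ Icc 0 T
    · simp only [hτ, if_true, slope_def_module]
      exact ((hv τ hτ).sub (hv t ht)).const_smul _
    · simp only [hτ, if_false]
      exact aestronglyMeasurable_const
  · refine (hasDerivWithinAt_iff_tendsto_slope.1 (hd a)).congr' ?_
    filter_upwards [self_mem_nhdsWithin] with τ hτ
    simp [hτ.1]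

/-- `y` and `z = y'` solve `y'' + P y + Q y' = F` on `[0,T]`. -/
structure IsOscillation (T : ℝ) (P Q F y z : ℝ → ℂ) : Prop where
  deriv_y : ∀ t ∈ Icc 0 T, HasDerivWithinAt y (z t) (Icc 0 T) t
  deriv_z : ∀ t ∈ Icc 0 T, HasDerivWithinAt z (F t - P t * y t - Q t * z t) (Icc 0 T) t

variable {T : ℝ} {P Q F y z : ℝ → ℂ}

theorem IsOscillation.derivWithin_y (h : IsOscillation T P Q F y z) (hT : 0 < T) :
    ∀ t ∈ Icc 0 T, derivWithin y (Icc 0 T) t = z t := fun t ht =>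
  (h.deriv_y t ht).derivWithin (uniqueDiffOn_Icc hT t ht)

theorem IsOscillation.derivWithin_z (h : IsOscillation T P Q F y z) (hT : 0 < T) :
    ∀ t ∈ Icc 0 T, derivWithin z (Icc 0 T) t = F t - P t * y t - Q t * z t := fun t ht =>
  (h.deriv_z t ht).derivWithin (uniqueDiffOn_Icc hT t ht)

/-- Bootstrapping: if `y` and `z` are `C^k`, the system expresses their derivatives through `C^k`
functions. -/
theorem IsOscillation.contDiffOn (h : IsOscillation T P Q F y z) (hT : 0 < T)
    (hP : ContDiffOn ℝ ∞ P (Icc 0 T)) (hQ : ContDiffOn ℝ ∞ Q (Icc 0 T))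
    (hF : ContDiffOn ℝ ∞ F (Icc 0 T)) :
    ContDiffOn ℝ ∞ y (Icc 0 T) ∧ ContDiffOn ℝ ∞ z (Icc 0 T) := by
  have hU := uniqueDiffOn_Icc hT
  have key : ∀ k : ℕ, ContDiffOn ℝ k y (Icc 0 T) ∧ ContDiffOn ℝ k z (Icc 0 T) := by
    intro k
    induction k with
    | zero =>
      simp only [Nat.cast_zero, contDiffOn_zero]
      exact ⟨fun t ht => (h.deriv_y t ht).continuousWithinAt,
        fun t ht => (h.deriv_z t ht).continuousWithinAt⟩
    | succ k ih =>
      simp only [Nat.cast_succ, contDiffOn_succ_iff_derivWithin hU]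
      refine ⟨⟨fun t ht => (h.deriv_y t ht).differentiableWithinAt, by simp,
        ih.2.congr (h.derivWithin_y hT)⟩, ⟨fun t ht => (h.deriv_z t ht).differentiableWithinAt,
        by simp, ContDiffOn.congr ?_ (h.derivWithin_z hT)⟩⟩
      have hk : ((k : ℕ∞) : WithTop ℕ∞) ≤ ∞ := mod_cast le_top
      exact ((hF.of_le hk).sub ((hP.of_le hk).mul ih.1)).sub ((hQ.of_le hk).mul ih.2)
  exact ⟨contDiffOn_infty.2 fun k => (key k).1, contDiffOn_infty.2 fun k => (key k).2⟩

theorem IsOscillation.iteratedDerivWithin_z (h : IsOscillation T P Q F y z) (hT : 0 < T) (k : ℕ)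
    {t : ℝ} (ht : t ∈ Icc 0 T) :
    iteratedDerivWithin k z (Icc 0 T) t = iteratedDerivWithin (k + 1) y (Icc 0 T) t := by
  rw [iteratedDerivWithin_succ']
  exact (iteratedDerivWithin_congr (h.derivWithin_y hT) ht).symm

theorem IsOscillation.norm_iteratedDerivWithin_succ_succ_le (h : IsOscillation T P Q F y z)
    (hT : 0 < T) (hP : ContDiffOn ℝ ∞ P (Icc 0 T)) (hQ : ContDiffOn ℝ ∞ Q (Icc 0 T))
    (hF : ContDiffOn ℝ ∞ F (Icc 0 T)) (k : ℕ) {t : ℝ} (ht : t ∈ Icc 0 T) :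
    ‖iteratedDerivWithin (k + 2) y (Icc 0 T) t‖ ≤ ‖iteratedDerivWithin k F (Icc 0 T) t‖ +
      ∑ i ∈ Finset.range (k + 1), (k.choose i : ℝ) * ‖iteratedDerivWithin i P (Icc 0 T) t‖ *
        ‖iteratedDerivWithin (k - i) y (Icc 0 T) t‖ +
      ∑ i ∈ Finset.range (k + 1), (k.choose i : ℝ) * ‖iteratedDerivWithin i Q (Icc 0 T) t‖ *
        ‖iteratedDerivWithin (k - i + 1) y (Icc 0 T) t‖ := by
  have hU := uniqueDiffOn_Icc hT
  obtain ⟨hy, hz⟩ := h.contDiffOn hT hP hQ hF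
  have hk : ((k : ℕ∞) : WithTop ℕ∞) ≤ ∞ := mod_cast le_top
  have e1 : iteratedDerivWithin (k + 2) y (Icc 0 T) t =
      iteratedDerivWithin k (fun t => F t - P t * y t - Q t * z t) (Icc 0 T) t := by
    rw [← h.iteratedDerivWithin_z hT (k + 1) ht, iteratedDerivWithin_succ']
    exact iteratedDerivWithin_congr (h.derivWithin_z hT) ht
  have hy' := (hy.of_le hk) t ht
  have hz' := (hz.of_le hk) t ht
  have hP' := (hP.of_le hk) t ht
  have hQ' := (hQ.of_le hk) t ht
  have hF' := (hF.of_le hk) t ht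
  have e2 := iteratedDerivWithin_sub ht hU (hF'.sub (hP'.mul hy')) (hQ'.mul hz')
  have e3 := iteratedDerivWithin_sub ht hU hF' (hP'.mul hy')
  have e4 := iteratedDerivWithin_mul ht hU hP' hy'
  have e5 := iteratedDerivWithin_mul ht hU hQ' hz'
  have e6 : iteratedDerivWithin k (fun t => F t - P t * y t - Q t * z t) (Icc 0 T) t =
      iteratedDerivWithin k F (Icc 0 T) t - iteratedDerivWithin k (P * y) (Icc 0 T) t -
        iteratedDerivWithin k (Q * z) (Icc 0 T) t := by
    exact e2.trans (congrArg (· - _) e3)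
  rw [e1, e6, e4, e5]
  refine (norm_sub_le _ _).trans (add_le_add ((norm_sub_le _ _).trans (add_le_add le_rfl ?_)) ?_)
  · refine (norm_sum_le _ _).trans (Finset.sum_le_sum fun i _ => ?_)
    rw [norm_mul, norm_mul, Complex.norm_natCast]
  · refine (norm_sum_le _ _).trans (Finset.sum_le_sum fun i _ => ?_)
    rw [norm_mul, norm_mul, Complex.norm_natCast, h.iteratedDerivWithin_z hT _ ht]

/-- Differentiating `y'' = F - P y - Q y'` expresses the derivative of order `k + 2` through lower
ones. Each application gains two orders, and `q^4` covers the worst power of `q` produced, hence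
`q^(2k)`. The constant depends on the bounds `p` but not on the individual equation, so it serves
all `ξ` and `ε`. -/
theorem exists_iteratedDerivWithin_bound (hT : 0 < T) (p : ℕ → ℝ) (k : ℕ) : ∃ G > 0,
    ∀ (P Q F y z : ℝ → ℂ) (q E : ℝ), 1 ≤ q → 0 ≤ E → IsOscillation T P Q F y z →
    ContDiffOn ℝ ∞ P (Icc 0 T) → ContDiffOn ℝ ∞ Q (Icc 0 T) → ContDiffOn ℝ ∞ F (Icc 0 T) →
    (∀ j, ∀ t ∈ Icc 0 T, ‖iteratedDerivWithin j P (Icc 0 T) t‖ ≤ p j * q ^ (j + 1)) →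
    (∀ j, ∀ t ∈ Icc 0 T, ‖iteratedDerivWithin j Q (Icc 0 T) t‖ ≤ p j * q ^ (j + 1)) →
    (∀ j, ∀ t ∈ Icc 0 T, ‖iteratedDerivWithin j F (Icc 0 T) t‖ ≤ p j * q ^ (j + 1) * E) →
    (∀ t ∈ Icc 0 T, ‖y t‖ ≤ E) → (∀ t ∈ Icc 0 T, ‖z t‖ ≤ E) →
    ∀ t ∈ Icc 0 T, ‖iteratedDerivWithin k y (Icc 0 T) t‖ ≤ G * q ^ (2 * k) * E := by
  induction k using Nat.strong_induction_on with
  | _ k ih =>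
  match k, ih with
  | 0, _ =>
    refine ⟨1, one_pos, fun P Q F y z q E hq hE h hP hQ hF bP bQ bF by_ bz t ht => ?_⟩
    simpa using by_ t ht
  | 1, _ =>
    refine ⟨1, one_pos, fun P Q F y z q E hq hE h hP hQ hF bP bQ bF by_ bz t ht => ?_⟩
    rw [← h.iteratedDerivWithin_z hT 0 ht, iteratedDerivWithin_zero, one_mul]
    exact (bz t ht).trans (le_mul_of_one_le_left hE (one_le_pow₀ hq))
  | k + 2, ih =>
    choose! G hG0 hG using ih
    refine ⟨|p k| + ∑ i ∈ Finset.range (k + 1), (k.choose i : ℝ) * |p i| * |G (k - i)| +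
      ∑ i ∈ Finset.range (k + 1), (k.choose i : ℝ) * |p i| * |G (k - i + 1)| + 1, by positivity,
      fun P Q F y z q E hq hE h hP hQ hF bP bQ bF by_ bz t ht => ?_⟩
    have hq0 : 0 ≤ q := by linarith
    refine (h.norm_iteratedDerivWithin_succ_succ_le hT hP hQ hF k ht).trans ?_
    have h1 : ‖iteratedDerivWithin k F (Icc 0 T) t‖ ≤ |p k| * (q ^ (2 * (k + 2)) * E) := by
      refine (bF k t ht).trans ?_
      rw [mul_assoc]
      exact mul_le_mul (le_abs_self _) (mul_le_mul_of_nonneg_right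
        (pow_le_pow_right₀ hq (by omega)) hE) (by positivity) (abs_nonneg _)
    have hy := fun i hi => hG i hi P Q F y z q E hq hE h hP hQ hF bP bQ bF by_ bz t ht
    have hpow : ∀ a b : ℕ, a ≤ b → q ^ a * E ≤ q ^ b * E := fun a b hab =>
      mul_le_mul_of_nonneg_right (pow_le_pow_right₀ hq hab) hE
    have h2 : ∀ i ∈ Finset.range (k + 1),
        (k.choose i : ℝ) * ‖iteratedDerivWithin i P (Icc 0 T) t‖ *
          ‖iteratedDerivWithin (k - i) y (Icc 0 T) t‖ ≤
        (k.choose i : ℝ) * |p i| * |G (k - i)| * (q ^ (2 * (k + 2)) * E) := by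
      intro i hi
      have hi' := Finset.mem_range.1 hi
      calc _ ≤ (k.choose i : ℝ) * (|p i| * q ^ (i + 1)) * (|G (k - i)| * q ^ (2 * (k - i)) * E) := by
            gcongr
            · exact (bP i t ht).trans (by gcongr; exact le_abs_self _)
            · exact (hy (k - i) (by omega)).trans (by gcongr; exact le_abs_self _)
        _ = (k.choose i : ℝ) * |p i| * |G (k - i)| * (q ^ (i + 1 + 2 * (k - i)) * E) := by
            rw [pow_add]; ring
        _ ≤ _ := by
            refine mul_le_mul_of_nonneg_left (hpow _ _ ?_) (by positivity)
            omega
    have h3 : ∀ i ∈ Finset.range (k + 1),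
        (k.choose i : ℝ) * ‖iteratedDerivWithin i Q (Icc 0 T) t‖ *
          ‖iteratedDerivWithin (k - i + 1) y (Icc 0 T) t‖ ≤
        (k.choose i : ℝ) * |p i| * |G (k - i + 1)| * (q ^ (2 * (k + 2)) * E) := by
      intro i hi
      have hi' := Finset.mem_range.1 hi
      calc _ ≤ (k.choose i : ℝ) * (|p i| * q ^ (i + 1)) *
            (|G (k - i + 1)| * q ^ (2 * (k - i + 1)) * E) := by
            gcongr
            · exact (bQ i t ht).trans (by gcongr; exact le_abs_self _)
            · exact (hy (k - i + 1) (by omega)).trans (by gcongr; exact le_abs_self _)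
        _ = (k.choose i : ℝ) * |p i| * |G (k - i + 1)| * (q ^ (i + 1 + 2 * (k - i + 1)) * E) := by
            rw [pow_add]; ring
        _ ≤ _ := by
            refine mul_le_mul_of_nonneg_left (hpow _ _ ?_) (by positivity)
            omega
    refine (add_le_add (add_le_add h1 (Finset.sum_le_sum h2)) (Finset.sum_le_sum h3)).trans ?_
    rw [← Finset.sum_mul, ← Finset.sum_mul, ← add_mul, ← add_mul, mul_assoc]
    refine mul_le_mul_of_nonneg_right (by linarith) (by positivity)

end VeryWeak

/-! ### Choice of the step length and the resulting loss. -/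

namespace VeryWeak

/-- Take `h = (2 Y)^(-1/m)`, which gives `Y h^m = 1/2`. Then about `T Y^(1/m)` steps are needed, and
the logarithm of the cost of one step is at most `m² (4 Y)^(1/m)`; the product of these two yields
the exponent `2/m`. -/
theorem exists_step_bound {T Y : ℝ} (hT : 0 < T) (hY : 2 ≤ Y) {m : ℕ} (hm : 0 < m) :
    ∃ h ≥ 0, ∃ N : ℕ, T ≤ N * h ∧ Y * h ^ m ≤ 1 / 2 ∧
      (4 * Y ^ m) ^ N ≤ Real.exp ((T + 1) * m ^ 2 * (4 * Y) ^ (2 / (m : ℝ))) := by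
  have hm' : (0 : ℝ) < m := by exact_mod_cast hm
  have hY0 : 0 < Y := by linarith
  set r := (4 * Y) ^ (1 / (m : ℝ)) with hr
  set r' := (2 * Y) ^ (1 / (m : ℝ)) with hr'
  have hr'0 : 0 < r' := by positivity
  have hr1 : 1 ≤ r := Real.one_le_rpow (by linarith) (by positivity)
  have hrr : r' ≤ r := Real.rpow_le_rpow (by positivity) (by linarith) (by positivity)
  have hpow : ∀ x : ℝ, 0 ≤ x → (x ^ (1 / (m : ℝ))) ^ m = x := fun x hx => by
    rw [← Real.rpow_natCast, ← Real.rpow_mul hx, one_div_mul_cancel hm'.ne', Real.rpow_one]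
  refine ⟨r'⁻¹, by positivity, ⌈T * r'⌉₊, ?_, ?_, ?_⟩
  · rw [← div_eq_mul_inv, le_div_iff₀ hr'0]
    exact Nat.le_ceil _
  · rw [inv_pow, hr', hpow _ (by positivity)]
    exact le_of_eq (by field_simp)
  · have h1 : 4 * Y ^ m ≤ Real.exp (m ^ 2 * r) := by
      calc 4 * Y ^ m ≤ 4 ^ m * Y ^ m := by
            gcongr
            exact le_self_pow₀ (by norm_num) hm.ne'
        _ = (r ^ m) ^ m := by rw [hr, hpow _ (by positivity), mul_pow]
        _ = r ^ (m ^ 2) := by rw [← pow_mul, sq]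
        _ ≤ (Real.exp r) ^ (m ^ 2) := by
            gcongr
            linarith [Real.add_one_le_exp r]
        _ = _ := by rw [← Real.exp_nat_mul]; push_cast; ring_nf
    have h2 : (⌈T * r'⌉₊ : ℝ) ≤ (T + 1) * r := by
      have := (Nat.ceil_lt_add_one (a := T * r') (by positivity)).le
      nlinarith
    have h3 : (4 * Y) ^ (2 / (m : ℝ)) = r * r := by
      rw [hr, ← Real.rpow_add (by positivity)]
      congr 1
      ring
    calc (4 * Y ^ m) ^ ⌈T * r'⌉₊ ≤ (Real.exp (m ^ 2 * r)) ^ ⌈T * r'⌉₊ := by gcongr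
      _ = Real.exp (⌈T * r'⌉₊ * (m ^ 2 * r)) := by rw [← Real.exp_nat_mul]
      _ ≤ Real.exp ((T + 1) * r * (m ^ 2 * r)) := by gcongr
      _ = _ := by rw [h3]; ring_nf

/-- Since `4/m ≤ 1/(2s)`, the quantity grows at most like `η^(M+1) v` with `v = (r/η)^(1/(2s))`.
Young's inequality splits this into `η^(2M+2)` and `κ v²`, where `v² = (r/η)^(1/s)`, for an
arbitrarily small `κ`. -/
theorem exists_exponent_bound {s κ : ℝ} (hs : 1 ≤ s) (hκ : 0 < κ) {B A : ℝ} (hB : 1 ≤ B)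
    (hA : 0 ≤ A) {m : ℕ} (hm : 8 * s ≤ m) (M : ℕ) : ∃ C > 0, ∀ η ≥ 1, ∀ r ≥ 0,
      A * (4 * (B * η ^ M * (1 + r) ^ 2)) ^ (2 / (m : ℝ)) ≤
        C * η ^ (2 * M + 2) + κ * (r / η) ^ (1 / s) := by
  set A' := A * (4 * B) with hA'
  have hA'0 : 0 ≤ A' := by positivity
  refine ⟨A' + A' ^ 2 / (4 * κ) + 1, by positivity, fun η hη r hr => ?_⟩
  have hs0 : 0 < s := by linarith
  have hm0 : (0 : ℝ) < m := by linarith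
  have hη0 : 0 < η := by linarith
  have h2m : 2 / (m : ℝ) ≤ 1 := by rw [div_le_one hm0]; linarith
  have h4m : 4 / (m : ℝ) ≤ 1 / (2 * s) := by
    rw [div_le_div_iff₀ hm0 (by positivity)]; linarith
  have hhalf : 1 / (2 * s) ≤ 1 := by rw [div_le_one (by positivity)]; linarith
  have e1 : (4 * (B * η ^ M * (1 + r) ^ 2)) ^ (2 / (m : ℝ)) =
      (4 * B * η ^ M) ^ (2 / (m : ℝ)) * (1 + r) ^ (4 / (m : ℝ)) := by
    rw [show 4 * (B * η ^ M * (1 + r) ^ 2) = (4 * B * η ^ M) * (1 + r) ^ 2 by ring,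
      Real.mul_rpow (by positivity) (by positivity), ← Real.rpow_natCast (1 + r) 2,
      ← Real.rpow_mul (by positivity)]
    congr 2
    push_cast
    ring
  have hηM : 1 ≤ η ^ M := one_le_pow₀ hη
  have e2 : (4 * B * η ^ M) ^ (2 / (m : ℝ)) ≤ 4 * B * η ^ M :=
    (Real.rpow_le_rpow_of_exponent_le (by nlinarith) h2m).trans_eq (Real.rpow_one _)
  set v := (r / η) ^ (1 / (2 * s)) with hv
  have hv0 : 0 ≤ v := by positivity
  have e3 : (1 + r) ^ (4 / (m : ℝ)) ≤ η * (1 + v) := by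
    calc (1 + r) ^ (4 / (m : ℝ)) ≤ (1 + r) ^ (1 / (2 * s)) :=
          Real.rpow_le_rpow_of_exponent_le (by linarith) h4m
      _ ≤ 1 ^ (1 / (2 * s)) + r ^ (1 / (2 * s)) :=
          Real.rpow_add_le_add_rpow zero_le_one hr (by positivity) hhalf
      _ = 1 + v * η ^ (1 / (2 * s)) := by
          rw [Real.one_rpow, hv, ← Real.mul_rpow (by positivity) (by positivity),
            div_mul_cancel₀ _ hη0.ne']
      _ ≤ 1 + v * η := by
          gcongr
          exact (Real.rpow_le_rpow_of_exponent_le hη hhalf).trans_eq (Real.rpow_one _)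
      _ ≤ η * (1 + v) := by linarith
  have hvv : v ^ 2 = (r / η) ^ (1 / s) := by
    rw [hv, ← Real.rpow_natCast, ← Real.rpow_mul (by positivity)]
    congr 1
    push_cast
    field_simp
  rw [e1, ← hvv]
  set q := η ^ (M + 1) with hq
  have hq1 : 1 ≤ q := one_le_pow₀ hη
  have hq2 : η ^ (2 * M + 2) = q ^ 2 := by rw [hq, ← pow_mul]; ring_nf
  rw [hq2]
  calc A * ((4 * B * η ^ M) ^ (2 / (m : ℝ)) * (1 + r) ^ (4 / (m : ℝ)))
      ≤ A * ((4 * B * η ^ M) * (η * (1 + v))) := by gcongr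
    _ = A' * q + A' * q * v := by rw [hA', hq]; ring
    _ ≤ A' * q ^ 2 + (A' ^ 2 / (4 * κ) * q ^ 2 + κ * v ^ 2) := by
        gcongr
        · nlinarith
        · have : A' ^ 2 / (4 * κ) * q ^ 2 + κ * v ^ 2 - A' * q * v =
              (A' * q - 2 * κ * v) ^ 2 / (4 * κ) := by field_simp; ring
          have h0 : 0 ≤ (A' * q - 2 * κ * v) ^ 2 / (4 * κ) := by positivity
          linarith
    _ ≤ _ := by nlinarith [sq_nonneg q]

/-- The energy estimate with a loss of an arbitrarily small multiple of `r^(1/s)` in the exponent,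
where `b` and its derivatives are of size `(1 + r)²`. -/
theorem exists_energy_bound {T s κ : ℝ} (hT : 0 < T) (hs : 1 ≤ s) (hκ : 0 < κ) :
    ∃ K : ℕ, ∀ (B : ℝ) (M : ℕ), 1 ≤ B → ∃ C > 0, ∀ η ≥ 1, ∀ r ≥ 0,
      ∀ (b : ℝ → ℝ) (l d F y z : ℝ → ℂ) (Λ Φ : ℝ), OscillatorData T b l d F y z Λ Φ →
        ContDiff ℝ ∞ b → (∀ t ∈ Icc 0 T, b t ≤ B * η ^ M * (1 + r) ^ 2) →
        (∀ t ∈ Icc 0 T, |iteratedDeriv K b t| ≤ B * η ^ M * (1 + r) ^ 2) →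
        ∀ t ∈ Icc 0 T, energy b y z Φ t ≤
          Real.exp (C * η ^ (2 * M + 2) + κ * (r / η) ^ (1 / s) + 8 * Λ * T) *
            energy b y z Φ 0 := by
  -- The number of derivatives of `b` to be controlled depends on the Gevrey order alone.
  set K := ⌈8 * s⌉₊ with hK
  have hK1 : 8 * s ≤ K := Nat.le_ceil _
  have hK0 : 0 < K := by
    have : (0 : ℝ) < K := by linarith
    exact_mod_cast this
  refine ⟨K, fun B M hB => ?_⟩
  obtain ⟨C, hC, h⟩ := exists_exponent_bound hs hκ (B := 3 * B) (A := (T + 1) * K ^ 2) (by linarith)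
    (by positivity) hK1 M
  refine ⟨C, hC, fun η hη r hr b l d F y z Λ Φ D hb hb0 hbK t ht => ?_⟩
  have hηM : 1 ≤ η ^ M := one_le_pow₀ hη
  have hr2 : 1 ≤ (1 + r) ^ 2 := one_le_pow₀ (by linarith)
  have hX1 : 1 ≤ B * η ^ M * (1 + r) ^ 2 :=
    one_le_mul_of_one_le_of_one_le (one_le_mul_of_one_le_of_one_le hB hηM) hr2
  -- The factor 3 makes room for `b + 2`; the same `X` bounds the `K`-th derivative.
  set X := 3 * B * η ^ M * (1 + r) ^ 2 with hX
  have hX3 : X = 3 * (B * η ^ M * (1 + r) ^ 2) := by rw [hX]; ring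
  obtain ⟨τ, hτ, N, hN1, hN2, hN3⟩ := exists_step_bound hT (by linarith : 2 ≤ X) hK0
  obtain ⟨k, hk⟩ : ∃ k, K = k + 1 := ⟨K - 1, by omega⟩
  rw [hk] at hN2 hbK
  refine (D.energy_le_steps hb (X := X) (M := X) (fun t ht => ?_) (fun t ht => ?_) hτ hN2 N t ht
    (ht.2.trans hN1)).trans ?_
  · linarith [hb0 t ht]
  · exact (hbK t ht).trans (by linarith)
  · have h0 : 0 ≤ energy b y z Φ 0 := by
      have := D.b_nonneg 0 ⟨le_rfl, hT.le⟩
      unfold energy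
      positivity
    refine mul_le_mul_of_nonneg_right ?_ h0
    rw [← hk]
    have hΛ := D.one_le
    calc _ ≤ Real.exp ((T + 1) * K ^ 2 * (4 * X) ^ (2 / (K : ℝ))) * Real.exp (8 * Λ * T) := by
          gcongr
          exact ht.2
      _ ≤ Real.exp (C * η ^ (2 * M + 2) + κ * (r / η) ^ (1 / s)) * Real.exp (8 * Λ * T) := by
          gcongr
          exact h η hη r hr
      _ = _ := by rw [← Real.exp_add]

end VeryWeak

/-! ### Symbols of the regularised operator. -/

namespace VeryWeak

section DerivBound

variable {T : ℝ} {V W : Type*} [NormedAddCommGroup V] [NormedSpace ℝ V] [NormedAddCommGroup W]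
  [NormedSpace ℝ W] {f g : ℝ → V} {p q : ℕ → ℝ}

/-- `f` is smooth and its derivatives on `[0,T]` are bounded by the sequence `p`. -/
structure DerivBound (T : ℝ) (f : ℝ → V) (p : ℕ → ℝ) : Prop where
  contDiff : ContDiff ℝ ∞ f
  bound : ∀ j, ∀ t ∈ Icc 0 T, ‖iteratedDeriv j f t‖ ≤ p j

theorem DerivBound.mono (h : DerivBound T f p) (hpq : ∀ j, p j ≤ q j) : DerivBound T f q :=
  ⟨h.contDiff, fun j t ht => (h.bound j t ht).trans (hpq j)⟩

theorem DerivBound.add (h : DerivBound T f p) (h' : DerivBound T g q) :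
    DerivBound T (fun t => f t + g t) fun j => p j + q j := by
  refine ⟨h.contDiff.add h'.contDiff, fun j t ht => ?_⟩
  have hj : ((j : ℕ∞) : WithTop ℕ∞) ≤ ∞ := mod_cast le_top
  have e : iteratedDeriv j (fun t => f t + g t) t = iteratedDeriv j f t + iteratedDeriv j g t :=
    iteratedDeriv_fun_add (h.contDiff.of_le hj).contDiffAt (h'.contDiff.of_le hj).contDiffAt
  rw [e]
  exact (norm_add_le _ _).trans (add_le_add (h.bound j t ht) (h'.bound j t ht))

theorem DerivBound.sum {ι : Type*} (S : Finset ι) {f : ι → ℝ → V} {p : ι → ℕ → ℝ}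
    (h : ∀ i, DerivBound T (f i) (p i)) :
    DerivBound T (fun t => ∑ i ∈ S, f i t) fun j => ∑ i ∈ S, p i j := by
  classical
  induction S using Finset.induction_on with
  | empty =>
    simp only [Finset.sum_empty]
    refine ⟨contDiff_const, fun j t _ => ?_⟩
    simp
  | insert i S hi ih =>
    simp only [Finset.sum_insert hi]
    exact (h i).add ih

theorem DerivBound.clm_comp (h : DerivBound T f p) (L : V →L[ℝ] W) {c : ℝ}
    (hL : ∀ v, ‖L v‖ ≤ c * ‖v‖) (hc : 0 ≤ c) :
    DerivBound T (fun t => L (f t)) fun j => c * p j := by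
  refine ⟨L.contDiff.comp h.contDiff, fun j t ht => ?_⟩
  rw [← norm_iteratedFDeriv_eq_norm_iteratedDeriv]
  refine (L.norm_iteratedFDeriv_comp_left (h.contDiff.contDiffAt) (mod_cast le_top)).trans ?_
  rw [norm_iteratedFDeriv_eq_norm_iteratedDeriv]
  exact mul_le_mul (L.opNorm_le_bound hc hL) (h.bound j t ht) (norm_nonneg _) hc

theorem DerivBound.mul_const {f : ℝ → ℂ} (h : DerivBound T f p) (c : ℂ) :
    DerivBound T (fun t => f t * c) fun j => ‖c‖ * p j :=
  h.clm_comp ((ContinuousLinearMap.mul ℝ ℂ).flip c) (fun z => by simp) (norm_nonneg _)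

theorem DerivBound.within (h : DerivBound T f p) (hT : 0 < T) (j : ℕ) {t : ℝ} (ht : t ∈ Icc 0 T) :
    ‖iteratedDerivWithin j f (Icc 0 T) t‖ ≤ p j := by
  rw [iteratedDerivWithin_eq_iteratedDeriv (uniqueDiffOn_Icc hT)
    (h.contDiff.of_le (mod_cast le_top)).contDiffAt ht]
  exact h.bound j t ht

end DerivBound

theorem contDiffOn_of_tower {T : ℝ} (hT : 0 < T) {v : ℕ → ℝ → ℂ}
    (h : ∀ k, ∀ t ∈ Icc 0 T, HasDerivWithinAt (v k) (v (k + 1) t) (Icc 0 T) t) :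
    ContDiffOn ℝ ∞ (v 0) (Icc 0 T) ∧
      ∀ k, ∀ t ∈ Icc 0 T, iteratedDerivWithin k (v 0) (Icc 0 T) t = v k t := by
  have hU := uniqueDiffOn_Icc hT
  have hd : ∀ k, ∀ t ∈ Icc 0 T, derivWithin (v k) (Icc 0 T) t = v (k + 1) t :=
    fun k t ht => (h k t ht).derivWithin (hU t ht)
  constructor
  · refine contDiffOn_infty.2 fun m => ?_
    have : ∀ k, ContDiffOn ℝ m (v k) (Icc 0 T) := by
      induction m with
      | zero => exact fun k => contDiffOn_zero.2 fun t ht => (h k t ht).continuousWithinAt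
      | succ m ih =>
        intro k
        rw [Nat.cast_succ, contDiffOn_succ_iff_derivWithin hU]
        exact ⟨fun t ht => (h k t ht).differentiableWithinAt, by simp, (ih (k + 1)).congr (hd k)⟩
    exact this 0
  · intro k
    induction k with
    | zero => simp
    | succ k ih =>
      intro t ht
      rw [iteratedDerivWithin_succ, derivWithin_congr ih (ih t ht), hd k t ht]

theorem hasDerivWithinAt_iteratedDerivWithin {T : ℝ} (hT : 0 < T) {y : ℝ → ℂ}
    (hy : ContDiffOn ℝ ∞ y (Icc 0 T)) (k : ℕ) {t : ℝ} (ht : t ∈ Icc 0 T) :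
    HasDerivWithinAt (iteratedDerivWithin k y (Icc 0 T))
      (iteratedDerivWithin (k + 1) y (Icc 0 T) t) (Icc 0 T) t := by
  rw [iteratedDerivWithin_succ]
  exact (hy.differentiableOn_iteratedDerivWithin (mod_cast ENat.natCast_lt_top k)
    (uniqueDiffOn_Icc hT) t ht).hasDerivWithinAt

variable {n : ℕ} {T s κ : ℝ}

/-- The symbol `∑ a_i (2π ξ_i)²`. -/
noncomputable def principalSymbol (a : Fin n → ℝ → ℂ) (t : ℝ) (ξ : Sp n) : ℝ :=
  ∑ i, (a i t).re * (2 * Real.pi * ξ i) ^ 2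

/-- The symbol `-2πi ∑ c_i ξ_i + e`. -/
noncomputable def lowerSymbol (c : Fin n → ℝ → ℂ) (e : ℝ → ℂ) (t : ℝ) (ξ : Sp n) : ℂ :=
  ∑ i, c i t * (-(2 * Real.pi * Complex.I) * (ξ i : ℂ)) + e t

/-- Smooth coefficients whose derivatives are bounded by powers of a parameter `η`, with Levi
conditions with constant `Λ`. -/
structure SmoothCoefficients (T : ℝ) (a c : Fin n → ℝ → ℂ) (d e : ℝ → ℂ) (B : ℕ → ℝ) (M : ℕ)
    (η Λ : ℝ) : Prop where
  a_bound : ∀ i, DerivBound T (a i) fun j => B j * η ^ (j + M)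
  c_bound : ∀ i, DerivBound T (c i) fun j => B j * η ^ (j + M)
  d_bound : DerivBound T d fun j => B j * η ^ (j + M)
  e_bound : DerivBound T e fun j => B j * η ^ (j + M)
  a_nonneg : ∀ i t, 0 ≤ (a i t).re
  levi : ∀ t ∈ Icc 0 T, ∀ ξ, ‖lowerSymbol c e t ξ‖ ^ 2 ≤ Λ ^ 2 * (principalSymbol a t ξ + 1)
  damping : ∀ t ∈ Icc 0 T, ‖d t‖ ≤ Λ
  one_le : 1 ≤ Λ

variable {a c : Fin n → ℝ → ℂ} {d e : ℝ → ℂ} {B : ℕ → ℝ} {M : ℕ} {η Λ : ℝ}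

theorem SmoothCoefficients.principalSymbol_nonneg (h : SmoothCoefficients T a c d e B M η Λ) (t : ℝ)
    (ξ : Sp n) : 0 ≤ principalSymbol a t ξ :=
  Finset.sum_nonneg fun i _ => mul_nonneg (h.a_nonneg i t) (sq_nonneg _)

theorem abs_two_pi_mul_coord_le (ξ : Sp n) (i : Fin n) :
    |2 * Real.pi * ξ i| ≤ 2 * Real.pi * (1 + ‖ξ‖) := by
  rw [abs_mul, abs_of_pos Real.two_pi_pos]
  have h1 : |ξ i| ≤ ‖ξ‖ := PiLp.norm_apply_le ξ i
  have := Real.two_pi_pos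
  gcongr
  linarith

/-- All time derivatives of the symbol are quadratic in `1 + ‖ξ‖`: differentiating in time costs `η`
but no frequency. The energy estimate relies on this for derivatives of high order. -/
theorem SmoothCoefficients.principalSymbol_bound (h : SmoothCoefficients T a c d e B M η Λ)
    (hB : ∀ j, 0 ≤ B j) (hη : 1 ≤ η) (ξ : Sp n) :
    DerivBound T (fun t => principalSymbol a t ξ) fun j =>
      n * (2 * Real.pi) ^ 2 * B j * η ^ (j + M) * (1 + ‖ξ‖) ^ 2 := by
  have h1 : ∀ i, DerivBound T (fun t => (a i t).re * (2 * Real.pi * ξ i) ^ 2) fun j =>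
      (2 * Real.pi * ξ i) ^ 2 * (B j * η ^ (j + M)) := fun i => by
    have e : (fun t => (a i t).re * (2 * Real.pi * ξ i) ^ 2) =
        fun t => (((2 * Real.pi * ξ i) ^ 2) • Complex.reCLM) (a i t) := by
      ext t
      rw [smul_apply, Complex.reCLM_apply, smul_eq_mul, mul_comm]
    rw [e]
    refine (h.a_bound i).clm_comp _ (fun z => ?_) (sq_nonneg _)
    rw [smul_apply, Complex.reCLM_apply, norm_smul, Real.norm_of_nonneg (sq_nonneg _)]
    exact mul_le_mul_of_nonneg_left (Complex.abs_re_le_norm z) (sq_nonneg _)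
  refine (DerivBound.sum Finset.univ h1).mono fun j => ?_
  have hBj := hB j
  calc _ ≤ ∑ _i : Fin n, (2 * Real.pi * (1 + ‖ξ‖)) ^ 2 * (B j * η ^ (j + M)) := by
        refine Finset.sum_le_sum fun i _ => ?_
        refine mul_le_mul_of_nonneg_right ?_ (by positivity)
        rw [← sq_abs]
        gcongr
        exact abs_two_pi_mul_coord_le ξ i
    _ = _ := by simp; ring

theorem SmoothCoefficients.lowerSymbol_bound (h : SmoothCoefficients T a c d e B M η Λ)
    (hB : ∀ j, 0 ≤ B j) (hη : 1 ≤ η) (ξ : Sp n) :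
    DerivBound T (fun t => lowerSymbol c e t ξ) fun j =>
      (n * (2 * Real.pi) + 1) * B j * η ^ (j + M) * (1 + ‖ξ‖) ^ 2 := by
  refine ((DerivBound.sum Finset.univ fun i => (h.c_bound i).mul_const
    (-(2 * Real.pi * Complex.I) * (ξ i : ℂ))).add h.e_bound).mono fun j => ?_
  have hBj := hB j
  have h0 : 1 ≤ 1 + ‖ξ‖ := by linarith [norm_nonneg ξ]
  have h1 : 1 + ‖ξ‖ ≤ (1 + ‖ξ‖) ^ 2 := le_self_pow₀ h0 two_ne_zero
  have h2 : 1 ≤ (1 + ‖ξ‖) ^ 2 := h0.trans h1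
  calc _ ≤ ∑ _i : Fin n, (2 * Real.pi * (1 + ‖ξ‖) ^ 2) * (B j * η ^ (j + M)) +
        B j * η ^ (j + M) * (1 + ‖ξ‖) ^ 2 := by
        refine add_le_add (Finset.sum_le_sum fun i _ => ?_)
          (le_mul_of_one_le_right (by positivity) h2)
        refine mul_le_mul_of_nonneg_right ?_ (by positivity)
        have := abs_two_pi_mul_coord_le ξ i
        rw [abs_mul, abs_of_pos Real.two_pi_pos] at this
        calc _ = 2 * Real.pi * |ξ i| := by simp [abs_of_pos Real.pi_pos]
          _ ≤ 2 * Real.pi * (1 + ‖ξ‖) := this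
          _ ≤ _ := by have := Real.two_pi_pos; gcongr
    _ = _ := by simp; ring

end VeryWeak

/-! ### Solution of the problem on the frequency side. -/

namespace VeryWeak

variable {n : ℕ} {T s κ : ℝ} {a c : Fin n → ℝ → ℂ} {d e : ℝ → ℂ} {B : ℕ → ℝ} {M : ℕ} {η Λ : ℝ}

/-- The squared data carry two copies of the weight `κ`. One cancels the loss `exp (κ (r/η)^(1/s))`
of the energy estimate; the square root of the other leaves the weight `κ/2`. -/
theorem exists_oscillation_bound (hT : 0 < T) (hs : 1 ≤ s) (hκ : 0 < κ) (hB : ∀ j, 1 ≤ B j)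
    (n M : ℕ) : ∃ C > 0, ∃ D ≥ 1, ∃ M₀ N : ℕ, ∀ η ≥ 1, ∀ (Λ : ℝ) (a c : Fin n → ℝ → ℂ) (d e : ℝ → ℂ),
      SmoothCoefficients T a c d e B M η Λ → ∀ (ξ : Sp n) (F y z : ℝ → ℂ),
      IsOscillation T (fun t => principalSymbol a t ξ + lowerSymbol c e t ξ) d F y z →
      (∀ t ∈ Icc 0 T, ‖F t‖ ≤ B 0 * η ^ M * gevreyWeight s κ η ξ) →
      ‖y 0‖ ≤ B 0 * η ^ M * gevreyWeight s κ η ξ → ‖z 0‖ ≤ B 0 * η ^ M * gevreyWeight s κ η ξ →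
      ∀ t ∈ Icc 0 T,
        ‖y t‖ ≤ D * η ^ N * Real.exp (C * η ^ M₀ + 8 * Λ * T) * (1 + ‖ξ‖) *
          gevreyWeight s (κ / 2) η ξ ∧
        ‖z t‖ ≤ D * η ^ N * Real.exp (C * η ^ M₀ + 8 * Λ * T) * (1 + ‖ξ‖) *
          gevreyWeight s (κ / 2) η ξ := by
  obtain ⟨K, hK⟩ := exists_energy_bound hT hs hκ
  have hBnn : ∀ j, 0 ≤ B j := fun j => zero_le_one.trans (hB j)
  -- Only orders `0` and `K` of the principal symbol enter the energy estimate.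
  set B' := 1 + n * (2 * Real.pi) ^ 2 * (B 0 + B K) with hB'
  have hB0 := hB 0
  have hBK := hB K
  have hB'1 : 1 ≤ B' := by
    have : 0 ≤ n * (2 * Real.pi) ^ 2 * (B 0 + B K) := by positivity
    linarith
  obtain ⟨C, hC, h⟩ := hK B' (K + M) hB'1
  refine ⟨C, hC, 2 * B' * B 0, by nlinarith [mul_le_mul hB'1 hB0 zero_le_one (by linarith)],
    2 * (K + M) + 2, K + M + M, fun η hη Λ a c d e hco ξ F y z hosc hF hy0 hz0 t ht => ?_⟩
  set r := ‖ξ‖ with hr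
  have hr0 : 0 ≤ r := norm_nonneg _
  set Φ := B 0 * η ^ M * gevreyWeight s κ η ξ with hΦ
  have hη0 : 0 ≤ η := by linarith
  have hbb := hco.principalSymbol_bound hBnn hη ξ
  have hle : ∀ j, (B j ≤ B 0 + B K) → j ≤ K → n * (2 * Real.pi) ^ 2 * B j * η ^ (j + M) * (1 + r) ^ 2 ≤
      B' * η ^ (K + M) * (1 + r) ^ 2 := by
    intro j hj hjK
    gcongr
    · rw [hB']
      have : n * (2 * Real.pi) ^ 2 * B j ≤ n * (2 * Real.pi) ^ 2 * (B 0 + B K) := by gcongr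
      linarith
  have hb0 : ∀ t ∈ Icc 0 T, principalSymbol a t ξ ≤ B' * η ^ (K + M) * (1 + r) ^ 2 := fun t ht =>
    (le_abs_self _).trans ((by simpa using hbb.bound 0 t ht :
      |principalSymbol a t ξ| ≤ n * (2 * Real.pi) ^ 2 * B 0 * η ^ M * (1 + r) ^ 2).trans
      ((by simpa using hle 0 (by linarith) (Nat.zero_le _))))
  have hD : OscillatorData T (fun t => principalSymbol a t ξ) (fun t => lowerSymbol c e t ξ) d F y z
      Λ Φ := ⟨hosc.deriv_y, hosc.deriv_z, fun t _ => hco.principalSymbol_nonneg t ξ,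
      fun t ht => hco.levi t ht ξ, hco.damping, hF, hco.one_le⟩
  have hen := h η hη r hr0 _ _ _ _ _ _ _ _ hD hbb.contDiff hb0
    (fun t ht => (hbb.bound K t ht).trans (hle K (by linarith) le_rfl)) t ht
  set W := gevreyWeight s (κ / 2) η ξ with hW
  have hW0 : 0 < W := gevreyWeight_pos ξ
  set X := Real.exp (C * η ^ (2 * (K + M) + 2) + 8 * Λ * T) with hX
  have hX1 : 1 ≤ X := by
    rw [hX]
    refine Real.one_le_exp ?_
    have := hco.one_le
    positivity
  have hexp : Real.exp (C * η ^ (2 * (K + M) + 2) + κ * (r / η) ^ (1 / s) + 8 * Λ * T) *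
      gevreyWeight s κ η ξ = X := by
    rw [gevreyWeight, ← Real.exp_add, hX]
    congr 1
    ring
  have hWW : gevreyWeight s κ η ξ = W * W := (gevreyWeight_half_mul ξ).symm
  have hr1 : 1 ≤ (1 + r) ^ 2 := one_le_pow₀ (by linarith)
  have hη1 : ∀ k : ℕ, 1 ≤ η ^ k := fun k => one_le_pow₀ hη
  have hA1 : 1 ≤ B' * η ^ (K + M) * (1 + r) ^ 2 :=
    one_le_mul_of_one_le_of_one_le (one_le_mul_of_one_le_of_one_le hB'1 (hη1 _)) hr1
  set E := 2 * B' * B 0 * η ^ (K + M + M) * X * (1 + r) * W with hE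
  have hE0 : 0 ≤ E := by positivity
  have h0 : energy (fun t => principalSymbol a t ξ) y z Φ 0 ≤
      4 * (B' * η ^ (K + M) * (1 + r) ^ 2) * Φ ^ 2 := by
    have h1 := hb0 0 ⟨le_rfl, hT.le⟩
    have h2 := hco.principalSymbol_nonneg 0 ξ
    unfold energy
    calc _ ≤ Φ ^ 2 + (principalSymbol a 0 ξ + 1) * Φ ^ 2 + Φ ^ 2 := by gcongr
      _ = (principalSymbol a 0 ξ + 3) * Φ ^ 2 := by ring
      _ ≤ _ := by gcongr; linarith
  have hfin : energy (fun t => principalSymbol a t ξ) y z Φ t ≤ E ^ 2 := by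
    refine hen.trans ?_
    calc _ ≤ Real.exp (C * η ^ (2 * (K + M) + 2) + κ * (r / η) ^ (1 / s) + 8 * Λ * T) *
          (4 * (B' * η ^ (K + M) * (1 + r) ^ 2) * Φ ^ 2) := by gcongr
      _ = (Real.exp (C * η ^ (2 * (K + M) + 2) + κ * (r / η) ^ (1 / s) + 8 * Λ * T) *
          gevreyWeight s κ η ξ) *
          (4 * (B' * η ^ (K + M) * (1 + r) ^ 2) * (B 0 * η ^ M) ^ 2 * gevreyWeight s κ η ξ) := by
          rw [hΦ]; ring
      _ = (X * B' * η ^ (K + M)) * (4 * B 0 ^ 2 * η ^ (M + M) * (1 + r) ^ 2 * W ^ 2) := by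
          rw [hexp, hWW]; ring
      _ ≤ (X ^ 2 * B' ^ 2 * (η ^ (K + M)) ^ 2) *
          (4 * B 0 ^ 2 * η ^ (M + M) * (1 + r) ^ 2 * W ^ 2) := by
          gcongr
          · exact le_self_pow₀ hX1 two_ne_zero
          · exact le_self_pow₀ hB'1 two_ne_zero
          · exact le_self_pow₀ (hη1 _) two_ne_zero
      _ = E ^ 2 := by rw [hE]; ring
  have hpt := hco.principalSymbol_nonneg t ξ
  have hen_def : energy (fun t => principalSymbol a t ξ) y z Φ t =
      ‖z t‖ ^ 2 + principalSymbol a t ξ * ‖y t‖ ^ 2 + ‖y t‖ ^ 2 + Φ ^ 2 := by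
    unfold energy
    ring
  have h1 := mul_nonneg hpt (sq_nonneg ‖y t‖)
  have h2 := sq_nonneg ‖y t‖
  have h3 := sq_nonneg ‖z t‖
  have h4 := sq_nonneg Φ
  have hyE : ‖y t‖ ^ 2 ≤ E ^ 2 := by linarith
  have hzE : ‖z t‖ ^ 2 ≤ E ^ 2 := by linarith
  exact ⟨(pow_le_pow_iff_left₀ (norm_nonneg _) hE0 two_ne_zero).1 hyE,
    (pow_le_pow_iff_left₀ (norm_nonneg _) hE0 two_ne_zero).1 hzE⟩

/-- Solution of the Cauchy problem on the Fourier side, with bounds for all time derivatives. -/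
theorem exists_solution_tower (hT : 0 < T) (hs : 1 ≤ s) (hκ : 0 < κ) (hB : ∀ j, 1 ≤ B j)
    (n M : ℕ) : ∃ C > 0, ∃ M₀ : ℕ, ∃ G : ℕ → ℝ, (∀ k, 0 < G k) ∧ ∃ N : ℕ → ℕ,
      ∀ η ≥ 1, ∀ (Λ : ℝ) (a c : Fin n → ℝ → ℂ) (d e : ℝ → ℂ),
      SmoothCoefficients T a c d e B M η Λ → ∀ (v : ℕ → ℝ → Sp n → ℂ) (y₀ y₁ : Sp n → ℂ),
      IsGevreyTower T s κ η v (fun k => B k * η ^ (k + M)) →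
      Continuous (fun z : ℝ × Sp n => v 0 z.1 z.2) → Continuous y₀ → Continuous y₁ →
      (∀ ξ, ‖y₀ ξ‖ ≤ B 0 * η ^ M * gevreyWeight s κ η ξ) →
      (∀ ξ, ‖y₁ ξ‖ ≤ B 0 * η ^ M * gevreyWeight s κ η ξ) →
      ∃ w : ℕ → ℝ → Sp n → ℂ,
        IsGevreyTower T s (κ / 4) η w
          (fun k => G k * η ^ N k * Real.exp (C * η ^ M₀ + 8 * Λ * T)) ∧
        (∀ ξ, w 0 0 ξ = y₀ ξ ∧ w 1 0 ξ = y₁ ξ) ∧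
        ∀ t ∈ Icc 0 T, ∀ ξ, w 2 t ξ =
          v 0 t ξ - (principalSymbol a t ξ + lowerSymbol c e t ξ) * w 0 t ξ - d t * w 1 t ξ := by
  have hs0 : 0 < s := by linarith
  have hBnn : ∀ j, 0 ≤ B j := fun j => zero_le_one.trans (hB j)
  obtain ⟨C, hC, D, hD, M₀, N₀, hbd⟩ := exists_oscillation_bound hT hs hκ hB n M
  -- One sequence dominates the full symbol, the damping coefficient and the right-hand side.
  set p : ℕ → ℝ := fun j => (n * (2 * Real.pi) ^ 2 + (n * (2 * Real.pi) + 1)) * B j with hp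
  choose G hG0 hG using exists_iteratedDerivWithin_bound hT p
  choose H hH0 hH using fun j =>
    one_add_norm_pow_mul_gevreyWeight_le (E := Sp n) hs0 (half_pos (half_pos hκ)) j
  refine ⟨C, hC, M₀, fun k => G k * D * H (4 * k + 1), fun k => by
    have := hG0 k; have := hH0 (4 * k + 1); positivity,
    -- The summands come from `q^(2k)`, from the bound for `y` and `z`, and from trading `(1 +
    -- ‖ξ‖)^(4k+1)` for half of the weight `κ/2`; the other half is the final `κ/4`.
    fun k => (M + 1) * (2 * k) + N₀ + (4 * k + 1),
    fun η hη Λ a c d e hco v y₀ y₁ hv hvc hy₀ hy₁ by₀ by₁ => ?_⟩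
  have hη0 : 0 ≤ η := by linarith
  have hac : ∀ i, Continuous (a i) := fun i => (hco.a_bound i).contDiff.continuous
  have hcc : ∀ i, Continuous (c i) := fun i => (hco.c_bound i).contDiff.continuous
  have hdc : Continuous d := hco.d_bound.contDiff.continuous
  have hec : Continuous e := hco.e_bound.contDiff.continuous
  have hPc : Continuous fun q : ℝ × Sp n =>
      (principalSymbol a q.1 q.2 : ℂ) + lowerSymbol c e q.1 q.2 := by
    unfold principalSymbol lowerSymbol
    have h1 : ∀ i, Continuous fun q : ℝ × Sp n => a i q.1 := fun i => (hac i).comp continuous_fst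
    have h2 : ∀ i, Continuous fun q : ℝ × Sp n => c i q.1 := fun i => (hcc i).comp continuous_fst
    have h3 : Continuous fun q : ℝ × Sp n => e q.1 := hec.comp continuous_fst
    refine Continuous.add ?_ (Continuous.add ?_ h3)
    · refine Complex.continuous_ofReal.comp (continuous_finsetSum _ fun i _ => ?_)
      exact (Complex.continuous_re.comp (h1 i)).mul (by fun_prop)
    · exact continuous_finsetSum _ fun i _ => (h2 i).mul (by fun_prop)
  obtain ⟨y, z, hym, -, hsol⟩ := exists_solution_second_order hT.le
    (P := fun t ξ => (principalSymbol a t ξ : ℂ) + lowerSymbol c e t ξ) hPc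
    (Q := fun t _ => d t) (hdc.comp continuous_fst) hvc hy₀ hy₁
  have hosc : ∀ ξ, IsOscillation T (fun t => principalSymbol a t ξ + lowerSymbol c e t ξ) d
      (fun t => v 0 t ξ) (fun t => y t ξ) (fun t => z t ξ) := fun ξ =>
    ⟨fun t ht => ((hsol ξ).2.2 t ht).1, fun t ht => ((hsol ξ).2.2 t ht).2⟩
  have hPb : ∀ ξ, DerivBound T (fun t => (principalSymbol a t ξ : ℂ) + lowerSymbol c e t ξ)
      fun j => p j * η ^ (j + M) * (1 + ‖ξ‖) ^ 2 := fun ξ => by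
    refine (((hco.principalSymbol_bound hBnn hη ξ).clm_comp Complex.ofRealCLM (c := 1)
      (fun x => by simp) zero_le_one).add (hco.lowerSymbol_bound hBnn hη ξ)).mono fun j => ?_
    rw [hp]
    exact le_of_eq (by ring)
  have hP : ∀ ξ, ContDiffOn ℝ ∞ (fun t => (principalSymbol a t ξ : ℂ) + lowerSymbol c e t ξ)
    (Icc 0 T) := fun ξ => (hPb ξ).contDiff.contDiffOn
  have hQ : ContDiffOn ℝ ∞ d (Icc 0 T) := hco.d_bound.contDiff.contDiffOn
  have hF := fun ξ => contDiffOn_of_tower hT fun k => hv.deriv k ξ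
  have hyz := fun ξ => (hosc ξ).contDiffOn hT (hP ξ) hQ (hF ξ).1
  set w : ℕ → ℝ → Sp n → ℂ := fun k t ξ => iteratedDerivWithin k (fun τ => y τ ξ) (Icc 0 T) t
    with hw
  have hwd : ∀ k ξ, ∀ t ∈ Icc 0 T,
      HasDerivWithinAt (fun t => w k t ξ) (w (k + 1) t ξ) (Icc 0 T) t := fun k ξ t ht =>
    hasDerivWithinAt_iteratedDerivWithin hT (hyz ξ).1 k ht
  have h0mem : (0 : ℝ) ∈ Icc 0 T := ⟨le_rfl, hT.le⟩
  have hw1 : ∀ t ∈ Icc 0 T, ∀ ξ, w 1 t ξ = z t ξ := fun t ht ξ => by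
    rw [hw]
    simp only [iteratedDerivWithin_one]
    exact (hosc ξ).derivWithin_y hT t ht
  refine ⟨w, ⟨fun k => ?_, hwd, fun k t ht ξ => ?_⟩, fun ξ => ⟨by simpa [hw] using (hsol ξ).1, ?_⟩,
    fun t ht ξ => ?_⟩
  · induction k with
    | zero => exact fun t ht => by simpa [hw] using (hym t ht).aestronglyMeasurable
    | succ k ih => exact fun t ht => aestronglyMeasurable_deriv hT ih ht fun ξ => hwd k ξ t ht
  · set X := Real.exp (C * η ^ M₀ + 8 * Λ * T) with hX
    set E := D * η ^ N₀ * X * (1 + ‖ξ‖) * gevreyWeight s (κ / 2) η ξ with hE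
    -- Chosen so that `q^(j+1)` dominates `η^(j+M) (1 + ‖ξ‖)²` for every `j`.
    set q := η ^ (M + 1) * (1 + ‖ξ‖) ^ 2 with hq
    have hX1 : 1 ≤ X := by
      rw [hX]
      refine Real.one_le_exp ?_
      have := hco.one_le
      positivity
    have hη1 : ∀ k : ℕ, 1 ≤ η ^ k := fun k => one_le_pow₀ hη
    have hr1 : 1 ≤ 1 + ‖ξ‖ := by linarith [norm_nonneg ξ]
    have hr2 : 1 ≤ (1 + ‖ξ‖) ^ 2 := one_le_pow₀ hr1
    have hq1 : 1 ≤ q := one_le_mul_of_one_le_of_one_le (hη1 _) hr2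
    have hW := gevreyWeight_pos (s := s) (κ := κ / 2) (η := η) ξ
    have hW4 := gevreyWeight_pos (s := s) (κ := κ / 2 / 2) (η := η) ξ
    have hWκ := gevreyWeight_pos (s := s) (κ := κ) (η := η) ξ
    have hE0 : 0 ≤ E := by positivity
    have hWE : gevreyWeight s κ η ξ ≤ E := by
      have h1 : gevreyWeight s (κ / 2) η ξ ≤ 1 := by
        rw [gevreyWeight, Real.exp_le_one_iff, neg_nonpos]
        positivity
      calc gevreyWeight s κ η ξ ≤ gevreyWeight s (κ / 2) η ξ := by
            rw [← gevreyWeight_half_mul]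
            exact mul_le_of_le_one_left hW.le h1
        _ ≤ E := by
            rw [hE]
            refine le_mul_of_one_le_left hW.le ?_
            exact one_le_mul_of_one_le_of_one_le (one_le_mul_of_one_le_of_one_le
              (one_le_mul_of_one_le_of_one_le hD (hη1 _)) hX1) hr1
    have hηq : ∀ j : ℕ, η ^ (j + M) * (1 + ‖ξ‖) ^ 2 ≤ q ^ (j + 1) := by
      intro j
      rw [hq, mul_pow, ← pow_mul]
      refine mul_le_mul (pow_le_pow_right₀ hη (by nlinarith)) (le_self_pow₀ hr2 (by omega))
        (by positivity) (by positivity)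
    have hηq' : ∀ j : ℕ, η ^ (j + M) ≤ q ^ (j + 1) := fun j =>
      (le_mul_of_one_le_right (by positivity) hr2).trans (hηq j)
    have hBp : ∀ j, B j ≤ p j := fun j => by
      have := hBnn j
      have h1 : (1 : ℝ) ≤ n * (2 * Real.pi) ^ 2 + (n * (2 * Real.pi) + 1) := by
        have : (0 : ℝ) ≤ n * (2 * Real.pi) ^ 2 + n * (2 * Real.pi) := by positivity
        linarith
      exact le_mul_of_one_le_left (hBnn j) h1
    have hp0 : ∀ j, 0 ≤ p j := fun j => (hBnn j).trans (hBp j)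
    have hEb := hbd η hη Λ a c d e hco ξ _ _ _ (hosc ξ)
      (fun t ht => by simpa using hv.bound 0 t ht ξ)
      (by simpa only [(hsol ξ).1] using by₀ ξ) (by simpa only [(hsol ξ).2.1] using by₁ ξ)
    have key := hG k _ _ _ _ _ q E hq1 hE0 (hosc ξ) (hP ξ) hQ (hF ξ).1
      (fun j t ht => ((hPb ξ).within hT j ht).trans (by
        rw [mul_assoc]; exact mul_le_mul_of_nonneg_left (hηq j) (hp0 j)))
      (fun j t ht => (hco.d_bound.within hT j ht).trans
        (mul_le_mul (hBp j) (hηq' j) (by positivity) (hp0 j)))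
      (fun j t ht => by
        rw [(hF ξ).2 j t ht]
        exact (hv.bound j t ht ξ).trans (mul_le_mul
          (mul_le_mul (hBp j) (hηq' j) (by positivity) (hp0 j)) hWE hWκ.le
          (mul_nonneg (hp0 j) (by positivity))))
      (fun t ht => (hEb t ht).1) (fun t ht => (hEb t ht).2) t ht
    refine key.trans ?_
    have hGk := hG0 k
    have hHk := hH0 (4 * k + 1)
    have hHη := hH (4 * k + 1) η hη ξ
    have h4 : κ / 4 = κ / 2 / 2 := by ring
    rw [h4]
    calc G k * q ^ (2 * k) * E = G k * D * (η ^ ((M + 1) * (2 * k) + N₀)) * X *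
          ((1 + ‖ξ‖) ^ (4 * k + 1) * gevreyWeight s (κ / 2 / 2) η ξ) *
          gevreyWeight s (κ / 2 / 2) η ξ := by
          rw [hE, hq, ← gevreyWeight_half_mul, mul_pow, ← pow_mul, ← pow_mul, pow_add η,
            show 4 * k + 1 = 2 * (2 * k) + 1 by ring, pow_succ (1 + ‖ξ‖)]
          ring
      _ ≤ G k * D * (η ^ ((M + 1) * (2 * k) + N₀)) * X *
          (H (4 * k + 1) * η ^ (4 * k + 1)) * gevreyWeight s (κ / 2 / 2) η ξ := by
          gcongr
      _ = _ := by ring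
  · rw [hw1 0 h0mem, (hsol ξ).2.1]
  · have h2 : w 2 t ξ = derivWithin (fun τ => w 1 τ ξ) (Icc 0 T) t :=
      ((hwd 1 ξ t ht).derivWithin (uniqueDiffOn_Icc hT t ht)).symm
    rw [h2, derivWithin_congr (fun τ hτ => hw1 τ hτ ξ) (hw1 t ht ξ), hw1 t ht,
      (hosc ξ).derivWithin_z hT t ht]
    simp [hw]

end VeryWeak

/-! ### Return to the equation and to moderate nets in physical space. -/

namespace VeryWeak

open scoped FourierTransform

section FourierLinear

variable {n : ℕ} {x : Sp n}

/-- `f` is integrable and its Fourier transform at `x` is `y`. -/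
def HasFourierAt (f : Sp n → ℂ) (x : Sp n) (y : ℂ) : Prop := Integrable f ∧ 𝓕 f x = y

theorem HasFourierAt.add {f g : Sp n → ℂ} {y z : ℂ} (hf : HasFourierAt f x y)
    (hg : HasFourierAt g x z) : HasFourierAt (fun ξ => f ξ + g ξ) x (y + z) := by
  refine ⟨hf.1.add hg.1, ?_⟩
  rw [← hf.2, ← hg.2, Real.fourier_eq, Real.fourier_eq, Real.fourier_eq,
    ← integral_add ((Real.fourierIntegral_convergent_iff x).2 hf.1)
      ((Real.fourierIntegral_convergent_iff x).2 hg.1)]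
  simp only [smul_add]

theorem HasFourierAt.const_mul {f : Sp n → ℂ} {y : ℂ} (hf : HasFourierAt f x y) (c : ℂ) :
    HasFourierAt (fun ξ => c * f ξ) x (c * y) := by
  refine ⟨hf.1.const_mul c, ?_⟩
  rw [← hf.2, Real.fourier_eq, Real.fourier_eq, ← integral_const_mul]
  simp only [mul_smul_comm]

theorem HasFourierAt.sum {ι : Type*} (S : Finset ι) {f : ι → Sp n → ℂ} {y : ι → ℂ}
    (hf : ∀ i, HasFourierAt (f i) x (y i)) :
    HasFourierAt (fun ξ => ∑ i ∈ S, f i ξ) x (∑ i ∈ S, y i) := by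
  classical
  induction S using Finset.induction_on with
  | empty => exact ⟨by simp, by simp [Real.fourier_eq]⟩
  | insert i S hi ih => simpa only [Finset.sum_insert hi] using (hf i).add ih

end FourierLinear

section Equation

variable {n : ℕ} {T : ℝ} {w : ℕ → ℝ → Sp n → ℂ}

theorem IsTower.pd_fourier (hw : IsTower T w) (k : ℕ) {t : ℝ} (ht : t ∈ Icc 0 T) (i : Fin n) :
    pd i (𝓕 (w k t)) =
      𝓕 fun ξ => -(2 * Real.pi * Complex.I) * (ξ i : ℂ) * w k t ξ :=
  funext fun x => VeryWeak.pd_fourier (hw.integrable k ht)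
    (by simpa using hw.integrable_pow_mul k 1 ht) i x

/-- The Fourier transform of a solution of the transformed equation solves the equation. -/
theorem IsTower.equation_fourier (hw : IsTower T w) (hT : 0 < T) {a c : Fin n → ℝ → ℂ}
    {d e : ℝ → ℂ} {v : Sp n → ℂ} {t : ℝ} (ht : t ∈ Icc 0 T) (ha : ∀ i, (a i t).im = 0)
    (h : ∀ ξ, w 2 t ξ = v ξ - (principalSymbol a t ξ + lowerSymbol c e t ξ) * w 0 t ξ
      - d t * w 1 t ξ) (x : Sp n) :
    iteratedDerivWithin 2 (fun τ => 𝓕 (w 0 τ) x) (Icc 0 T) t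
      - ∑ i, a i t * pd i (pd i (𝓕 (w 0 t))) x
      + ∑ i, c i t * pd i (𝓕 (w 0 t)) x
      + d t * derivWithin (fun τ => 𝓕 (w 0 τ) x) (Icc 0 T) t
      + e t * 𝓕 (w 0 t) x = 𝓕 v x := by
  have h1 : derivWithin (fun τ => 𝓕 (w 0 τ) x) (Icc 0 T) t =
      𝓕 (w 1 t) x :=
    (hw.hasDerivWithinAt_fourier 0 x ht).derivWithin (uniqueDiffOn_Icc hT t ht)
  have hk : ∀ k, HasFourierAt (w k t) x (𝓕 (w k t) x) :=
    fun k => ⟨hw.integrable k ht, rfl⟩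
  have hi : ∀ i, HasFourierAt (fun ξ => -(2 * Real.pi * Complex.I) * (ξ i : ℂ) * w 0 t ξ) x
      (pd i (𝓕 (w 0 t)) x) := fun i =>
    ⟨(hw.mul_coord (-(2 * Real.pi * Complex.I)) i).integrable 0 ht, by rw [hw.pd_fourier 0 ht]⟩
  have hii : ∀ i, HasFourierAt (fun ξ => -(2 * Real.pi * Complex.I) * (ξ i : ℂ) *
      (-(2 * Real.pi * Complex.I) * (ξ i : ℂ) * w 0 t ξ)) x
      (pd i (pd i (𝓕 (w 0 t))) x) := fun i => by
    have hm := hw.mul_coord (-(2 * Real.pi * Complex.I)) i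
    refine ⟨(hm.mul_coord (-(2 * Real.pi * Complex.I)) i).integrable 0 ht, ?_⟩
    rw [hw.pd_fourier 0 ht, hm.pd_fourier 0 ht]
  have key := ((((hk 2).add ((HasFourierAt.sum Finset.univ fun i =>
    (hii i).const_mul (a i t)).const_mul (-1))).add (HasFourierAt.sum Finset.univ fun i =>
    (hi i).const_mul (c i t))).add ((hk 1).const_mul (d t))).add ((hk 0).const_mul (e t))
  rw [hw.iteratedDerivWithin_fourier hT 2 x ht, h1, sub_eq_add_neg, ← neg_one_mul, ← key.2]
  refine congrArg (fun g : Sp n → ℂ => 𝓕 g x) (funext fun ξ => ?_)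
  -- The square of `-2πi ξᵢ` is `-(2π ξᵢ)²`, which accounts for the sign; reality of `aᵢ` identifies
  -- it with the real part used in the symbol.
  have e1 : ((principalSymbol a t ξ : ℝ) : ℂ) * w 0 t ξ = -1 * ∑ i, a i t *
      (-(2 * Real.pi * Complex.I) * (ξ i : ℂ) *
        (-(2 * Real.pi * Complex.I) * (ξ i : ℂ) * w 0 t ξ)) := by
    rw [principalSymbol, Complex.ofReal_sum, Finset.sum_mul, Finset.mul_sum]
    refine Finset.sum_congr rfl fun i _ => ?_
    have : a i t = ((a i t).re : ℂ) := Complex.ext rfl (by simp [ha i])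
    rw [Complex.ofReal_mul, ← this]
    push_cast
    linear_combination a i t * (2 * Real.pi) ^ 2 * (ξ i : ℂ) ^ 2 * w 0 t ξ * Complex.I_sq
  have e2 : lowerSymbol c e t ξ * w 0 t ξ =
      (∑ i, c i t * (-(2 * Real.pi * Complex.I) * (ξ i : ℂ) * w 0 t ξ)) + e t * w 0 t ξ := by
    rw [lowerSymbol, add_mul, Finset.sum_mul]
    congr 1
    exact Finset.sum_congr rfl fun i _ => by ring
  rw [h ξ, add_mul, e1, e2]
  ring

end Equation

theorem gevreyWeight_mono {E : Type*} [NormedAddCommGroup E] {s κ κ' η η' : ℝ} (hs : 0 < s)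
    (hκ' : 0 ≤ κ') (hκ : κ' ≤ κ) (hη : 0 < η) (hη' : η ≤ η') (ξ : E) :
    gevreyWeight s κ η ξ ≤ gevreyWeight s κ' η' ξ := by
  have hη'0 : 0 < η' := hη.trans_le hη'
  have hκ0 : 0 ≤ κ := hκ'.trans hκ
  unfold gevreyWeight
  refine Real.exp_le_exp.2 (neg_le_neg (mul_le_mul hκ ?_ (by positivity) hκ0))
  gcongr

theorem IsGevreyTower.mono {n : ℕ} {T s κ κ' η η' : ℝ} {w : ℕ → ℝ → Sp n → ℂ} {C C' : ℕ → ℝ}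
    (hw : IsGevreyTower T s κ η w C) (hs : 0 < s)
    (hκ' : 0 ≤ κ') (hκ : κ' ≤ κ) (hη : 0 < η) (hη' : η ≤ η') (hC : ∀ k, 0 ≤ C k)
    (hCC : ∀ k, C k ≤ C' k) : IsGevreyTower T s κ' η' w C' where
  meas := hw.meas
  deriv := hw.deriv
  bound k t ht ξ := (hw.bound k t ht ξ).trans (mul_le_mul (hCC k)
    (gevreyWeight_mono hs hκ' hκ hη hη' ξ) (gevreyWeight_pos ξ).le ((hC k).trans (hCC k)))

/-- A time-independent function as a tower, so that initial data are covered by the same Fourier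
estimate as solutions. -/
theorem isGevreyTower_const {n : ℕ} {T s κ η D : ℝ} (G : 𝓢(Sp n, ℂ)) (hD : 0 ≤ D)
    (hG : ∀ ξ, ‖G ξ‖ ≤ D * gevreyWeight s κ η ξ) :
    IsGevreyTower T s κ η (fun k _ ξ => if k = 0 then G ξ else 0) fun _ => D where
  meas k t _ := by
    rcases eq_or_ne k 0 with rfl | hk
    · simpa using G.continuous.aestronglyMeasurable
    · simpa [hk] using aestronglyMeasurable_const
  deriv k ξ t _ := by simpa using hasDerivWithinAt_const t (Icc 0 T) (if k = 0 then G ξ else 0)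
  bound k t _ ξ := by
    rcases eq_or_ne k 0 with rfl | hk
    · simpa using hG ξ
    · simpa [hk] using mul_nonneg hD (gevreyWeight_pos ξ).le

theorem fourier_fourierInv_apply {n : ℕ} (G : 𝓢(Sp n, ℂ)) (x : Sp n) :
    𝓕 (fun ξ => (𝓕⁻ G : 𝓢(Sp n, ℂ)) ξ) x = G x := by
  have := congrArg (fun F : 𝓢(Sp n, ℂ) => F x) (FourierTransform.fourier_fourierInv_eq (F := 𝓢(Sp n, ℂ)) G)
  rw [← this]
  exact (congrFun (SchwartzMap.fourier_coe _) x).symm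

/-- A net of Schwartz functions whose inverse Fourier transforms have
Gevrey decay is moderate. -/
theorem isGevreyModerate_of_fourierInv {n : ℕ} {s κ : ℝ} (hs : 0 < s) (hκ : 0 < κ) {η : ℝ → ℝ}
    {B D : ℝ} {M : ℕ} (hB : 0 < B) (hD : 0 < D)
    (hη : ∀ ε ∈ Ioc (0 : ℝ) 1, 1 ≤ η ε ∧ η ε ≤ B * ε⁻¹) {g : ℝ → Sp n → ℂ}
    {G : ℝ → 𝓢(Sp n, ℂ)} (hG : ∀ ε ∈ Ioc (0 : ℝ) 1, ∀ x, G ε x = g ε x)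
    (hb : ∀ ε ∈ Ioc (0 : ℝ) 1, ∀ ξ, ‖(𝓕⁻ (G ε) : 𝓢(Sp n, ℂ)) ξ‖ ≤
      D * (ε ^ M)⁻¹ * gevreyWeight s κ (η ε) ξ) : IsGevreyModerate s g := by
  obtain ⟨A, hA, hAb⟩ := exists_gevreyTower_bound (T := 1) hs hκ n
  have hgG : ∀ ε ∈ Ioc (0 : ℝ) 1, g ε = G ε := fun ε hε => funext fun x => (hG ε hε x).symm
  refine ⟨fun ε hε => hgG ε hε ▸ (G ε).smooth ⊤, fun K _ => ?_⟩
  -- Moderateness has only the constant `c^(m+1)` for all `m`; factors independent of `m` are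
  -- absorbed by using bases at least 1, and `m + n + 1 ≤ (n + 2)(m + 1)`.
  refine ⟨(1 + D) * (1 + A) * (1 + B) ^ (n + 2), by positivity, M + (n + 1), fun ε hε m x _ => ?_⟩
  have hε0 := hε.1
  have hD' : 0 ≤ D * (ε ^ M)⁻¹ := by positivity
  have hb' := (hAb (η ε) (hη ε hε).1 _ _ (isGevreyTower_const _ hD' (hb ε hε))).2 0 m 0
    ⟨le_rfl, zero_le_one⟩ x
  have e : 𝓕 (fun ξ => if 0 = 0 then
      (𝓕⁻ (G ε) : 𝓢(Sp n, ℂ)) ξ else 0) = g ε := by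
    rw [hgG ε hε]
    exact funext fun x => by simpa using fourier_fourierInv_apply (G ε) x
  rw [e] at hb'
  refine hb'.trans ?_
  have h1 : η ε ^ (m + (n + 1)) ≤ (B * ε⁻¹) ^ (m + (n + 1)) :=
    pow_le_pow_left₀ (by linarith [(hη ε hε).1]) (hη ε hε).2 _
  have h2 : D ≤ (1 + D) ^ (m + 1) := (by linarith : D ≤ 1 + D).trans
    (le_self_pow₀ (by linarith) (by omega))
  have h3 : B ^ (m + (n + 1)) ≤ ((1 + B) ^ (n + 2)) ^ (m + 1) := by
    rw [← pow_mul]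
    exact (pow_le_pow_left₀ hB.le (by linarith) _).trans
      (pow_le_pow_right₀ (by linarith) (by nlinarith))
  have h4 : A ^ (m + 1) ≤ (1 + A) ^ (m + 1) := by gcongr; linarith
  have hf : (0 : ℝ) ≤ (m.factorial : ℝ) ^ s := by positivity
  have hη0 : 0 ≤ η ε := by linarith [(hη ε hε).1]
  calc D * (ε ^ M)⁻¹ * (A ^ (m + 1) * (m.factorial : ℝ) ^ s * η ε ^ (m + (n + 1)))
      ≤ (1 + D) ^ (m + 1) * (ε ^ M)⁻¹ * ((1 + A) ^ (m + 1) * (m.factorial : ℝ) ^ s *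
        (B * ε⁻¹) ^ (m + (n + 1))) := by gcongr
    _ = (1 + D) ^ (m + 1) * (ε ^ M)⁻¹ * ((1 + A) ^ (m + 1) * (m.factorial : ℝ) ^ s *
        (B ^ (m + (n + 1)) * (ε ^ (m + (n + 1)))⁻¹)) := by rw [mul_pow, inv_pow]
    _ ≤ (1 + D) ^ (m + 1) * (ε ^ M)⁻¹ * ((1 + A) ^ (m + 1) * (m.factorial : ℝ) ^ s *
        (((1 + B) ^ (n + 2)) ^ (m + 1) * (ε ^ (m + (n + 1)))⁻¹)) := by gcongr
    _ = _ := by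
      rw [mul_pow, mul_pow, show M + (n + 1) + m = M + (m + (n + 1)) by ring, pow_add ε M,
        mul_inv]
      ring

end VeryWeak

/-! ### Logarithmic scales and the Levi conditions on the symbols. -/

namespace VeryWeak

section Family

variable {T : ℝ} {ψ : ℝ → ℝ}

/-- Summing over the finite family gives one exponent and one sequence of constants for all
coefficients. Any `η` above the inverse scale is allowed, so different scales can share the same
`η`. -/
theorem IsFriedrichsMollifier.exists_derivBound {ι : Type*} [Fintype ι]
    (h : IsFriedrichsMollifier ψ) (T : ℝ) (u : ι → 𝓢'(ℝ, ℂ)) :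
    ∃ M : ℕ, ∃ B : ℕ → ℝ, (∀ j, 1 ≤ B j) ∧ ∀ i, ∀ δ ∈ Ioc (0 : ℝ) 1, ∀ η, δ⁻¹ ≤ η →
      DerivBound T (conv (u i) (dilate ψ δ)) fun j => B j * η ^ (j + M) := by
  choose M hM using fun i => h.exists_conv_bound (u i)
  choose D hD0 hD using fun i j => hM i j T
  have hB : ∀ j, 0 ≤ ∑ i, D i j := fun j => Finset.sum_nonneg fun i _ => (hD0 i j).le
  refine ⟨∑ i, M i, fun j => 1 + ∑ i, D i j, fun j => by linarith [hB j], fun i δ hδ η hη => ?_⟩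
  refine ⟨h.contDiff_conv (u i) hδ, fun j t ht => ?_⟩
  have h1 : 1 ≤ δ⁻¹ := (one_le_inv₀ hδ.1).2 hδ.2
  have hDj : D i j ≤ ∑ i, D i j :=
    Finset.single_le_sum (f := fun i => D i j) (fun i _ => (hD0 i j).le) (Finset.mem_univ i)
  have hMj : M i ≤ ∑ i, M i :=
    Finset.single_le_sum (f := M) (fun i _ => Nat.zero_le _) (Finset.mem_univ i)
  refine (hD i j δ hδ t (abs_le.2 ⟨by linarith [ht.1, ht.2], ht.2⟩)).trans ?_
  refine mul_le_mul (by linarith) ?_ (by positivity) (by linarith [hB j])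
  exact (pow_le_pow_left₀ (by positivity) hη _).trans
    (pow_le_pow_right₀ (h1.trans hη) (by omega))

end Family

theorem IsCompactlySupported.exists_conv_bound {n : ℕ} {s : ℝ} {φ : Sp n → ℂ} {χ : Sp n → ℝ}
    {g : 𝓢'(Sp n, ℂ)} (hg : IsCompactlySupported g) (h : IsGevreyMollifierPair s φ χ)
    (hn : 0 < n) (hs : 0 < s) :
    ∃ κ > 0, ∃ D > 0, ∃ M : ℕ, ∀ δ ∈ Ioc (0 : ℝ) 1, 1 ≤ |Real.log δ| →
      ∃ G : 𝓢(Sp n, ℂ), (∀ x, G x = conv g (gevreyMollifier φ χ δ) x) ∧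
        ∀ ξ, ‖(FourierTransformInv.fourierInv G : 𝓢(Sp n, ℂ)) ξ‖ ≤
          D * δ⁻¹ ^ M * gevreyWeight s κ δ⁻¹ ξ := by
  obtain ⟨N, C, hC, hN⟩ := exists_hasOrder g
  obtain ⟨R, hR⟩ := hg.isBounded.subset_closedBall (0 : Sp n)
  obtain ⟨κ, hκ, D, hD, M, hM⟩ := h.exists_conv_bound hn hs N hC (le_max_right R 0)
  refine ⟨κ, hκ, D, hD, M, fun δ hδ hl => ?_⟩
  obtain ⟨G, h1, -, -, h2⟩ := hM δ hδ hl g hN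
    (hR.trans (Metric.closedBall_subset_closedBall (le_max_left _ _)))
  exact ⟨G, h1, h2⟩

section Scale

/-- `max (log ε⁻¹) X`. -/
noncomputable def truncLog (X ε : ℝ) : ℝ := max (Real.log ε⁻¹) X

variable {X ε r : ℝ}

theorem exp_truncLog_le (hX : 0 ≤ X) (hε : ε ∈ Ioc (0 : ℝ) 1) :
    Real.exp (truncLog X ε) ≤ Real.exp X * ε⁻¹ := by
  have h1 : 1 ≤ ε⁻¹ := (one_le_inv₀ hε.1).2 hε.2
  have h2 : 1 ≤ Real.exp X := Real.one_le_exp hX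
  rcases max_cases (Real.log ε⁻¹) X with ⟨h, _⟩ | ⟨h, _⟩
  · rw [truncLog, h, Real.exp_log (by linarith)]
    exact le_mul_of_one_le_left (by linarith) h2
  · rw [truncLog, h]
    exact le_mul_of_one_le_right (by linarith) h1

theorem truncLog_le (hX : 0 ≤ X) (hε : ε ∈ Ioc (0 : ℝ) 1) :
    truncLog X ε ≤ Real.exp X * ε⁻¹ :=
  (by linarith [Real.add_one_le_exp (truncLog X ε)] : _ ≤ Real.exp (truncLog X ε)).trans
    (exp_truncLog_le hX hε)

/-- Truncation is inactive for small `ε`, where the exact logarithm is required; for all `ε` it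
keeps the scale in `(0,1]`. The lower bound follows from `truncLog X ε ≤ exp X * ε⁻¹`. -/
theorem isLogScale_truncLog (hX : 1 ≤ X) (hr : 0 < r) :
    IsLogScale r fun ε => truncLog X ε ^ (-r) where
  positive_net := by
    refine ⟨1, one_pos, Real.exp X ^ (-r), by positivity, ⌈r⌉₊, Nat.ceil_pos.2 hr, fun ε hε => ?_⟩
    have h1 : 1 ≤ truncLog X ε := hX.trans (le_max_right _ _)
    refine ⟨?_, Real.rpow_le_one_of_one_le_of_nonpos h1 (by linarith)⟩
    have h2 := Real.rpow_le_rpow_of_nonpos (by linarith) (truncLog_le (by linarith) hε)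
      (neg_nonpos.2 hr.le)
    have hε0 := hε.1
    have h3 : ε ^ ⌈r⌉₊ ≤ ε ^ r := by
      rw [← Real.rpow_natCast]
      exact Real.rpow_le_rpow_of_exponent_ge hε0 hε.2 (Nat.le_ceil r)
    refine le_trans ?_ h2
    rw [Real.mul_rpow (Real.exp_pos X).le (by positivity), Real.inv_rpow hε0.le,
      Real.rpow_neg hε0.le, inv_inv]
    gcongr
  log_type := by
    have h1 : Tendsto (fun ε : ℝ => Real.log ε⁻¹) (𝓝[>] 0) atTop :=
      Real.tendsto_log_atTop.comp tendsto_inv_nhdsGT_zero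
    filter_upwards [h1.eventually_ge_atTop X] with ε hε
    rw [truncLog, max_eq_left hε, Real.rpow_neg (by linarith), inv_inv]

end Scale

section Levi

variable {n : ℕ} {T p q : ℝ} {a c : Fin n → 𝓢'(ℝ, ℂ)} {d e : 𝓢'(ℝ, ℂ)} {ψ : ℝ → ℝ}

/-- The Levi conditions are read at `exp (-L^θ)`, whose scales of exponents `p` and `q` are exactly
`L^(-θp)` and `L^(-θq)`. The logarithm occurring there is `L^θ ≤ L`, so lowering the exponents by
`θ` does not spoil the constants. The condition `X ≤ L^θ` makes this parameter small enough. -/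
theorem LeviConditions.exists_symbol_bound (h : LeviConditions T a c d e ψ p q) :
    ∃ K ≥ 0, ∃ R ≥ 0, ∃ X ≥ 1, ∀ θ ∈ Ioc (0 : ℝ) 1, ∀ L ≥ 1, X ≤ L ^ θ → ∀ t ∈ Icc 0 T,
      (∀ ξ : Sp n, R ≤ ‖ξ‖ →
        ‖lowerSymbol (fun i => conv (c i) (dilate ψ (L ^ (-(θ * q)))))
          (conv e (dilate ψ (L ^ (-(θ * q))))) t ξ‖ ^ 2 ≤ (K * L) ^ 2 *
          principalSymbol (fun i => conv (a i) (dilate ψ (L ^ (-(θ * p))))) t ξ) ∧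
      ‖conv d (dilate ψ (L ^ (-(θ * q)))) t‖ ≤ K * L := by
  obtain ⟨c₁, hc₁, c₂, hc₂, R, hR, h⟩ := h
  obtain ⟨ε₀, hε₀, hε⟩ := mem_nhdsGT_iff_exists_Ioo_subset.1 h
  have hε₀' : (0 : ℝ) < ε₀ := hε₀
  -- The square of this constant dominates both `2 c₁` and `c₂`.
  refine ⟨2 * c₁ + c₂ + 1, by positivity, R, hR.le, max 1 (Real.log ε₀⁻¹ + 1), le_max_left _ _,
    fun θ hθ L hL hX t ht => ?_⟩
  have hL0 : 0 ≤ L := by linarith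
  have hlL : L ^ θ ≤ L := by simpa using Real.rpow_le_rpow_of_exponent_le hL hθ.2
  have hl1 : 1 ≤ L ^ θ := (le_max_left _ _).trans hX
  have hmem : Real.exp (-L ^ θ) ∈ Ioo 0 ε₀ := by
    refine ⟨Real.exp_pos _, ?_⟩
    have := (le_max_right _ _).trans hX
    rw [Real.log_inv] at this
    rw [← Real.lt_log_iff_exp_lt hε₀']
    linarith
  have hlog : Real.log (Real.exp (-L ^ θ))⁻¹ = L ^ θ := by
    rw [← Real.exp_neg, neg_neg, Real.log_exp]
  have hpow : ∀ r : ℝ, (L ^ θ) ^ (-r) = L ^ (-(θ * r)) := fun r => by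
    rw [← Real.rpow_mul hL0, mul_neg]
  have hsq : (L ^ θ) ^ 2 ≤ L ^ 2 := pow_le_pow_left₀ (by linarith) hlL 2
  have hK : 2 * c₁ + c₂ ≤ (2 * c₁ + c₂ + 1) ^ 2 := by nlinarith
  obtain ⟨h1, h2⟩ := hε hmem t ht
  rw [hlog] at h1 h2
  simp only [hpow] at h1 h2
  constructor
  · intro ξ hξ
    have hn : ‖(-(2 * Real.pi)) • ξ‖ = 2 * Real.pi * ‖ξ‖ := by
      rw [norm_smul, norm_neg, Real.norm_of_nonneg Real.two_pi_pos.le]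
    -- Differentiation corresponds to `-2πi ξ`, so the conditions are needed at `-2π ξ`, whose norm
    -- is still at least `R`.
    have h1' := h1 ((-(2 * Real.pi)) • ξ) (by
      rw [hn]
      nlinarith [Real.pi_gt_three, norm_nonneg ξ])
    have e1 : lowerSymbol (fun i => conv (c i) (dilate ψ (L ^ (-(θ * q)))))
          (conv e (dilate ψ (L ^ (-(θ * q))))) t ξ =
        Complex.I * ∑ i, conv (c i) (dilate ψ (L ^ (-(θ * q)))) t *
          (((-(2 * Real.pi)) • ξ) i : ℂ) + conv e (dilate ψ (L ^ (-(θ * q)))) t := by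
      rw [lowerSymbol, Finset.mul_sum]
      congr 1
      refine Finset.sum_congr rfl fun i _ => ?_
      rw [PiLp.smul_apply, smul_eq_mul]
      push_cast
      ring
    have e2 : principalSymbol (fun i => conv (a i) (dilate ψ (L ^ (-(θ * p))))) t ξ =
        ∑ i, (conv (a i) (dilate ψ (L ^ (-(θ * p)))) t).re * (((-(2 * Real.pi)) • ξ) i) ^ 2 := by
      refine Finset.sum_congr rfl fun i _ => ?_
      rw [PiLp.smul_apply, smul_eq_mul]
      ring
    rw [← e1, ← e2] at h1'
    -- Nonnegativity is forced here by the Levi inequality itself: its left side is a square.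
    have hb : 0 ≤ principalSymbol (fun i => conv (a i) (dilate ψ (L ^ (-(θ * p))))) t ξ := by
      by_contra hneg
      have : c₁ * (L ^ θ) ^ 2 *
          (2 * principalSymbol (fun i => conv (a i) (dilate ψ (L ^ (-(θ * p))))) t ξ) < 0 :=
        mul_neg_of_pos_of_neg (by positivity) (by linarith)
      nlinarith [sq_nonneg ‖lowerSymbol (fun i => conv (c i) (dilate ψ (L ^ (-(θ * q)))))
          (conv e (dilate ψ (L ^ (-(θ * q))))) t ξ‖]
    refine h1'.trans ?_
    rw [← mul_assoc, mul_pow]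
    refine mul_le_mul_of_nonneg_right ?_ hb
    calc c₁ * (L ^ θ) ^ 2 * 2 = (2 * c₁) * (L ^ θ) ^ 2 := by ring
      _ ≤ _ := mul_le_mul (by linarith) hsq (by positivity) (by positivity)
  · refine abs_le_of_sq_le_sq' (h2.trans ?_) (by positivity) |>.2
    rw [mul_pow]
    exact mul_le_mul (by linarith) hsq (by positivity) (by positivity)

theorem norm_lowerSymbol_le {c : Fin n → ℝ → ℂ} {e : ℝ → ℂ} {t Q : ℝ} (hc : ∀ i, ‖c i t‖ ≤ Q)
    (he : ‖e t‖ ≤ Q) (ξ : Sp n) :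
    ‖lowerSymbol c e t ξ‖ ≤ (n * (2 * Real.pi * ‖ξ‖) + 1) * Q := by
  rw [add_mul, one_mul]
  refine (norm_add_le _ _).trans (add_le_add ?_ he)
  refine (norm_sum_le _ _).trans ?_
  have hi : ∀ i, ‖c i t * (-(2 * Real.pi * Complex.I) * (ξ i : ℂ))‖ ≤
      Q * (2 * Real.pi * ‖ξ‖) := fun i => by
    have hξ : ‖ξ i‖ ≤ ‖ξ‖ := PiLp.norm_apply_le ξ i
    have h2 : ‖-(2 * Real.pi * Complex.I) * (ξ i : ℂ)‖ = 2 * Real.pi * ‖ξ i‖ := by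
      rw [norm_mul, norm_neg, norm_mul, Complex.norm_I, mul_one, ← Complex.ofReal_ofNat,
        ← Complex.ofReal_mul, Complex.norm_real, Complex.norm_real,
        Real.norm_of_nonneg Real.two_pi_pos.le]
    rw [norm_mul, h2]
    exact mul_le_mul (hc i) (by gcongr) (by positivity) ((norm_nonneg _).trans (hc i))
  refine (Finset.sum_le_sum fun i _ => hi i).trans (le_of_eq ?_)
  simp
  ring

/-- Mollified coefficients satisfying the Levi conditions have, at logarithmic scales, Levi
constants proportional to the logarithm. -/
theorem LeviConditions.exists_smoothCoefficients (h : LeviConditions T a c d e ψ p q)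
    {B : ℕ → ℝ} (hB : ∀ j, 0 ≤ B j) (M : ℕ) :
    ∃ K > 0, ∃ X ≥ 1, ∀ θ ∈ Ioc (0 : ℝ) 1, ∀ L ≥ 1, X ≤ L ^ θ → ∀ η ≥ 1, η ^ M ≤ L →
      (∀ i, DerivBound T (conv (a i) (dilate ψ (L ^ (-(θ * p))))) fun j => B j * η ^ (j + M)) →
      (∀ i, DerivBound T (conv (c i) (dilate ψ (L ^ (-(θ * q))))) fun j => B j * η ^ (j + M)) →
      DerivBound T (conv d (dilate ψ (L ^ (-(θ * q))))) (fun j => B j * η ^ (j + M)) →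
      DerivBound T (conv e (dilate ψ (L ^ (-(θ * q))))) (fun j => B j * η ^ (j + M)) →
      (∀ i t, 0 ≤ (conv (a i) (dilate ψ (L ^ (-(θ * p)))) t).re) →
      SmoothCoefficients T (fun i => conv (a i) (dilate ψ (L ^ (-(θ * p)))))
        (fun i => conv (c i) (dilate ψ (L ^ (-(θ * q))))) (conv d (dilate ψ (L ^ (-(θ * q)))))
        (conv e (dilate ψ (L ^ (-(θ * q))))) B M η (K * L) := by
  obtain ⟨K, hK, R, hR, X, hX, h⟩ := h.exists_symbol_bound
  have hB0 := hB 0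
  have hK' : 0 ≤ (n * (2 * Real.pi * R) + 1) * B 0 := by positivity
  refine ⟨K + 1 + (n * (2 * Real.pi * R) + 1) * B 0, by positivity, X, hX,
    fun θ hθ L hL hXL η hη hηL hac hcc hdc hec hpos => ?_⟩
  have hL0 : 0 ≤ L := by linarith
  have hKL : K * L ≤ (K + 1 + (n * (2 * Real.pi * R) + 1) * B 0) * L := by gcongr; linarith
  refine ⟨hac, hcc, hdc, hec, hpos, fun t ht ξ => ?_, fun t ht => (h θ hθ L hL hXL t ht).2.trans hKL,
    ?_⟩
  · have hb : 0 ≤ principalSymbol (fun i => conv (a i) (dilate ψ (L ^ (-(θ * p))))) t ξ :=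
      Finset.sum_nonneg fun i _ => mul_nonneg (hpos i t) (sq_nonneg _)
    rcases le_or_gt R ‖ξ‖ with hξ | hξ
    · refine ((h θ hθ L hL hXL t ht).1 ξ hξ).trans ?_
      refine mul_le_mul (pow_le_pow_left₀ (by positivity) hKL 2) (by linarith) hb (by positivity)
    -- Low frequencies, where no Levi condition is given: the coefficients are at most `B 0 * η^M ≤
    -- B 0 * L` and `‖ξ‖ < R`, so the lower symbol is `O(L)`, and the summand 1 next to the
    -- principal symbol suffices.
    · have h0 : ∀ {F : ℝ → ℂ}, DerivBound T F (fun j => B j * η ^ (j + M)) → ‖F t‖ ≤ B 0 * L :=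
        fun hF => by
          have := hF.bound 0 t ht
          rw [iteratedDeriv_zero, zero_add] at this
          exact this.trans (mul_le_mul_of_nonneg_left hηL hB0)
      have h1 := norm_lowerSymbol_le (fun i => h0 (hcc i)) (h0 hec) ξ
      have h2 : (n * (2 * Real.pi * ‖ξ‖) + 1) * (B 0 * L) ≤
          (K + 1 + (n * (2 * Real.pi * R) + 1) * B 0) * L := by
        rw [← mul_assoc]
        refine mul_le_mul_of_nonneg_right ?_ hL0
        have h3 : (n * (2 * Real.pi * ‖ξ‖) + 1) * B 0 ≤ (n * (2 * Real.pi * R) + 1) * B 0 := by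
          gcongr
        linarith
      refine (pow_le_pow_left₀ (norm_nonneg _) (h1.trans h2) 2).trans ?_
      exact le_mul_of_one_le_right (by positivity) (by linarith)
  · nlinarith [mul_nonneg (add_nonneg hK hK') hL0]

end Levi

end VeryWeak

/-! ### The regularised problem at logarithmic scales. -/

namespace VeryWeak

open scoped FourierTransform

theorem rpow_neg_mem_Ioc {L r : ℝ} (hL : 1 ≤ L) (hr : 0 ≤ r) : L ^ (-r) ∈ Ioc (0 : ℝ) 1 :=
  ⟨Real.rpow_pos_of_pos (by linarith) _, Real.rpow_le_one_of_one_le_of_nonpos hL (by linarith)⟩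

theorem inv_rpow_neg_le {L r r' : ℝ} (hL : 1 ≤ L) (hr : r ≤ r') : (L ^ (-r))⁻¹ ≤ L ^ r' := by
  rw [Real.rpow_neg (by linarith), inv_inv]
  exact Real.rpow_le_rpow_of_exponent_le hL hr

theorem rpow_inv_natCast_pow_le {L : ℝ} (hL : 1 ≤ L) {Q j : ℕ} (hQ : Q ≠ 0) (hj : j ≤ Q) :
    (L ^ (Q : ℝ)⁻¹) ^ j ≤ L :=
  (pow_le_pow_right₀ (Real.one_le_rpow hL (by positivity)) hj).trans
    (Real.rpow_inv_natCast_pow (by linarith) hQ).le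

theorem eventually_scale {θ r : ℝ} (hθ : 0 < θ) (hr : 0 < r) (X : ℝ) :
    ∃ Y ≥ 1, ∀ L ≥ Y, X ≤ L ^ θ ∧ 1 ≤ |Real.log (L ^ (-r))| := by
  have h1 : ∀ᶠ L : ℝ in atTop, X ≤ L ^ θ := (tendsto_rpow_atTop hθ).eventually_ge_atTop X
  have h2 : ∀ᶠ L : ℝ in atTop, 1 ≤ r * Real.log L :=
    (Real.tendsto_log_atTop.const_mul_atTop hr).eventually_ge_atTop 1
  obtain ⟨Y, hY⟩ := eventually_atTop.1 (h1.and h2)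
  refine ⟨max Y 1, le_max_right _ _, fun L hL => ?_⟩
  obtain ⟨h3, h4⟩ := hY L ((le_max_left _ _).trans hL)
  have hL0 : 0 < L := one_pos.trans_le ((le_max_right _ _).trans hL)
  refine ⟨h3, ?_⟩
  rw [Real.log_rpow hL0, neg_mul, abs_neg]
  exact h4.trans (le_abs_self _)

variable {n : ℕ} {T s : ℝ} {a c : Fin n → 𝓢'(ℝ, ℂ)} {d e : 𝓢'(ℝ, ℂ)}
  {f : ℝ → 𝓢'(Sp n, ℂ)} {g₀ g₁ : 𝓢'(Sp n, ℂ)} {ψ : ℝ → ℝ} {φ : Sp n → ℂ} {χ : Sp n → ℝ}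

/-- The regularised data at scale `δ` have Fourier transforms with common Gevrey bounds. -/
theorem exists_data_bound (hn : 0 < n) (hT : 0 < T) (hs : 0 < s) (hf : IsContinuousCurve T f)
    (hg₀ : IsCompactlySupported g₀) (hg₁ : IsCompactlySupported g₁)
    (hψ : IsFriedrichsMollifier ψ) (hρ : IsGevreyMollifierPair s φ χ) :
    ∃ κ > 0, ∃ M : ℕ, ∃ B : ℕ → ℝ, (∀ j, 0 ≤ B j) ∧
      ∀ δ ∈ Ioc (0 : ℝ) 1, 1 ≤ |Real.log δ| → ∀ η, δ⁻¹ ≤ η →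
        ∃ (G₀ G₁ : 𝓢(Sp n, ℂ)) (v : ℕ → ℝ → Sp n → ℂ),
        (∀ x, G₀ x = conv g₀ (gevreyMollifier φ χ δ) x) ∧
        (∀ x, G₁ x = conv g₁ (gevreyMollifier φ χ δ) x) ∧
        (∀ ξ, ‖(𝓕⁻ G₀ : 𝓢(Sp n, ℂ)) ξ‖ ≤ B 0 * η ^ M * gevreyWeight s κ η ξ) ∧
        (∀ ξ, ‖(𝓕⁻ G₁ : 𝓢(Sp n, ℂ)) ξ‖ ≤ B 0 * η ^ M * gevreyWeight s κ η ξ) ∧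
        IsGevreyTower T s κ η v (fun k => B k * η ^ (k + M)) ∧
        Continuous (fun z : ℝ × Sp n => v 0 z.1 z.2) ∧
        ∀ t x, mollifyRhs T f ψ φ χ δ t x = 𝓕 (v 0 t) x := by
  obtain ⟨κ₀, hκ₀, D₀, hD₀, M₀, h₀⟩ := hg₀.exists_conv_bound hρ hn hs
  obtain ⟨κ₁, hκ₁, D₁, hD₁, M₁, h₁⟩ := hg₁.exists_conv_bound hρ hn hs
  obtain ⟨κ₂, hκ₂, M₂, D₂, hD₂, h₂⟩ := hf.exists_mollifyRhs_tower hT hρ hψ hn hs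
  refine ⟨min κ₀ (min κ₁ κ₂), lt_min hκ₀ (lt_min hκ₁ hκ₂), M₀ + M₁ + M₂,
    fun j => D₀ + D₁ + D₂ j, fun j => by have := hD₂ j; positivity, fun δ hδ hl η hη => ?_⟩
  obtain ⟨G₀, hG₀, hb₀⟩ := h₀ δ hδ hl
  obtain ⟨G₁, hG₁, hb₁⟩ := h₁ δ hδ hl
  obtain ⟨v, hv, hvc, hvf⟩ := h₂ δ hδ hl
  have hδ0 : 0 < δ⁻¹ := inv_pos.2 hδ.1
  have h1 : 1 ≤ δ⁻¹ := (one_le_inv₀ hδ.1).2 hδ.2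
  have hpow : ∀ {i j : ℕ}, i ≤ j → δ⁻¹ ^ i ≤ η ^ j := fun hij =>
    (pow_le_pow_left₀ hδ0.le hη _).trans (pow_le_pow_right₀ (h1.trans hη) hij)
  have hκ0 : 0 ≤ min κ₀ (min κ₁ κ₂) := (lt_min hκ₀ (lt_min hκ₁ hκ₂)).le
  have hD0 := hD₂ 0
  have hη0 : 0 < η := hδ0.trans_le hη
  refine ⟨G₀, G₁, v, hG₀, hG₁, fun ξ => (hb₀ ξ).trans ?_, fun ξ => (hb₁ ξ).trans ?_,
    hv.mono hs hκ0 ((min_le_right _ _).trans (min_le_right _ _)) hδ0 hη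
      (fun k => by have := hD₂ k; positivity) (fun k => ?_), hvc 0, hvf⟩
  · exact mul_le_mul (mul_le_mul (by linarith) (hpow (by omega)) (by positivity) (by positivity))
      (gevreyWeight_mono hs hκ0 (min_le_left _ _) hδ0 hη ξ) (gevreyWeight_pos ξ).le
      (by positivity)
  · exact mul_le_mul (mul_le_mul (by linarith) (hpow (by omega)) (by positivity) (by positivity))
      (gevreyWeight_mono hs hκ0 ((min_le_right _ _).trans (min_le_left _ _)) hδ0 hη ξ)
      (gevreyWeight_pos ξ).le (by positivity)
  · have := hD₂ k
    exact mul_le_mul (by linarith) (hpow (by omega)) (by positivity) (by positivity)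

/-- The regularised problem at logarithmic scales, `L` being the logarithm of the inverse of the
regularisation parameter: its data and its solution are Fourier transforms with Gevrey bounds in
terms of `L`. -/
theorem exists_regularised_solution (hn : 0 < n) (hT : 0 < T) (hs : 1 ≤ s)
    (ha : ∀ i, IsRealNonneg (a i)) (hf : IsContinuousCurve T f)
    (hg₀ : IsCompactlySupported g₀) (hg₁ : IsCompactlySupported g₁)
    (hψ : IsFriedrichsMollifier ψ) (hρ : IsGevreyMollifierPair s φ χ) :
    ∃ κ > 0, ∃ M Q : ℕ, 0 < Q ∧ ∃ B : ℕ → ℝ, (∀ j, 0 < B j) ∧ ∃ N : ℕ → ℕ, ∃ C > 0,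
      ∀ p > 0, ∀ q > 0, LeviConditions T a c d e ψ p q → ∃ K > 0, ∃ X : ℝ,
      ∀ θ ∈ Ioc (0 : ℝ) 1, θ * p ≤ (Q : ℝ)⁻¹ → θ * q ≤ (Q : ℝ)⁻¹ → ∀ L ≥ 1, X ≤ L ^ θ →
      1 ≤ |Real.log (L ^ (-(θ * p)))| →
      ∃ (G₀ G₁ : 𝓢(Sp n, ℂ)) (v w : ℕ → ℝ → Sp n → ℂ),
        (∀ x, G₀ x = conv g₀ (gevreyMollifier φ χ (L ^ (-(θ * p)))) x) ∧
        (∀ x, G₁ x = conv g₁ (gevreyMollifier φ χ (L ^ (-(θ * p)))) x) ∧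
        (∀ ξ, ‖(𝓕⁻ G₀ : 𝓢(Sp n, ℂ)) ξ‖ ≤ B 0 * L ^ M * gevreyWeight s κ L ξ) ∧
        (∀ ξ, ‖(𝓕⁻ G₁ : 𝓢(Sp n, ℂ)) ξ‖ ≤ B 0 * L ^ M * gevreyWeight s κ L ξ) ∧
        IsGevreyTower T s κ L v (fun k => B k * L ^ (k + M)) ∧
        (∀ t x, mollifyRhs T f ψ φ χ (L ^ (-(θ * p))) t x = 𝓕 (v 0 t) x) ∧
        IsGevreyTower T s κ L w (fun k => B k * L ^ N k * Real.exp (C * (1 + K) * L)) ∧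
        (∀ t ∈ Icc 0 T, ∀ x, iteratedDerivWithin 2 (fun τ => 𝓕 (w 0 τ) x) (Icc 0 T) t
          - ∑ i, conv (a i) (dilate ψ (L ^ (-(θ * p)))) t * pd i (pd i (𝓕 (w 0 t))) x
          + ∑ i, conv (c i) (dilate ψ (L ^ (-(θ * q)))) t * pd i (𝓕 (w 0 t)) x
          + conv d (dilate ψ (L ^ (-(θ * q)))) t * derivWithin (fun τ => 𝓕 (w 0 τ) x) (Icc 0 T) t
          + conv e (dilate ψ (L ^ (-(θ * q)))) t * 𝓕 (w 0 t) x =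
            mollifyRhs T f ψ φ χ (L ^ (-(θ * p))) t x) ∧
        ∀ x, 𝓕 (w 0 0) x = G₀ x ∧ derivWithin (fun τ => 𝓕 (w 0 τ) x) (Icc 0 T) 0 = G₁ x := by
  have hs0 : 0 < s := by linarith
  -- All coefficients are put into one finite family to obtain common constants.
  obtain ⟨Ma, Ba, hBa, hda⟩ := hψ.exists_derivBound T
    (Sum.elim (Sum.elim a c) fun b : Bool => if b then d else e)
  obtain ⟨κ, hκ, Md, Bd, hBd, hdata⟩ := exists_data_bound hn hT hs0 hf hg₀ hg₁ hψ hρ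
  have hBB : ∀ j, 1 ≤ Ba j + Bd j := fun j => by linarith [hBa j, hBd j]
  obtain ⟨C, hC, M₀, G, hG, N, hsol⟩ := exists_solution_tower hT hs hκ hBB n (Ma + Md)
  -- With `Q` above `M₀` and `Ma + Md`, the choice `η = L^(1/Q)` gives `η^M₀ ≤ L`, needed for the
  -- exponential, and `η^(Ma+Md) ≤ L`, needed for low frequencies. Everything chosen here precedes
  -- `p` and `q`.
  refine ⟨κ / 4, by positivity, Ma + Md, M₀ + (Ma + Md) + 1, by omega,
    fun j => Ba j + Bd j + G j, fun j => by linarith [hBB j, hG j], N, C + 8 * T, by positivity,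
    fun p hp q hq hLevi => ?_⟩
  obtain ⟨K, hK, X, hX, hco⟩ := hLevi.exists_smoothCoefficients
    (fun j => zero_le_one.trans (hBB j)) (Ma + Md)
  refine ⟨K, hK, X, fun θ hθ hθp hθq L hL hXL hlog => ?_⟩
  set Q : ℕ := M₀ + (Ma + Md) + 1 with hQ
  have hQ0 : Q ≠ 0 := by omega
  set η : ℝ := L ^ (Q : ℝ)⁻¹ with hη
  have hη1 : 1 ≤ η := Real.one_le_rpow hL (by positivity)
  have hηj : ∀ j ≤ Q, η ^ j ≤ L := fun j hj => rpow_inv_natCast_pow_le hL hQ0 hj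
  have hηL : η ≤ L := by simpa using hηj 1 (by omega)
  have hμ : L ^ (-(θ * p)) ∈ Ioc (0 : ℝ) 1 := rpow_neg_mem_Ioc hL (mul_nonneg hθ.1.le hp.le)
  have hν : L ^ (-(θ * q)) ∈ Ioc (0 : ℝ) 1 := rpow_neg_mem_Ioc hL (mul_nonneg hθ.1.le hq.le)
  -- This is where `θ p ≤ 1/Q` enters: the inverse scale does not exceed `η`.
  have hμη := inv_rpow_neg_le hL hθp
  have hνη := inv_rpow_neg_le hL hθq
  have hη0 : 0 < η := by linarith
  have hL0 : 0 < L := by linarith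
  have hpow : ∀ {i j : ℕ}, i ≤ j → η ^ i ≤ η ^ j := fun h => pow_le_pow_right₀ hη1 h
  have hcoef : ∀ i, ∀ δ ∈ Ioc (0 : ℝ) 1, δ⁻¹ ≤ η → DerivBound T
      (conv (Sum.elim (Sum.elim a c) (fun b : Bool => if b then d else e) i) (dilate ψ δ))
      fun j => (Ba j + Bd j) * η ^ (j + (Ma + Md)) := fun i δ hδ hδη =>
    (hda i δ hδ η hδη).mono fun j => mul_le_mul (by linarith [hBd j]) (hpow (by omega))
      (by positivity) (by linarith [hBB j])
  have hreal : ∀ i t, 0 ≤ (conv (a i) (dilate ψ (L ^ (-(θ * p)))) t).re ∧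
      (conv (a i) (dilate ψ (L ^ (-(θ * p)))) t).im = 0 := fun i t => (ha i).conv_dilate hψ hμ t
  have hsm := hco θ hθ L hL hXL η hη1 (hηj _ (by omega))
    (fun i => hcoef (Sum.inl (Sum.inl i)) _ hμ hμη)
    (fun i => hcoef (Sum.inl (Sum.inr i)) _ hν hνη) (hcoef (Sum.inr true) _ hν hνη)
    (hcoef (Sum.inr false) _ hν hνη) (fun i t => (hreal i t).1)
  obtain ⟨G₀, G₁, v, hG₀, hG₁, hb₀, hb₁, hv, hvc, hvf⟩ := hdata _ hμ hlog η hμη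
  have hWB : ∀ k, 0 ≤ Bd k * η ^ (k + Md) := fun k => mul_nonneg (hBd k) (by positivity)
  have hdB : ∀ k, Bd k * η ^ (k + Md) ≤ (Ba k + Bd k) * η ^ (k + (Ma + Md)) := fun k =>
    mul_le_mul (by linarith [hBa k]) (hpow (by omega)) (by positivity) (by linarith [hBB k])
  have hd0 : ∀ ξ : Sp n, Bd 0 * η ^ Md * gevreyWeight s κ η ξ ≤
      (Ba 0 + Bd 0) * η ^ (Ma + Md) * gevreyWeight s κ η ξ := fun ξ =>
    mul_le_mul_of_nonneg_right (by simpa using hdB 0) (gevreyWeight_pos ξ).le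
  obtain ⟨w, hw, hw0, hw2⟩ := hsol η hη1 _ _ _ _ _ hsm v (𝓕⁻ G₀ : 𝓢(Sp n, ℂ))
    (𝓕⁻ G₁ : 𝓢(Sp n, ℂ)) (hv.mono hs0 hκ.le le_rfl hη0 le_rfl hWB hdB) hvc
    (SchwartzMap.continuous _) (SchwartzMap.continuous _) (fun ξ => (hb₀ ξ).trans (hd0 ξ))
    (fun ξ => (hb₁ ξ).trans (hd0 ξ))
  have hκ4 : κ / 4 ≤ κ := by linarith
  have hBL : ∀ k, Bd k * η ^ (k + Md) ≤ (Ba k + Bd k + G k) * L ^ (k + (Ma + Md)) := fun k =>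
    (hdB k).trans (mul_le_mul (by linarith [hG k]) (pow_le_pow_left₀ hη0.le hηL _)
      (by positivity) (by linarith [hBB k, hG k]))
  have hdL : ∀ ξ : Sp n, Bd 0 * η ^ Md * gevreyWeight s κ η ξ ≤
      (Ba 0 + Bd 0 + G 0) * L ^ (Ma + Md) * gevreyWeight s (κ / 4) L ξ := fun ξ =>
    mul_le_mul (by simpa using hBL 0) (gevreyWeight_mono hs0 (by positivity) hκ4 hη0 hηL ξ)
      (gevreyWeight_pos ξ).le (mul_nonneg (by linarith [hBB 0, hG 0]) (by positivity))
  obtain ⟨A, -, hA⟩ := exists_gevreyTower_bound (T := T) hs0 (by positivity : 0 < κ / 4) n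
  have hwT := (hA η hη1 w _ hw).1
  refine ⟨G₀, G₁, v, w, hG₀, hG₁, fun ξ => (hb₀ ξ).trans (hdL ξ), fun ξ => (hb₁ ξ).trans (hdL ξ),
    hv.mono hs0 (by positivity) hκ4 hη0 hηL hWB hBL, hvf,
    hw.mono hs0 (by positivity) le_rfl hη0 hηL (fun k => ?_) (fun k => ?_), fun t ht x => ?_,
    fun x => ⟨?_, ?_⟩⟩
  · have := hG k
    positivity
  -- Both parts of the exponent are linear in `L`, so for logarithmic `L` the exponential is a power
  -- of `ε⁻¹`.
  · have hexp : C * η ^ M₀ + 8 * (K * L) * T ≤ (C + 8 * T) * (1 + K) * L := by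
      have h1 : C * η ^ M₀ ≤ C * L := mul_le_mul_of_nonneg_left (hηj _ (by omega)) hC.le
      have h2 : 0 ≤ C * K * L + 8 * T * L := by positivity
      nlinarith
    have := hG k
    have hB := hBB k
    exact mul_le_mul (mul_le_mul (by linarith) (pow_le_pow_left₀ hη0.le hηL _) (by positivity)
      (by positivity)) (Real.exp_le_exp.2 hexp) (Real.exp_pos _).le (by positivity)
  · rw [hvf]
    exact hwT.equation_fourier hT ht (fun i => (hreal i t).2) (hw2 t ht) x
  · rw [show w 0 0 = fun ξ => (𝓕⁻ G₀ : 𝓢(Sp n, ℂ)) ξ from funext fun ξ => (hw0 ξ).1]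
    exact fourier_fourierInv_apply G₀ x
  · have h0 : (0 : ℝ) ∈ Icc 0 T := ⟨le_rfl, hT.le⟩
    rw [(hwT.hasDerivWithinAt_fourier 0 x h0).derivWithin (uniqueDiffOn_Icc hT 0 h0),
      show w (0 + 1) 0 = fun ξ => (𝓕⁻ G₁ : 𝓢(Sp n, ℂ)) ξ from funext fun ξ => (hw0 ξ).2]
    exact fourier_fourierInv_apply G₁ x

end VeryWeak

/-! ### Assembly of the very weak solution. -/

namespace VeryWeak

theorem IsTimeGevreyModerate.congr {n : ℕ} {T s : ℝ} {v v' : ℝ → ℝ → Sp n → ℂ}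
    (h : IsTimeGevreyModerate T s v) (hv : ∀ ε t x, v' ε t x = v ε t x) :
    IsTimeGevreyModerate T s v' := by
  have : v' = v := funext fun ε => funext fun t => funext fun x => hv ε t x
  rwa [this]

end VeryWeak

open scoped FourierTransform in
theorem mainTheorem2 (n : ℕ) (hn : 0 < n) (T : ℝ) (hT : 0 < T) (s : ℝ) (hs : 1 < s)
    (a c : Fin n → 𝓢'(ℝ, ℂ)) (d e : 𝓢'(ℝ, ℂ))
    (f : ℝ → 𝓢'(Sp n, ℂ)) (g₀ g₁ : 𝓢'(Sp n, ℂ))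
    (ha_supp : ∀ i, Distribution.dsupport (a i) ⊆ Icc 0 T)
    (ha : ∀ i, IsRealNonneg (a i))
    (hc_supp : ∀ i, Distribution.dsupport (c i) ⊆ Icc 0 T)
    (hd_supp : Distribution.dsupport d ⊆ Icc 0 T)
    (he_supp : Distribution.dsupport e ⊆ Icc 0 T)
    (hf : IsContinuousCurve T f)
    (hg₀ : IsCompactlySupported g₀) (hg₁ : IsCompactlySupported g₁)
    (ψ : ℝ → ℝ) (hψ : IsFriedrichsMollifier ψ)
    (φ : Sp n → ℂ) (χ : Sp n → ℝ) (hρ : IsGevreyMollifierPair s φ χ) :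
    ∃ p₀ > 0, ∀ p > 0, ∀ q > 0, LeviConditions T a c d e ψ p q →
      ∀ θ ∈ Ioc (0 : ℝ) 1, θ * p ≤ p₀ → θ * q ≤ p₀ →
        HasVeryWeakSolution T s a c d e f g₀ g₁ ψ φ χ (θ * p) (θ * q) := by
  have hs0 : 0 < s := by linarith
  obtain ⟨κ, hκ, M, Q, hQ, B, hB, N, C, hC, hsol⟩ :=
    exists_regularised_solution (a := a) (c := c) (d := d) (e := e) hn hT hs.le ha hf hg₀ hg₁ hψ hρ
  refine ⟨(Q : ℝ)⁻¹, by positivity, fun p hp q hq hLevi θ hθ hθp hθq => ?_⟩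
  obtain ⟨K, hK, X, hX⟩ := hsol p hp q hq hLevi
  -- Solutions are required for every `ε` in `(0,1]`, but the estimates need a large logarithm;
  -- truncating it at `Y` makes them available for all `ε`.
  obtain ⟨Y, hY1, hY⟩ := eventually_scale hθ.1 (mul_pos hθ.1 hp) X
  have hL1 : ∀ ε, 1 ≤ truncLog Y ε := fun ε => hY1.trans (le_max_right _ _)
  have hLY : ∀ ε, Y ≤ truncLog Y ε := fun ε => le_max_right _ _
  choose G₀ G₁ v w hG₀ hG₁ hb₀ hb₁ hv hvf hw heq hw0 using fun ε =>
    hX θ hθ hθp hθq (truncLog Y ε) (hL1 ε) (hY _ (hLY ε)).1 (hY _ (hLY ε)).2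
  have hY0 : 0 ≤ Y := by linarith
  have hE : 0 < Real.exp Y := Real.exp_pos Y
  have hLε : ∀ ε ∈ Ioc (0 : ℝ) 1, 1 ≤ truncLog Y ε ∧ truncLog Y ε ≤ Real.exp Y * ε⁻¹ :=
    fun ε hε => ⟨hL1 ε, truncLog_le hY0 hε⟩
  have hpow : ∀ ε ∈ Ioc (0 : ℝ) 1, ∀ j : ℕ, truncLog Y ε ^ j ≤ Real.exp Y ^ j * (ε ^ j)⁻¹ :=
    fun ε hε j => by
      rw [← inv_pow, ← mul_pow]
      exact pow_le_pow_left₀ (by linarith [hL1 ε]) (hLε ε hε).2 j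
  have hscale : ∀ r > 0, r ≤ (Q : ℝ)⁻¹ → ∀ ε ∈ Ioc (0 : ℝ) 1, truncLog Y ε ^ (-r) ∈ Ioc (0 : ℝ) 1 ∧
      (truncLog Y ε ^ (-r))⁻¹ ≤ Real.exp Y * ε⁻¹ := fun r hr hrQ ε hε => by
    refine ⟨rpow_neg_mem_Ioc (hL1 ε) hr.le, (inv_rpow_neg_le (hL1 ε) hrQ).trans (le_trans ?_
      (hLε ε hε).2)⟩
    simpa using rpow_inv_natCast_pow_le (hL1 ε) hQ.ne' hQ
  have hμ := hscale _ (mul_pos hθ.1 hp) hθp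
  have hν := hscale _ (mul_pos hθ.1 hq) hθq
  have hg : ∀ (g : 𝓢'(Sp n, ℂ)) (G : ℝ → 𝓢(Sp n, ℂ)),
      (∀ ε x, G ε x = conv g (gevreyMollifier φ χ (truncLog Y ε ^ (-(θ * p)))) x) →
      (∀ ε ξ, ‖(𝓕⁻ (G ε) : 𝓢(Sp n, ℂ)) ξ‖ ≤
        B 0 * truncLog Y ε ^ M * gevreyWeight s κ (truncLog Y ε) ξ) →
      IsGevreyModerate s fun ε => conv g (gevreyMollifier φ χ (truncLog Y ε ^ (-(θ * p)))) :=
    fun g G hG hb => by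
      refine isGevreyModerate_of_fourierInv hs0 hκ (D := B 0 * Real.exp Y ^ M) (M := M) hE
        (mul_pos (hB 0) (by positivity)) hLε (fun ε _ => hG ε) fun ε hε ξ => (hb ε ξ).trans ?_
      refine mul_le_mul_of_nonneg_right ?_ (gevreyWeight_pos ξ).le
      rw [mul_assoc]
      exact mul_le_mul_of_nonneg_left (hpow ε hε M) (hB 0).le
  refine ⟨fun ε => truncLog Y ε ^ (-(θ * p)), fun ε => truncLog Y ε ^ (-(θ * q)),
    isLogScale_truncLog hY1 (mul_pos hθ.1 hp), isLogScale_truncLog hY1 (mul_pos hθ.1 hq),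
    fun ε t => 𝓕 (w ε 0 t), ?_⟩
  refine ⟨fun i => hψ.isSmoothModerate (a i) hμ, fun i => hψ.isSmoothModerate (c i) hν,
    hψ.isSmoothModerate d hν, hψ.isSmoothModerate e hν, ?_, hg g₀ G₀ hG₀ hb₀, hg g₁ G₁ hG₁ hb₁,
    fun ε _ => heq ε, fun ε _ x => (hw0 ε x).1.trans (hG₀ ε x),
    fun ε _ x => (hw0 ε x).2.trans (hG₁ ε x), ?_⟩
  · refine IsTimeGevreyModerate.congr (isTimeGevreyModerate_fourier hT hs0 hκ hE hLε (w := v)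
      (D := fun k => B k * Real.exp Y ^ (k + M)) (M := fun k => k + M)
      (fun k => mul_pos (hB k) (by positivity)) fun ε hε => ?_) hvf
    have hL0 : 0 < truncLog Y ε := by linarith [hL1 ε]
    refine (hv ε).mono hs0 hκ.le le_rfl hL0 le_rfl
      (fun k => mul_nonneg (hB k).le (by positivity)) fun k => ?_
    rw [mul_assoc]
    exact mul_le_mul_of_nonneg_left (hpow ε hε _) (hB k).le
  -- The exponential factor is at most `exp (J L)`, and `exp L ≤ exp Y * ε⁻¹` turns it into a fixed
  -- power of `ε⁻¹`, the same for every order `k`.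
  · set J : ℕ := ⌈C * (1 + K)⌉₊ with hJ
    refine isTimeGevreyModerate_fourier hT hs0 hκ hE hLε (w := w)
      (D := fun k => B k * Real.exp Y ^ (N k + J)) (M := fun k => N k + J)
      (fun k => mul_pos (hB k) (by positivity)) fun ε hε => ?_
    have hL0 : 0 < truncLog Y ε := by linarith [hL1 ε]
    have hexp : Real.exp (C * (1 + K) * truncLog Y ε) ≤ Real.exp Y ^ J * (ε ^ J)⁻¹ := by
      calc Real.exp (C * (1 + K) * truncLog Y ε) ≤ Real.exp (J * truncLog Y ε) :=
            Real.exp_le_exp.2 (mul_le_mul_of_nonneg_right (Nat.le_ceil _) hL0.le)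
        _ = Real.exp (truncLog Y ε) ^ J := Real.exp_nat_mul _ J
        _ ≤ (Real.exp Y * ε⁻¹) ^ J :=
            pow_le_pow_left₀ (Real.exp_pos _).le (exp_truncLog_le hY0 hε) J
        _ = _ := by rw [mul_pow, inv_pow]
    refine (hw ε).mono hs0 hκ.le le_rfl hL0 le_rfl
      (fun k => mul_nonneg (mul_nonneg (hB k).le (by positivity)) (Real.exp_pos _).le) fun k => ?_
    have hε0 := hε.1
    have h1 := mul_le_mul (hpow ε hε (N k)) hexp (Real.exp_pos _).le (by positivity)
    calc B k * truncLog Y ε ^ N k * Real.exp (C * (1 + K) * truncLog Y ε)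
        = B k * (truncLog Y ε ^ N k * Real.exp (C * (1 + K) * truncLog Y ε)) := by ring
      _ ≤ B k * (Real.exp Y ^ N k * (ε ^ N k)⁻¹ * (Real.exp Y ^ J * (ε ^ J)⁻¹)) :=
          mul_le_mul_of_nonneg_left h1 (hB k).le
      _ = _ := by
          rw [pow_add, pow_add, mul_inv]
          ring
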